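/- Let $\mathsf{K}$ be a field of characteristic $0$ and let $\mathfrak g$ be a nilpotent $L_\infty$-algebra over $\mathsf K$: a $\mathbb Z$-graded vector space with graded antisymmetric brackets $[x_1,\dots,x_k]$, $k\ge1$, of degree $2-k$, satisfying $\sum_{k=1}^n(-1)^k\sum\pm[[x_{i_1},\dots,x_{i_k}],x_{j_1},\dots,x_{j_{n-k}}]=0$ for all $n\ge 1$ (sum over unshuffles, with the sign of the permutation times the Koszul sign), and with terminating lower central series. Write $\delta x=[x]$, $\mathrm{MC}(\mathfrak g)=\{\mu\in\mathfrak g^1:\sum_{\ell\ge1}\frac1{\ell!}[\mu^{\wedge\ell}]=0\}$, and $[x_1,\dots,x_k]_\mu=\sum_{\ell\ge0}\frac1{\ell!}[\mu^{\wedge\ell},x_1,\dots,x_k]$. Let $\Omega_n$ be the dg commutative algebra of polynomial differential forms on the $n$-simplex, with barycentric coordinates $t_0,\dots,t_n$. The tensor product $\mathfrak g\otimes\Omega_n$ is an $L_\infty$-algebra with differential $(d+\delta)(x\otimes a)=\delta x\otimes a+(-1)^{|x|}x\otimes da$ and, for $k\ge2$, brackets $[x_1\otimes a_1,\dots,x_k\otimes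 a_k]=(-1)^{\sum_{i<j}|a_i||x_j|}[x_1,\dots,x_k]\otimes a_1\cdots a_k$. Let $P_\bullet$ be Whitney's projection of $\Omega_\bullet$ onto the elementary forms, and let $s_\bullet$ be any gauge, i.e. a simplicial endomorphism of $\Omega_\bullet$ of degree $-1$ with $\mathrm{Id}-P_\bullet=ds_\bullet+s_\bullet d$ and $s_\bullet^2=0$. Put $\gamma_n(\mathfrak g)=\{\alpha\in\mathrm{MC}(\mathfrak g\otimes\Omega_n): s_n\alpha=0\}$. Let $\varepsilon_1^0$ be evaluation at the vertex $e_0$ (where $t_0=1$), $h_1^0$ the Poincaré homotopy given by integration along the dilations towards $e_0$ (so that $dh_1^0+h_1^0d=\mathrm{Id}-\varepsilon_1^0$), and $R_1^0=(d+\delta)h_1^0$. For $\mu\in\mathrm{MC}(\mathfrak g)$ and $x\in\mathfrak g^0$, denote by $\alpha_1^\mu(x)$ the element $\alpha\in\gamma_1(\mathfrak g)$ with $$\varepsilon_1^0\alpha=\mu,\qquad R_1^0\alpha=-(d+\delta)(x\,t_1),$$ and put $\rho_1^\mu(x)=I_1(\alpha_1^\mu(x))$, the value of $\alpha_1^\mu(x)$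 at the vertex $e_1$. To a rooted tree associate the word obtained by attaching to each vertex with $i$ branches the operation $[x,a_1,\dots,a_i]_\mu$, where $a_1,\dots,a_i$ are the words of the branches. Let $e^k_\mu(x)$ be the sum, over all isomorphism classes of rooted trees with $k$ vertices, of the word of the tree multiplied by the number of its monotone orderings: total orderings of the vertices in which each vertex is greater than its parent, orderings which differ by an automorphism of the tree being identified. **Proposition.** The word depends only on the isomorphism class of the tree, $e^k_\mu(x)=0$ for all sufficiently large $k$, and the element $\alpha_1^\mu(x)$ exists, is unique, and is given by $$\alpha_1^\mu(x)=\mu-\sum_{k=1}^\infty\frac{t_1^k}{k!}\,e^k_\mu(x)+x\,dt_0 .$$ Consequently $$\rho_1^\mu(x)=\mu-\sum_{k=1}^\infty\frac1{k!}\,e^k_\mu(x).$$ If $\mathfrak g$ is a dg Lie algebra (all brackets of more than two elements vanish), then $e^{k+1}_\mu(x)=\mathrm{ad}(x)^k(\delta_\mu x)$ for all $k\ge0$, where $\delta_\mu x=\delta x+[\mu,x]$, and $\rho_1^\mu(x)$ is the Deligne gauge action $$\rho_1^\mu(x)=e^x*\mu=\mu-\sum_{n=0}^\infty\frac{\mathrm{ad}(x)^n(\delta_\mu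 x)}{(n+1)!}.$$ -/

import Mathlib

open scoped TensorProduct Nat

noncomputable section

namespace LieTheory

universe u v

/-! ## Polynomial differential forms on the simplices -/

section Forms

variable (K : Type u) [Field K]

/-- The algebra `Ω_n` of polynomial differential forms on the `n`-simplex. The relations
`t_0 + ⋯ + t_n = 1` and `dt_0 + ⋯ + dt_n = 0` are used to eliminate `t_0` and `dt_0`, so that `Ω_n`
is the free graded commutative algebra `K[t_1, …, t_n] ⊗ Λ(dt_1, …, dt_n)`. The variable `X i` of
index `i : Fin n` is `t_{i+1}`, and the basis vector `e_i` of `Fin n → K` is `dt_{i+1}`. -/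
abbrev Forms (n : ℕ) : Type u :=
  MvPolynomial (Fin n) K ⊗[K] ExteriorAlgebra K (Fin n → K)

/-- The forms of degree `q`. -/
def formsDeg (n q : ℕ) : Submodule K (Forms K n) :=
  LinearMap.range (LinearMap.lTensor (MvPolynomial (Fin n) K)
    (⋀[K]^q (Fin n → K) : Submodule K (ExteriorAlgebra K (Fin n → K))).subtype)

/-- The projection of `Λ(dt_1, …, dt_n)` onto its part of degree `q`. -/
def extProj (n q : ℕ) : ExteriorAlgebra K (Fin n → K) →ₗ[K] ExteriorAlgebra K (Fin n → K) :=
  GradedAlgebra.proj (fun i : ℕ => ⋀[K]^i (Fin n → K)) q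

/-- The projection of `Ω_n` onto the forms of degree `q`. -/
def formsProj (n q : ℕ) : Forms K n →ₗ[K] Forms K n :=
  LinearMap.lTensor _ (extProj K n q)

/-- The exterior differential, `d (f η) = ∑ᵢ (∂f/∂tᵢ) dtᵢ η`. -/
def extDeriv (n : ℕ) : Forms K n →ₗ[K] Forms K n :=
  ∑ i : Fin n, TensorProduct.map (MvPolynomial.pderiv i).toLinearMap
    (LinearMap.mulLeft K (ExteriorAlgebra.ι K (Pi.single i (1 : K) : Fin n → K)))

/-- The barycentric coordinates `t_0, …, t_n` as polynomials in `t_1, …, t_n`. -/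
def bary (n : ℕ) : Fin (n + 1) → MvPolynomial (Fin n) K :=
  Fin.cons (1 - ∑ i : Fin n, MvPolynomial.X i) MvPolynomial.X

/-- The differentials `dt_0, …, dt_n` as combinations of `dt_1, …, dt_n`. -/
def dbary (n : ℕ) : Fin (n + 1) → (Fin n → K) :=
  Fin.cons (-∑ i : Fin n, Pi.single i (1 : K)) (fun i => Pi.single i (1 : K))

/-- The function `t_i`, as an element of `Ω_n`. -/
def coord (n : ℕ) (i : Fin (n + 1)) : Forms K n := bary K n i ⊗ₜ 1

/-- The form `dt_i`, as an element of `Ω_n`. -/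
def dcoord (n : ℕ) (i : Fin (n + 1)) : Forms K n := 1 ⊗ₜ ExteriorAlgebra.ι K (dbary K n i)

/-- The pullback `Ω_n → Ω_m` along a map of vertices `f : {0, …, m} → {0, …, n}`: the algebra
morphism with `t_i ↦ ∑_{f j = i} t_j` and `dt_i ↦ ∑_{f j = i} dt_j`. -/
def pullback {m n : ℕ} (f : Fin (m + 1) → Fin (n + 1)) : Forms K n →ₐ[K] Forms K m :=
  Algebra.TensorProduct.map
    (MvPolynomial.aeval fun i : Fin n => ∑ j with f j = i.succ, bary K m j)
    (ExteriorAlgebra.map (Fintype.linearCombination K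
      fun i : Fin n => ∑ j with f j = i.succ, dbary K m j))

/-- The integral of a polynomial over the `k`-simplex:
`t_1^{a_1} ⋯ t_k^{a_k} ↦ a_1! ⋯ a_k! / (a_1 + ⋯ + a_k + k)!`. -/
def polyIntegral (k : ℕ) : MvPolynomial (Fin k) K →ₗ[K] K :=
  (MvPolynomial.basisMonomials (Fin k) K).constr K
    fun a => ((∏ i, (a i)! : ℕ) : K) / (((∑ i, a i) + k)! : ℕ)

/-- The coefficient of `dt_1 ⋯ dt_k` in an element of `Λ(dt_1, …, dt_k)`. -/
def topCoeff (k : ℕ) : ExteriorAlgebra K (Fin k → K) →ₗ[K] K :=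
  ExteriorAlgebra.liftAlternating (Pi.single k Matrix.detRowAlternating)

/-- The integral of a form over the `k`-simplex. -/
def simplexIntegral (k : ℕ) : Forms K k →ₗ[K] K :=
  LinearMap.mul' K K ∘ₗ TensorProduct.map (polyIntegral K k) (topCoeff K k)

/-- `I_{i_0 … i_k}`: the integral over the `k`-chain spanned by the vertices
`e_{i_0}, …, e_{i_k}`. -/
def chainIntegral {n k : ℕ} (i : Fin (k + 1) → Fin (n + 1)) : Forms K n →ₗ[K] K :=
  simplexIntegral K k ∘ₗ (pullback K i).toLinearMap

/-- The elementary form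
`ω_{i_0 … i_k} = k! ∑_j (-1)^j t_{i_j} dt_{i_0} ⋯ (omit dt_{i_j}) ⋯ dt_{i_k}`. -/
def elementaryForm {n k : ℕ} (i : Fin (k + 1) → Fin (n + 1)) : Forms K n :=
  (k ! : K) • ∑ j : Fin (k + 1), (-1 : K) ^ (j : ℕ) •
    (coord K n (i j) * (List.ofFn fun l : Fin k => dcoord K n (i (j.succAbove l))).prod)

open Classical in
/-- The Whitney projection
`P_n ω = ∑_k ∑_{i_0 < ⋯ < i_k} ω_{i_0 … i_k} I_{i_0 … i_k}(ω)` onto elementary forms. -/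
def whitney (n : ℕ) : Forms K n →ₗ[K] Forms K n :=
  ∑ k ∈ Finset.range (n + 1),
    ∑ i ∈ Finset.univ.filter (fun i : Fin (k + 1) → Fin (n + 1) => StrictMono i),
      (chainIntegral K i).smulRight (elementaryForm K i)

/-- A gauge: a simplicial map `s` of degree `-1` from `Ω_•` to itself with
`1 - P = d s + s d` and `s² = 0`. -/
structure Gauge where
  /-- The operator on `Ω_n`. -/
  op : ∀ n : ℕ, Forms K n →ₗ[K] Forms K n
  op_zero_form : ∀ n, ∀ ω ∈ formsDeg K n 0, op n ω = 0
  op_mem : ∀ n q, ∀ ω ∈ formsDeg K n (q + 1), op n ω ∈ formsDeg K n q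
  simplicial : ∀ {m n : ℕ} (f : Fin (m + 1) → Fin (n + 1)), Monotone f →
    ∀ ω, pullback K f (op n ω) = op m (pullback K f ω)
  contraction : ∀ n ω,
    ω - whitney K n ω = extDeriv K n (op n ω) + op n (extDeriv K n ω)
  op_op : ∀ n ω, op n (op n ω) = 0

/-- Evaluation `ε_n^i` at the vertex `e_i`: it sends `t_j` to `δ_{ij}` and `dt_j` to `0`. -/
def vertexEval (n : ℕ) (i : Fin (n + 1)) : Forms K n →ₗ[K] K :=
  LinearMap.mul' K K ∘ₗ TensorProduct.map
    (MvPolynomial.aeval fun j : Fin n => if j.succ = i then (1 : K) else 0).toLinearMap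
    ExteriorAlgebra.algebraMapInv.toLinearMap

/-- For a polynomial `f` on the `n`-simplex, the polynomial
`t ↦ ∫₀¹ u^q f(u t + (1 - u) e_i) du`. -/
def dilationIntegral (n : ℕ) (i : Fin (n + 1)) (q : ℕ) :
    MvPolynomial (Fin n) K →ₗ[K] MvPolynomial (Fin n) K :=
  Polynomial.lsum (fun l : ℕ => ((l + q + 1 : ℕ) : K)⁻¹ • LinearMap.id) ∘ₗ
    (MvPolynomial.aeval fun j : Fin n =>
      (Polynomial.X * Polynomial.C (MvPolynomial.X j) + (1 - Polynomial.X) *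
        (if j.succ = i then 1 else 0) : Polynomial (MvPolynomial (Fin n) K))).toLinearMap

/-- The Poincaré homotopy `h_n^i = ∫₀¹ u⁻¹ φ_i(u)^* ι(E_i) du` attached to the dilations
`φ_i(u)(t) = u t + (1 - u) e_i`, with `E_i = ∑_j (t_j - δ_{ij}) ∂_j`. Since `φ_i(u)^*` multiplies
both `t_j - δ_{ij}` and every `dt_l` by `u`, for `η` a product of `q + 1` of the `dt_l` it sends
`f η` to `∑_j (t_j - δ_{ij}) (∫₀¹ u^q f(u t + (1 - u) e_i) du) ι(∂_j) η`. -/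
def poincareHomotopy (n : ℕ) (i : Fin (n + 1)) : Forms K n →ₗ[K] Forms K n :=
  ∑ j : Fin n, ∑ q ∈ Finset.range n, TensorProduct.map
    (LinearMap.mulLeft K (MvPolynomial.X j - if j.succ = i then 1 else 0) ∘ₗ
      dilationIntegral K n i q)
    (CliffordAlgebra.contractLeft (Q := (0 : QuadraticForm K (Fin n → K)))
      (LinearMap.proj j : (Fin n → K) →ₗ[K] K) ∘ₗ extProj K n (q + 1))

end Forms

/-! ## Graded vector spaces and `L_∞`-algebras -/

section LInfinity

variable {K : Type u} [Field K] {V : Type v} [AddCommGroup V] [Module K V]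

/-- The parity operator `x ↦ (-1)^{|x|} x` of a graded vector space. -/
def parity (𝒢 : ℤ → Submodule K V) [DirectSum.Decomposition 𝒢] : V →ₗ[K] V :=
  DirectSum.toModule K ℤ V (fun p => ((p.negOnePow : ℤ) : K) • (𝒢 p).subtype) ∘ₗ
    (DirectSum.decomposeLinearEquiv 𝒢).toLinearMap

/-- For the permutation `π` listing first the elements of `I`, then those of its complement (each in
increasing order), the sign of `π` times the Koszul sign of its action on elements of degrees `d`:
the product of `-(-1)^{|x_i| |x_j|}` over the pairs `j < i` with `i ∈ I` and `j ∉ I`. -/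
def unshuffleSign {n : ℕ} (d : Fin n → ℤ) (I : Finset (Fin n)) : ℤˣ :=
  ∏ i ∈ I, ∏ j ∈ Iᶜ with j < i, -(d i * d j).negOnePow

/-- An `L_∞`-algebra on the graded vector space `V = ⨁ 𝒢 i`: graded antisymmetric brackets
`[x_1, …, x_k]`, `k > 0`, of degree `2 - k`, satisfying the Jacobi rules. (There is no bracket of no
elements; by convention `bracket 0 = 0`.) -/
structure LInfinityAlgebra (𝒢 : ℤ → Submodule K V) [DirectSum.Decomposition 𝒢] where
  /-- The bracket of `k` elements. -/
  bracket : ∀ k : ℕ, MultilinearMap K (fun _ : Fin k => V) V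
  bracket_zero : bracket 0 = 0
  bracket_mem : ∀ (k : ℕ) (d : Fin k → ℤ) (x : Fin k → V), (∀ i, x i ∈ 𝒢 (d i)) →
    bracket k x ∈ 𝒢 (2 - k + ∑ i, d i)
  antisymm : ∀ (k : ℕ) (d : Fin k → ℤ) (x : Fin k → V), (∀ i, x i ∈ 𝒢 (d i)) →
    ∀ i j : Fin k, (i : ℕ) + 1 = j →
      bracket k x + (d i * d j).negOnePow • bracket k (x ∘ Equiv.swap i j) = 0
  jacobi : ∀ (n : ℕ) (d : Fin n → ℤ) (x : Fin n → V), (∀ i, x i ∈ 𝒢 (d i)) →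
    ∑ I : Finset (Fin n) with I.Nonempty, (-1 : ℤˣ) ^ I.card • unshuffleSign d I •
      bracket (Iᶜ.card + 1) (Fin.cons (bracket I.card (x ∘ I.orderEmbOfFin rfl))
        (x ∘ Iᶜ.orderEmbOfFin rfl) : Fin (Iᶜ.card + 1) → V) = 0

/-- The curvature `∑_{ℓ ≥ 1} [α, …, α] / ℓ!` (with `ℓ` arguments) attached to a sequence of
brackets; the sum is finite in the nilpotent case. -/
def curvature {W : Type*} [AddCommGroup W] [Module K W] (b : ∀ k : ℕ, (Fin k → W) → W) (α : W) : W :=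
  ∑ᶠ l : ℕ, ((l + 1)! : K)⁻¹ • b (l + 1) fun _ => α

/-- The unsigned extension of a multilinear map to tensor products with an algebra `B`:
`(x_1 ⊗ a_1, …, x_k ⊗ a_k) ↦ m(x_1, …, x_k) ⊗ a_1 ⋯ a_k`. -/
def tensorExtend (B : Type*) [Ring B] [Algebra K B] {W : Type*} [AddCommGroup W] [Module K W] :
    ∀ k : ℕ, MultilinearMap K (fun _ : Fin k => V) W →ₗ[K]
      MultilinearMap K (fun _ : Fin k => V ⊗[K] B) (W ⊗[K] B)
  | 0 =>
    { toFun := fun m => MultilinearMap.constOfIsEmpty K _ (m 0 ⊗ₜ 1)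
      map_add' := fun m m' => by ext; simp [TensorProduct.add_tmul]
      map_smul' := fun c m => by ext; simp [TensorProduct.smul_tmul'] }
  | k + 1 =>
    { toFun := fun m => (TensorProduct.lift (LinearMap.mk₂ K
        (fun (x : V) (a : B) => (LinearMap.lTensor W (LinearMap.mul K B a)).compMultilinearMap
          (tensorExtend B k (m.curryLeft x)))
        (fun x x' a => by ext; simp) (fun c x a => by ext; simp)
        (fun x a a' => by ext z; simp [LinearMap.lTensor_add])
        (fun c x a => by ext z; simp [LinearMap.lTensor_smul]))).uncurryLeft
      map_add' := fun m m' => by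
        ext z
        simp only [LinearMap.uncurryLeft_apply, add_apply]
        generalize z 0 = w
        induction w with
        | zero => simp
        | tmul x a => simp [show (m + m').curryLeft x = m.curryLeft x + m'.curryLeft x from rfl]
        | add w w' hw hw' =>
          simp only [map_add, add_apply, hw, hw']
          abel
      map_smul' := fun c m => by
        ext z
        simp only [LinearMap.uncurryLeft_apply, smul_apply, RingHom.id_apply]
        generalize z 0 = w
        induction w with
        | zero => simp
        | tmul x a => simp [show (c • m).curryLeft x = c • m.curryLeft x from rfl]
        | add w w' hw hw' =>
          simp only [map_add, add_apply, hw, hw', smul_add] }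

namespace LInfinityAlgebra

variable {𝒢 : ℤ → Submodule K V} [DirectSum.Decomposition 𝒢] (L : LInfinityAlgebra 𝒢)

/-- `x ∈ F^i 𝔤`, where `F^1 𝔤 = 𝔤` and `F^i 𝔤 = ∑_{i_1 + ⋯ + i_k = i} [F^{i_1} 𝔤, …, F^{i_k} 𝔤]` for
`i > 1`. (Terms with `k = 1` would be circular and are omitted; by the Jacobi rules the resulting
subspaces are stable under `x ↦ [x]`.) -/
inductive MemLowerCentral : ℕ → V → Prop
  | one (x : V) : MemLowerCentral 1 x
  | bracket {k : ℕ} (hk : 2 ≤ k) (i : Fin k → ℕ) (x : Fin k → V)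
      (h : ∀ j, MemLowerCentral (i j) (x j)) : MemLowerCentral (∑ j, i j) (L.bracket k x)
  | zero (i : ℕ) : MemLowerCentral i 0
  | add {i : ℕ} {x y : V} : MemLowerCentral i x → MemLowerCentral i y → MemLowerCentral i (x + y)
  | smul {i : ℕ} (c : K) {x : V} : MemLowerCentral i x → MemLowerCentral i (c • x)

/-- The lower central series of `L` terminates. -/
def IsNilpotent : Prop := ∃ N, ∀ i ≥ N, ∀ x, L.MemLowerCentral i x → x = 0

/-- The Maurer–Cartan set `MC(𝔤)`. -/
def maurerCartan : Set V := {μ | μ ∈ 𝒢 1 ∧ curvature (K := K) (fun k => L.bracket k) μ = 0}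

/-- The twisted bracket `[x_1, …, x_k]_μ = ∑_ℓ [μ, …, μ, x_1, …, x_k] / ℓ!` (`μ` repeated `ℓ` times);
the sum is finite in the nilpotent case. -/
def twisted (μ : V) {k : ℕ} (x : Fin k → V) : V :=
  ∑ᶠ l : ℕ, (l ! : K)⁻¹ • L.bracket (l + k) (Fin.append (fun _ : Fin l => μ) x)

/-! ### The `L_∞`-algebra `𝔤 ⊗ Ω_n` -/

/-- The differential `d + δ` of `𝔤 ⊗ Ω_n`: `x ⊗ a ↦ [x] ⊗ a + (-1)^{|x|} x ⊗ da`. -/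
def tensorDifferential (n : ℕ) : V ⊗[K] Forms K n →ₗ[K] V ⊗[K] Forms K n :=
  LinearMap.rTensor _ ((L.bracket 1).toLinearMap 0 0) + TensorProduct.map (parity 𝒢) (extDeriv K n)

/-- The brackets of `𝔤 ⊗ Ω_n` with `k ≠ 1` arguments:
`[x_1 ⊗ a_1, …, x_k ⊗ a_k] = (-1)^{∑_{i < j} |a_i| |x_j|} [x_1, …, x_k] ⊗ a_1 ⋯ a_k`.
In the code `p` runs over the possible degrees of `(a_1, …, a_k)`. -/
def tensorMultiBracket (n k : ℕ) :
    MultilinearMap K (fun _ : Fin k => V ⊗[K] Forms K n) (V ⊗[K] Forms K n) :=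
  ∑ p : Fin k → Fin (n + 1),
    (tensorExtend (Forms K n) k (L.bracket k)).compLinearMap fun j =>
      TensorProduct.map (parity 𝒢 ^ ∑ i with i < j, (p i : ℕ)) (formsProj K n (p j))

/-- The brackets of `𝔤 ⊗ Ω_n`. -/
def tensorBracket (n : ℕ) : ∀ k : ℕ, (Fin k → V ⊗[K] Forms K n) → V ⊗[K] Forms K n
  | 1, z => L.tensorDifferential n (z 0)
  | k, z => L.tensorMultiBracket n k z

variable (𝒢) in
/-- The part of `𝔤 ⊗ Ω_n` of total degree `m`. -/
def tensorDeg (n : ℕ) (m : ℤ) : Submodule K (V ⊗[K] Forms K n) :=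
  Submodule.span K {z | ∃ (p : ℤ) (q : ℕ), p + q = m ∧
    ∃ x ∈ 𝒢 p, ∃ a ∈ formsDeg K n q, z = x ⊗ₜ a}

/-- `MC_n(𝔤)`, the Maurer–Cartan set of `𝔤 ⊗ Ω_n`. -/
def MCSimplices (n : ℕ) : Set (V ⊗[K] Forms K n) :=
  {α | α ∈ tensorDeg 𝒢 n 1 ∧ curvature (K := K) (L.tensorBracket n) α = 0}

variable (𝒢) in
/-- The extension to `𝔤 ⊗ Ω_n` of an operator of odd degree on `Ω_n`:
`x ⊗ a ↦ (-1)^{|x|} x ⊗ T a`. -/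
def oddExtend {n : ℕ} (T : Forms K n →ₗ[K] Forms K n) : V ⊗[K] Forms K n →ₗ[K] V ⊗[K] Forms K n :=
  TensorProduct.map (parity 𝒢) T

/-- The `n`-simplices of `γ_•(𝔤)`: the elements of `MC_n(𝔤)` annihilated by the gauge. -/
def gammaSimplices (s : Gauge K) (n : ℕ) : Set (V ⊗[K] Forms K n) :=
  {α | α ∈ L.MCSimplices n ∧ oddExtend 𝒢 (s.op n) α = 0}

/-- The value at the vertex `e_i` of an element of `𝔤 ⊗ Ω_n`. -/
def valueAt {n : ℕ} (i : Fin (n + 1)) (α : V ⊗[K] Forms K n) : V :=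
  TensorProduct.rid K V (LinearMap.lTensor V (vertexEval K n i) α)

/-- The operator `R_n^i = (d + δ) h_n^i` on `𝔤 ⊗ Ω_n`. -/
def potentialPart {n : ℕ} (i : Fin (n + 1)) (α : V ⊗[K] Forms K n) : V ⊗[K] Forms K n :=
  L.tensorDifferential n (oddExtend 𝒢 (poincareHomotopy K n i) α)

/-- `α` is the `1`-simplex `α_1^μ(x)` of `γ_1(𝔤)` determined by `μ ∈ MC(𝔤)` and `x ∈ 𝔤^0`: it takes the
value `μ` at the vertex `e_0`, and `R_1^0 α = -(d + δ)(x ⊗ t_1)`. -/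
def IsOneSimplex (s : Gauge K) (μ x : V) (α : V ⊗[K] Forms K 1) : Prop :=
  α ∈ L.gammaSimplices s 1 ∧ valueAt (0 : Fin 2) α = μ ∧
    L.potentialPart (0 : Fin 2) α = -L.tensorDifferential 1 (x ⊗ₜ coord K 1 1)

/-- The integral `I_1` of an element of `𝔤 ⊗ Ω_1` over the `0`-chain given by the vertex `e_1`. -/
def integralOne (α : V ⊗[K] Forms K 1) : V :=
  TensorProduct.rid K V (LinearMap.lTensor V (chainIntegral K (![1] : Fin 1 → Fin 2)) α)

end LInfinityAlgebra

end LInfinity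

/-! ## Rooted trees -/

/-- A rooted tree with vertex set `Fin k`, given by the parent of each vertex: the root is the only
vertex without parent, and it is an ancestor of every vertex. -/
@[ext]
structure FinTree (k : ℕ) where
  /-- The parent of a vertex. -/
  parent : Fin k → Option (Fin k)
  /-- The root. -/
  root : Fin k
  parent_eq_none : ∀ v, parent v = none ↔ v = root
  reaches_root : ∀ v, Relation.ReflTransGen (fun a b => parent a = some b) v root

namespace FinTree

variable {k : ℕ}

instance : Fintype (FinTree k) := by
  classical
  exact Fintype.ofInjective (fun T : FinTree k => (T.parent, T.root)) fun T S h => by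
    simp only [Prod.mk.injEq] at h
    exact FinTree.ext h.1 h.2

open Classical in
/-- The children of a vertex. -/
def children (T : FinTree k) (v : Fin k) : Finset (Fin k) :=
  Finset.univ.filter fun w => T.parent w = some v

/-- Every vertex is greater than its parent, for the ordering of the vertices by `Fin k`. -/
def IsMonotone (T : FinTree k) : Prop := ∀ v w, T.parent v = some w → w < v

/-- Isomorphism of rooted trees: a renaming of the vertices carries `T` to `S`. -/
instance isoSetoid (k : ℕ) : Setoid (FinTree k) where
  r T S := ∃ σ : Equiv.Perm (Fin k), ∀ v, S.parent (σ v) = (T.parent v).map σ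
  iseqv :=
    { refl := fun T => ⟨Equiv.refl _, fun v => by simp⟩
      symm := by
        rintro T S ⟨σ, h⟩
        refine ⟨σ.symm, fun v => ?_⟩
        have := h (σ.symm v)
        simp only [Equiv.apply_symm_apply] at this
        simp [this]
      trans := by
        rintro T S R ⟨σ, h⟩ ⟨τ, h'⟩
        exact ⟨σ.trans τ, fun v => by simp [h', h]⟩ }

/-- The isomorphism classes of rooted trees with `k` vertices. -/
abbrev IsoClass (k : ℕ) : Type := Quotient (isoSetoid k)

instance : Fintype (IsoClass k) := Fintype.ofFinite _

open Classical in
/-- The number of monotone orderings of the vertices of a rooted tree with `k` vertices, two orderings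
that differ by an automorphism of the tree being identified. Numbering the vertices in increasing
order, such an ordering is the same as a tree on `Fin k` in the isomorphism class in which every vertex
is greater than its parent. -/
def monotoneOrderings (c : IsoClass k) : ℕ :=
  (Finset.univ.filter fun T : FinTree k => T.IsMonotone ∧ (⟦T⟧ : IsoClass k) = c).card

section Word

variable {K : Type u} [Field K] {V : Type v} [AddCommGroup V] [Module K V]
  {𝒢 : ℤ → Submodule K V} [DirectSum.Decomposition 𝒢] (L : LInfinityAlgebra 𝒢) (μ x : V)

/-- The element attached to the vertex `v` of `T`: it is `[x, a_1, …, a_i]_μ`, where `a_1, …, a_i` are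
the elements attached to the children of `v`. The recursion is stopped at the depth given by the first
numeral, which has no effect when this is at least the number of vertices. -/
def vertexWord (T : FinTree k) : ℕ → Fin k → V
  | 0, _ => 0
  | h + 1, v => L.twisted μ
      (Fin.cons x fun j => T.vertexWord h ((T.children v).orderEmbOfFin rfl j) :
        Fin ((T.children v).card + 1) → V)

/-- The word of a rooted tree with `k` vertices. -/
def word (T : FinTree k) : V := T.vertexWord L μ x k T.root

/-- `e^k_μ(x)`: the sum of the words of the rooted trees with `k` vertices up to isomorphism, weighted
by their numbers of monotone orderings. (For `x` of degree `0` and `μ` of degree `1` all the entries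
`a_j` have degree `1`, so that the word only depends on the isomorphism class of the tree.) -/
def expTerm (k : ℕ) : V :=
  ∑ c : IsoClass k, monotoneOrderings c • word L μ x c.out

end Word

end FinTree

/-! ## dg Lie algebras -/

namespace LInfinityAlgebra

variable {K : Type u} [Field K] {V : Type v} [AddCommGroup V] [Module K V]
  {𝒢 : ℤ → Submodule K V} [DirectSum.Decomposition 𝒢] (L : LInfinityAlgebra 𝒢)

/-- An `L_∞`-algebra whose brackets of more than two elements vanish is a dg Lie algebra. -/
def IsDGLie : Prop := ∀ k, 2 < k → L.bracket k = 0

/-- The covariant differential `δ_μ x = δ x + [μ, x]`. -/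
def covDiff (μ x : V) : V := L.bracket 1 ![x] + L.bracket 2 ![μ, x]

/-- The adjoint action `ad(x) y = [x, y]`. -/
def ad (x y : V) : V := L.bracket 2 ![x, y]

/-- The gauge action `e^x * μ = μ - ∑_n ad(x)^n (δ_μ x) / (n + 1)!` in a nilpotent dg Lie algebra. -/
def gaugeAction (x μ : V) : V :=
  μ - ∑ᶠ n : ℕ, ((n + 1)! : K)⁻¹ • (L.ad x)^[n] (L.covDiff μ x)

end LInfinityAlgebra

end LieTheory

end

/-! A form on the interval has only two components, so `α = A(t₁) + B(t₁) dt₁` with `A` of degree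
`1` and `B` of degree `0`. The homotopy `h_1^0` integrates the `dt₁` component from `e_0`, so the
condition on `R_1^0 α` says exactly that `B = -x` is constant (`potentialPart_eq_iff`). The gauge
condition is then automatic: `t₁` is an elementary form, hence every gauge kills `dt₁`, and it kills
functions by degree.

The Maurer–Cartan equation splits into two components. The `dt₁` component is the differential
equation `A' = -[x]_A`, and the function component says that each `A(t)` has zero curvature. The
second follows from the first and from `μ ∈ MC(𝔤)`: the twisted Jacobi rule (`twisted_jacobi`) makes
the curvature satisfy a homogeneous linear equation with zero initial value, and nilpotence forces
it to vanish. So `α` is determined by the solution of `A' = -[x]_A` with `A(0) = μ`. Existence and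
uniqueness among polynomials follow by Picard iteration, each step of which gains one stage of the
lower central filtration.

With `Y = -A` the signs disappear: `Y' = ∑ₗ S(Y, …, Y) / l!`, where `S(a_1, …, a_n) = [x, a_1, …,
a_n]` is symmetric on elements of degree `1`. Differentiating the word of a tree along `Y` attaches
a leaf in all possible ways (`IsMonotone.hasPolyDeriv_symmWord`). Every monotone tree arises in
exactly one way from a smaller one by attaching its last vertex (`sum_monotone_succ`), so the `k`-th
derivative of `Y` is the sum of the words of the monotone trees with `k` vertices. Taylor's formula
at `0`, where `Y = -μ`, gives the expansion in the `e^k_μ(x)`; since it is polynomial, these vanish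
for large `k`. In a dg Lie algebra the equation is affine, `Y' = δx + ad(x) Y`, and its higher
derivatives are iterates of `ad(x)`. -/

noncomputable section

namespace LieTheory

/-! ### Polynomial functions with values in a vector space, and their formal derivatives -/

section PolynomialFunctions

variable {K : Type*} [Field K] {U W : Type*} [AddCommGroup U] [Module K U]
  [AddCommGroup W] [Module K W]

/-- The value at `t` of the polynomial `∑ₙ tⁿ pₙ` with coefficients in a vector space. -/
def polyEval (t : K) : (ℕ →₀ U) →ₗ[K] U :=
  Finsupp.lsum K fun n => t ^ n • LinearMap.id

/-- The formal derivative of a polynomial with coefficients in a vector space. -/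
def polyDeriv : (ℕ →₀ U) →ₗ[K] (ℕ →₀ U) :=
  Finsupp.lsum K fun n => (n : K) • Finsupp.lsingle (n - 1)

@[simp] lemma polyEval_single (t : K) (n : ℕ) (a : U) :
    polyEval t (Finsupp.single n a) = t ^ n • a := by
  simp [polyEval]

@[simp] lemma polyDeriv_single (n : ℕ) (a : U) :
    polyDeriv (K := K) (Finsupp.single n a) = Finsupp.single (n - 1) ((n : K) • a) := by
  simp [polyDeriv]

lemma polyEval_zero (p : ℕ →₀ U) : polyEval (0 : K) p = p 0 := by
  induction p using Finsupp.induction_linear with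
  | zero => simp
  | add f g hf hg => simp [hf, hg]
  | single n a => rcases n with _ | n <;> simp

lemma polyDeriv_apply (p : ℕ →₀ U) (n : ℕ) :
    polyDeriv (K := K) p n = ((n + 1 : ℕ) : K) • p (n + 1) := by
  induction p using Finsupp.induction_linear with
  | zero => simp
  | add f g hf hg => simp [hf, hg]
  | single m a =>
    rcases m with _ | m
    · simp
    · by_cases h : m = n
      · subst h; simp
      · simp [h]

lemma map_polyEval (f : U →ₗ[K] W) (t : K) (p : ℕ →₀ U) :
    f (polyEval t p) = polyEval t (Finsupp.mapRange.linearMap f p) := by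
  induction p using Finsupp.induction_linear with
  | zero => simp
  | add p q hp hq => simp only [map_add, hp, hq]
  | single n a => simp

lemma map_polyDeriv (f : U →ₗ[K] W) (p : ℕ →₀ U) :
    Finsupp.mapRange.linearMap f (polyDeriv (K := K) p) =
      polyDeriv (K := K) (Finsupp.mapRange.linearMap f p) := by
  ext n
  simp [polyDeriv_apply]

/-- Linear functionals reduce this to scalar polynomials, where it holds because a field of
characteristic `0` is infinite. -/
lemma eq_zero_of_polyEval [CharZero K] (p : ℕ →₀ U) (h : ∀ t : K, polyEval t p = 0) : p = 0 := by
  ext n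
  refine (Module.forall_dual_apply_eq_zero_iff K (p n)).mp fun L => ?_
  have key : ∀ q : ℕ →₀ K, ∀ t : K,
      polyEval t q = (Polynomial.ofFinsupp (.ofCoeff q)).eval t := by
    intro q t
    induction q using Finsupp.induction_linear with
    | zero => simp
    | add p q hp hq =>
      simp [hp, hq]
    | single n a =>
      simp [mul_comm]
  have h0 : (Polynomial.ofFinsupp (.ofCoeff (Finsupp.mapRange.linearMap L p)) : Polynomial K) = 0 := by
    refine Polynomial.funext fun t => ?_
    rw [← key, ← map_polyEval, h t]
    simp
  have := congrArg (fun q => Polynomial.coeff q n) h0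
  simpa using this

/-- `f` is a polynomial function with formal derivative `g`. -/
def HasPolyDeriv (f g : K → U) : Prop :=
  ∃ p : ℕ →₀ U, (∀ t, f t = polyEval t p) ∧ ∀ t, g t = polyEval t (polyDeriv (K := K) p)

namespace HasPolyDeriv

lemma const (a : U) : HasPolyDeriv (fun _ : K => a) fun _ => 0 :=
  ⟨Finsupp.single 0 a, by simp, by simp⟩

lemma add {f g f' g' : K → U} (hf : HasPolyDeriv f f') (hg : HasPolyDeriv g g') :
    HasPolyDeriv (fun t => f t + g t) fun t => f' t + g' t := by
  obtain ⟨p, hp, hp'⟩ := hf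
  obtain ⟨q, hq, hq'⟩ := hg
  exact ⟨p + q, fun t => by simp [hp, hq], fun t => by simp [hp', hq']⟩

lemma map (L : U →ₗ[K] W) {f f' : K → U} (hf : HasPolyDeriv f f') :
    HasPolyDeriv (fun t => L (f t)) fun t => L (f' t) := by
  obtain ⟨p, hp, hp'⟩ := hf
  exact ⟨Finsupp.mapRange.linearMap L p, fun t => by simp only [hp, map_polyEval],
    fun t => by simp only [hp', map_polyEval, map_polyDeriv]⟩

lemma smul (c : K) {f f' : K → U} (hf : HasPolyDeriv f f') :
    HasPolyDeriv (fun t => c • f t) fun t => c • f' t :=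
  hf.map (c • LinearMap.id)

lemma neg {f f' : K → U} (hf : HasPolyDeriv f f') :
    HasPolyDeriv (fun t => -f t) fun t => -f' t :=
  hf.map (-LinearMap.id)

lemma sub {f g f' g' : K → U} (hf : HasPolyDeriv f f') (hg : HasPolyDeriv g g') :
    HasPolyDeriv (fun t => f t - g t) fun t => f' t - g' t := by
  simpa [sub_eq_add_neg] using hf.add hg.neg

lemma sum {ι : Type*} (s : Finset ι) {f f' : ι → K → U} (h : ∀ i ∈ s, HasPolyDeriv (f i) (f' i)) :
    HasPolyDeriv (fun t => ∑ i ∈ s, f i t) fun t => ∑ i ∈ s, f' i t := by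
  classical
  induction s using Finset.induction_on with
  | empty => simpa using const (K := K) (0 : U)
  | insert i s hi ih =>
    simp only [Finset.sum_insert hi]
    exact (h i (by simp)).add (ih fun j hj => h j (by simp [hj]))

lemma pow_smul (n : ℕ) {f f' : K → U} (hf : HasPolyDeriv f f') :
    HasPolyDeriv (fun t => t ^ n • f t) fun t => ((n : K) * t ^ (n - 1)) • f t + t ^ n • f' t := by
  obtain ⟨p, hp, hp'⟩ := hf
  obtain rfl : f = _ := funext hp
  obtain rfl : f' = _ := funext hp'
  induction p using Finsupp.induction_linear with
  | zero => simpa using const (K := K) (0 : U)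
  -- Both sides are linear in the polynomial `p`, so monomials suffice; the truncated subtractions
  -- in the exponents are harmless because they carry a zero coefficient.
  | add p q h h' =>
    convert (h (by simp) (by simp)).add (h' (by simp) (by simp)) using 2
    · simp
    · simp only [map_add, smul_add]; abel
  | single m a =>
    refine ⟨Finsupp.single (n + m) a, by simp [pow_add, mul_smul], fun t => ?_⟩
    simp only [polyEval_single, polyDeriv_single, smul_smul, ← add_smul]
    congr 1
    rcases n with _ | n
    · rcases m with _ | m <;> simp
    · rcases m with _ | m
      · simp; ring
      · simp only [Nat.cast_add, Nat.cast_one, Nat.add_sub_cancel,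
          show n + 1 + (m + 1) - 1 = n + m + 1 by omega]
        ring

/-- Every polynomial function has a polynomial primitive with prescribed value at `0`. -/
lemma exists_primitive [CharZero K] {f f' : K → U} (hf : HasPolyDeriv f f') (a : U) :
    ∃ F : K → U, HasPolyDeriv F f ∧ F 0 = a := by
  obtain ⟨p, hp, -⟩ := hf
  obtain rfl : f = _ := funext hp
  clear hp
  induction p using Finsupp.induction_linear generalizing a with
  | zero => exact ⟨fun _ => a, by simpa using const (K := K) a, rfl⟩
  | add p q h h' =>
    obtain ⟨F, hF, hF0⟩ := h a
    obtain ⟨G, hG, hG0⟩ := h' 0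
    exact ⟨_, by simpa using hF.add hG, by simp [hF0, hG0]⟩
  | single n b =>
    refine ⟨fun t => a + (t ^ (n + 1) * ((n + 1 : ℕ) : K)⁻¹) • b,
      ⟨Finsupp.single 0 a + Finsupp.single (n + 1) (((n + 1 : ℕ) : K)⁻¹ • b), fun t => ?_,
        fun t => ?_⟩, by simp⟩
    · simp [smul_smul]
    · have : ((n : K) + 1) ≠ 0 := by exact_mod_cast n.succ_ne_zero
      simp [smul_smul, this]

/-- A polynomial function that vanishes at `0` and whose derivative takes values in a subspace takes
values in this subspace. -/
lemma mem_of_deriv_mem [CharZero K] {f f' : K → U} (hf : HasPolyDeriv f f') (G : Submodule K U)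
    (h0 : f 0 ∈ G) (h : ∀ t, f' t ∈ G) (t : K) : f t ∈ G := by
  obtain ⟨p, hp, hp'⟩ := hf
  -- Modulo `G` the derivative is zero, so all coefficients of positive index vanish there, as `n +
  -- 1` is invertible; the constant one is handled by `h0`.
  have hd : polyDeriv (K := K) (Finsupp.mapRange.linearMap G.mkQ p) = 0 := by
    refine eq_zero_of_polyEval (K := K) _ fun t => ?_
    rw [← map_polyDeriv, ← map_polyEval, ← hp']
    simpa using h t
  have hz : Finsupp.mapRange.linearMap G.mkQ p = 0 := by
    ext n
    rcases n with _ | n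
    · have : G.mkQ (p 0) = 0 := by
        rw [← polyEval_zero (K := K), ← hp]; simpa using h0
      simpa using this
    · have h1 := DFunLike.congr_fun hd n
      rw [polyDeriv_apply] at h1
      have : ((n + 1 : ℕ) : K) ≠ 0 := by exact_mod_cast n.succ_ne_zero
      simpa [this, -Nat.cast_add] using h1
  rw [← Submodule.Quotient.mk_eq_zero, ← Submodule.mkQ_apply, hp, map_polyEval, hz, map_zero]

/-- This makes the formal derivative a function of the polynomial function itself: the polynomial in
`HasPolyDeriv` is determined by its values. -/
lemma unique [CharZero K] {f g g' : K → U} (h : HasPolyDeriv f g) (h' : HasPolyDeriv f g') :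
    g = g' := by
  obtain ⟨p, hp, hp'⟩ := h
  obtain ⟨q, hq, hq'⟩ := h'
  have : p - q = 0 := eq_zero_of_polyEval (K := K) _ fun t => by rw [map_sub, ← hp, ← hq, sub_self]
  rw [sub_eq_zero] at this
  subst this
  exact funext fun t => (hp' t).trans (hq' t).symm

/-- Taylor's formula for polynomial functions. -/
lemma taylor [CharZero K] (f : ℕ → K → U) (h : ∀ k, HasPolyDeriv (f k) (f (k + 1))) :
    ∃ N, (∀ k ≥ N, f k 0 = 0) ∧
      ∀ t, f 0 t = ∑ k ∈ Finset.range N, (t ^ k * ((k ! : ℕ) : K)⁻¹) • f k 0 := by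
  obtain ⟨p, hp, -⟩ := h 0
  have hk : ∀ k t, f k t = polyEval t ((polyDeriv (K := K))^[k] p) := by
    intro k
    induction k with
    | zero => simpa using hp
    | succ k ih =>
      have : HasPolyDeriv (f k) fun t => polyEval t ((polyDeriv (K := K))^[k + 1] p) :=
        ⟨_, ih, fun t => by rw [Function.iterate_succ_apply']⟩
      exact fun t => congrFun ((h k).unique this) t
  -- The coefficient of `tⁿ` in the `k`-th derivative; at `n = 0` it is `k!` times the `k`-th
  -- coefficient.
  have hc : ∀ k n, (polyDeriv (K := K))^[k] p n = (((n + k)! : K) * ((n !) : K)⁻¹) • p (n + k) := by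
    intro k
    induction k with
    | zero =>
      intro n
      have : (n ! : K) ≠ 0 := by exact_mod_cast n.factorial_ne_zero
      simp [this]
    | succ k ih =>
      intro n
      rw [Function.iterate_succ_apply', polyDeriv_apply, ih, smul_smul,
        show n + 1 + k = n + (k + 1) by ring, Nat.factorial_succ n]
      congr 1
      have : (n ! : K) ≠ 0 := by exact_mod_cast n.factorial_ne_zero
      have : ((n + 1 : ℕ) : K) ≠ 0 := by exact_mod_cast n.succ_ne_zero
      push_cast at *
      field_simp
  have hk0 : ∀ k, f k 0 = (k ! : K) • p k := fun k => by
    rw [hk, polyEval_zero, hc]; simp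
  refine ⟨p.support.sup id + 1, fun k hk' => ?_, fun t => ?_⟩
  · rw [hk0]
    have : k ∉ p.support := fun hm => by
      have := Finset.le_sup (f := id) hm
      simp only [id] at this
      omega
    simp [Finsupp.notMem_support_iff.mp this]
  · rw [hp, polyEval, Finsupp.lsum_apply, Finsupp.sum]
    trans ∑ k ∈ Finset.range (p.support.sup id + 1), t ^ k • p k
    · refine Finset.sum_subset (fun k hm => ?_) fun k _ hm => ?_
      · have := Finset.le_sup (f := id) hm
        simp only [id] at this
        simp only [Finset.mem_range]
        omega
      · simp [Finsupp.notMem_support_iff.mp hm]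
    · refine Finset.sum_congr rfl fun k _ => ?_
      have : (k ! : K) ≠ 0 := by exact_mod_cast k.factorial_ne_zero
      rw [hk0, smul_smul, mul_assoc, inv_mul_cancel₀ this, mul_one]

end HasPolyDeriv

end PolynomialFunctions

/-! ### Multilinear maps evaluated on lists -/

section ListEval

variable {K : Type*} [Field K] {V W : Type*} [AddCommGroup V] [Module K V]
  [AddCommGroup W] [Module K W]

/-- The value of a family of multilinear maps on a list of arguments. -/
def listEval (m : ∀ n, MultilinearMap K (fun _ : Fin n => V) W) (l : List V) : W :=
  m l.length l.get

variable (m : ∀ n, MultilinearMap K (fun _ : Fin n => V) W)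

/-- Lists avoid transporting tuples along equalities between numbers of arguments; this is the
passage from tuples to lists. -/
lemma listEval_of_get {n : ℕ} (f : Fin n → V) (l : List V) (h : l.length = n)
    (hf : ∀ i (hi : i < l.length), l[i] = f ⟨i, h ▸ hi⟩) : m n f = listEval m l := by
  subst h
  exact congrArg (m _) (funext fun i => (hf i i.2).symm)

lemma listEval_ofFn {n : ℕ} (f : Fin n → V) : listEval m (List.ofFn f) = m n f :=
  (listEval_of_get m f _ (by simp) (by simp)).symm

lemma listEval_cons (a : V) (l : List V) :
    listEval m (a :: l) = m (l.length + 1) (Fin.cons a l.get) :=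
  (listEval_of_get m _ _ (by simp) fun i hi => by rcases i with _ | i <;> rfl).symm

lemma listEval_cons_add (a b : V) (l : List V) :
    listEval m ((a + b) :: l) = listEval m (a :: l) + listEval m (b :: l) := by
  simp only [listEval_cons, MultilinearMap.cons_add]

lemma listEval_cons_smul (c : K) (a : V) (l : List V) :
    listEval m ((c • a) :: l) = c • listEval m (a :: l) := by
  simp only [listEval_cons, MultilinearMap.cons_smul]

end ListEval

/-! ### Symmetric families of multilinear maps and their twisted values -/

/-- A family of symmetric multilinear maps, one for each number of arguments, of which only finitely
many are nonzero. -/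
structure SymmFamily (K U W : Type*) [Field K] [AddCommGroup U] [Module K U]
    [AddCommGroup W] [Module K W] where
  /-- The map with `n` arguments. -/
  map : ∀ n, MultilinearMap K (fun _ : Fin n => U) W
  symm : ∀ (p : List U) (a b : U) (q : List U),
    listEval map (p ++ a :: b :: q) = listEval map (p ++ b :: a :: q)
  /-- The maps with at least `order` arguments vanish. -/
  order : ℕ
  vanish : ∀ n ≥ order, map n = 0

namespace SymmFamily

variable {K : Type*} [Field K] {U W : Type*} [AddCommGroup U] [Module K U]
  [AddCommGroup W] [Module K W] (S : SymmFamily K U W)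

/-- The prefix `p` is there for the induction: an argument in front of the permuted list is moved
into it. -/
lemma listEval_perm {l l' : List U} (h : l.Perm l') (p : List U) :
    listEval S.map (p ++ l) = listEval S.map (p ++ l') := by
  induction h generalizing p with
  | nil => rfl
  | cons a _ ih => simpa using ih (p ++ [a])
  | swap a b l => exact S.symm p b a l
  | trans _ _ ih ih' => exact (ih p).trans (ih' p)

/-- The value of a symmetric family on a multiset of arguments. -/
def app (s : Multiset U) : W :=
  Quot.liftOn s (listEval S.map) fun _ _ h => S.listEval_perm h []

@[simp] lemma app_coe (l : List U) : S.app (l : Multiset U) = listEval S.map l := rfl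

lemma app_ofFn {n : ℕ} (f : Fin n → U) : S.app (Finset.univ.val.map f) = S.map n f := by
  rw [← listEval_ofFn, ← app_coe]
  congr 1
  rw [Fin.univ_val_map]

lemma app_replicate (n : ℕ) (a : U) : S.app (Multiset.replicate n a) = S.map n fun _ => a := by
  rw [← app_ofFn]
  simp

lemma app_cons_add (a b : U) (s : Multiset U) :
    S.app ((a + b) ::ₘ s) = S.app (a ::ₘ s) + S.app (b ::ₘ s) := by
  induction s using Quot.inductionOn with
  | h l => exact listEval_cons_add _ a b l

lemma app_cons_smul (c : K) (a : U) (s : Multiset U) :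
    S.app ((c • a) ::ₘ s) = c • S.app (a ::ₘ s) := by
  induction s using Quot.inductionOn with
  | h l => exact listEval_cons_smul _ c a l

/-- The value of a symmetric family as a linear function of one argument. -/
def appHead (s : Multiset U) : U →ₗ[K] W where
  toFun a := S.app (a ::ₘ s)
  map_add' a b := S.app_cons_add a b s
  map_smul' c a := S.app_cons_smul c a s

lemma appHead_apply (s : Multiset U) (a : U) : S.appHead s a = S.app (a ::ₘ s) := rfl

lemma app_eq_zero (s : Multiset U) (h : S.order ≤ Multiset.card s) : S.app s = 0 := by
  induction s using Quot.inductionOn with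
  | h l =>
    change S.map l.length l.get = 0
    rw [S.vanish _ (show S.order ≤ l.length from h)]
    simp

/-- The derivative of the value of a symmetric family on polynomial functions. -/
lemma hasPolyDeriv_app {ι : Type*} [DecidableEq ι] (s : Multiset ι) (F F' : ι → K → U)
    (h : ∀ i ∈ s, HasPolyDeriv (F i) (F' i)) (r : Multiset U) :
    HasPolyDeriv (fun t => S.app (s.map (F · t) + r)) fun t =>
      (s.map fun i => S.app (F' i t ::ₘ ((s.erase i).map (F · t) + r))).sum := by
  induction s using Multiset.induction_on generalizing r with
  | empty => simpa using HasPolyDeriv.const (K := K) (S.app r)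
  | cons i s ih =>
    replace ih := ih fun j hj => h j (Multiset.mem_cons_of_mem hj)
    -- The first argument is expanded into monomials `tⁿ a`; the scalar `tⁿ` comes out, and the
    -- constant `a` joins the constant arguments `r` to which the induction hypothesis applies.
    have key : ∀ p : ℕ →₀ U,
        HasPolyDeriv (fun t => S.app (polyEval t p ::ₘ (s.map (F · t) + r))) fun t =>
          S.app (polyEval t (polyDeriv (K := K) p) ::ₘ (s.map (F · t) + r)) +
          (s.map fun j => S.app (F' j t ::ₘ polyEval t p ::ₘ
            ((s.erase j).map (F · t) + r))).sum := by
      intro p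
      simp_rw [Multiset.cons_swap _ (polyEval _ p), ← appHead_apply]
      induction p using Finsupp.induction_linear with
      | zero => simpa using HasPolyDeriv.const (K := K) (0 : W)
      | add p q hp hq =>
        convert hp.add hq using 2
        · simp
        · simp only [map_add, Multiset.sum_map_add]
          abel
      | single n a =>
        convert (ih (a ::ₘ r)).pow_smul n using 2
        · simp [appHead_apply]
        · rename_i t
          simp only [polyEval_single, polyDeriv_single, map_smul, Multiset.add_cons, appHead_apply,
            smul_smul, mul_comm (t ^ (n - 1)), Multiset.smul_sum, Multiset.map_map]
          congr 3
          funext j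
          simp [Multiset.cons_swap a]
    obtain ⟨p, hp, hp'⟩ := h i (Multiset.mem_cons_self i s)
    convert key p using 2
    · simp [hp]
    · rename_i t
      simp only [Multiset.map_cons, Multiset.sum_cons, Multiset.erase_cons_head, hp']
      congr 2
      refine Multiset.map_congr rfl fun j hj => ?_
      rw [Multiset.erase_cons_tail_of_mem hj, Multiset.map_cons, hp, Multiset.cons_add]

/-- The value of a symmetric family twisted by `y`: the sum `∑ₗ S(y, …, y, s) / l!`. -/
def tw (y : U) (s : Multiset U) : W :=
  ∑ l ∈ Finset.range S.order, ((l ! : ℕ) : K)⁻¹ • S.app (Multiset.replicate l y + s)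

lemma tw_eq_sum (y : U) (s : Multiset U) {N : ℕ} (hN : S.order ≤ N) :
    S.tw y s = ∑ l ∈ Finset.range N, ((l ! : ℕ) : K)⁻¹ • S.app (Multiset.replicate l y + s) := by
  refine Finset.sum_subset (Finset.range_mono hN) fun l _ hl => ?_
  rw [S.app_eq_zero, smul_zero]
  simp only [Finset.mem_range, not_lt] at hl
  simp only [Multiset.card_add, Multiset.card_replicate]
  omega

/-- The twisted value as a linear function of one argument. -/
def twHead (y : U) (s : Multiset U) : U →ₗ[K] W :=
  ∑ l ∈ Finset.range S.order, ((l ! : ℕ) : K)⁻¹ • S.appHead (Multiset.replicate l y + s)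

lemma twHead_apply (y : U) (s : Multiset U) (a : U) : S.twHead y s a = S.tw y (a ::ₘ s) := by
  simp [twHead, tw, appHead_apply]

/-- The derivative of the twisted value of a symmetric family on polynomial functions. -/
lemma hasPolyDeriv_tw [CharZero K] {ι : Type*} [DecidableEq ι] (s : Finset ι) (F F' : ι → K → U)
    (h : ∀ i ∈ s, HasPolyDeriv (F i) (F' i)) {Y Y' : K → U} (hY : HasPolyDeriv Y Y') :
    HasPolyDeriv (fun t => S.tw (Y t) (s.val.map (F · t))) fun t =>
      S.tw (Y t) (Y' t ::ₘ s.val.map (F · t)) +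
      ∑ i ∈ s, S.tw (Y t) (F' i t ::ₘ (s.erase i).val.map (F · t)) := by
  have key : ∀ l : ℕ, HasPolyDeriv
      (fun t => S.app (Multiset.replicate l (Y t) + s.val.map (F · t))) fun t =>
        l • S.app (Y' t ::ₘ (Multiset.replicate (l - 1) (Y t) + s.val.map (F · t))) +
        ∑ i ∈ s, S.app (F' i t ::ₘ
          (Multiset.replicate l (Y t) + (s.erase i).val.map (F · t))) := by
    intro l
    -- The index `none` stands for the twisting argument `Y`, occurring `l` times; the indices `some
    -- i` stand for the other arguments.
    let G : Option ι → K → U := fun o => o.elim Y F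
    let G' : Option ι → K → U := fun o => o.elim Y' F'
    have := S.hasPolyDeriv_app (Multiset.replicate l none + s.val.map some) G G' (by
      intro o ho
      rcases o with _ | i
      · exact hY
      · refine h i ?_
        simpa [Multiset.mem_replicate] using ho) 0
    convert this using 2
    · simp [G, Function.comp_def]
    · rename_i t
      rw [Multiset.map_add, Multiset.sum_add]
      congr 1
      · rcases l with _ | l
        · simp
        · simp [G, G', Multiset.map_replicate, Function.comp_def, succ_nsmul']
      · rw [Multiset.map_map]
        refine congrArg Multiset.sum (Multiset.map_congr rfl fun i _ => ?_)
        simp only [Function.comp, add_zero, G']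
        rw [Multiset.erase_add_right_neg _ (by simp [Multiset.mem_replicate]),
          ← Multiset.map_erase _ (Option.some_injective _), Multiset.map_add, Multiset.map_map,
          Multiset.map_replicate]
        rfl
  -- The `l` equal derivatives of the copies of `Y` turn `1/l!` into `1/(l - 1)!`; the extra term in
  -- the range makes up for this shift of the index.
  convert HasPolyDeriv.sum (Finset.range (S.order + 1)) fun l _ =>
    (key l).smul ((l ! : ℕ) : K)⁻¹ using 2
  · exact S.tw_eq_sum _ _ (Nat.le_succ _)
  · rename_i t
    simp only [smul_add, Finset.sum_add_distrib, Finset.smul_sum]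
    congr 1
    · rw [Finset.sum_range_succ', tw]
      simp only [Nat.add_sub_cancel, zero_smul, smul_zero, add_zero]
      refine Finset.sum_congr rfl fun l _ => ?_
      rw [Nat.factorial_succ, ← Nat.cast_smul_eq_nsmul K (l + 1), smul_smul, Multiset.add_cons]
      congr 1
      have : ((l + 1 : ℕ) : K) ≠ 0 := by exact_mod_cast l.succ_ne_zero
      rw [Nat.cast_mul, mul_inv]
      field_simp
    · rw [Finset.sum_comm]
      refine Finset.sum_congr rfl fun i _ => ?_
      rw [S.tw_eq_sum _ _ (Nat.le_succ _)]
      simp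

end SymmFamily

/-! ### The differential equation of a nilpotent symmetric family -/

namespace SymmFamily

variable {K : Type*} [Field K] {U : Type*} [AddCommGroup U] [Module K U]
  (S : SymmFamily K U U) (G : ℕ → Submodule K U)
  (hG : ∀ i a s, a ∈ G i → S.app (a ::ₘ s) ∈ G (i + 1))

include hG

/-- The copies of `y` are replaced by `z` one at a time, and each replacement contributes a term
with an argument `y - z`. -/
lemma app_replicate_sub_mem {i : ℕ} {y z : U} (h : y - z ∈ G i) (l : ℕ) (r : Multiset U) :
    S.app (Multiset.replicate l y + r) - S.app (Multiset.replicate l z + r) ∈ G (i + 1) := by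
  induction l generalizing r with
  | zero => simp
  | succ l ih =>
    have h1 := ih (y ::ₘ r)
    have h2 := hG i _ (Multiset.replicate l z + r) h
    rw [← appHead_apply, map_sub, appHead_apply, appHead_apply] at h2
    simp only [Multiset.replicate_succ, Multiset.cons_add, Multiset.add_cons] at h1 ⊢
    simpa using add_mem h1 h2

lemma tw_sub_mem {i : ℕ} {y z : U} (h : y - z ∈ G i) : S.tw y 0 - S.tw z 0 ∈ G (i + 1) := by
  rw [tw, tw, ← Finset.sum_sub_distrib]
  refine sum_mem fun l _ => ?_
  rw [← smul_sub]
  exact Submodule.smul_mem _ _ (S.app_replicate_sub_mem G hG h l 0)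

variable [CharZero K] (h0 : G 0 = ⊤) {M : ℕ} (hM : G M = ⊥)

include h0 hM

/-- The differential equation `Y' = ∑ₗ S(Y, …, Y) / l!` of a nilpotent family has a polynomial
solution. -/
lemma exists_solution (y : U) :
    ∃ Y : K → U, HasPolyDeriv Y (fun t => S.tw (Y t) 0) ∧ Y 0 = y := by
  classical
  -- Picard iteration: `Z` is the iterate after `Y`, and successive iterates agree modulo `G n`.
  have key : ∀ n, ∃ Y Z : K → U, HasPolyDeriv Z (fun t => S.tw (Y t) 0) ∧ Y 0 = y ∧ Z 0 = y ∧
      ∀ t, Z t - Y t ∈ G n := by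
    intro n
    induction n with
    | zero =>
      obtain ⟨Z, hZ, hZ0⟩ := (HasPolyDeriv.const (K := K) (S.tw y 0)).exists_primitive y
      exact ⟨_, Z, hZ, rfl, hZ0, fun t => by simp [h0]⟩
    | succ n ih =>
      obtain ⟨Y, Z, hZ, hY0, hZ0, hn⟩ := ih
      -- Only the polynomiality of `t ↦ S.tw (Z t) 0` is needed here, in order to integrate it.
      have hd := S.hasPolyDeriv_tw (∅ : Finset ℕ) (fun _ _ => 0) (fun _ _ => 0) (by simp) hZ
      simp only [Finset.empty_val, Multiset.map_zero] at hd
      obtain ⟨X, hX, hX0⟩ := hd.exists_primitive y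
      refine ⟨Z, X, hX, hZ0, hX0, fun t => ?_⟩
      exact (hX.sub hZ).mem_of_deriv_mem (G (n + 1)) (by simp [hX0, hZ0])
        (fun t => S.tw_sub_mem G hG (hn t)) t
  obtain ⟨Y, Z, hZ, hY0, hZ0, hn⟩ := key M
  have : Z = Y := funext fun t => by simpa [hM, sub_eq_zero] using hn t
  subst this
  exact ⟨Z, hZ, hZ0⟩

/-- The polynomial solution of the differential equation is unique. -/
lemma solution_unique {Y Z : K → U} (hY : HasPolyDeriv Y fun t => S.tw (Y t) 0)
    (hZ : HasPolyDeriv Z fun t => S.tw (Z t) 0) (h : Y 0 = Z 0) : Y = Z := by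
  have key : ∀ n t, Y t - Z t ∈ G n := by
    intro n
    induction n with
    | zero => simp [h0]
    | succ n ih =>
      exact (hY.sub hZ).mem_of_deriv_mem (G (n + 1)) (by simp [h])
        fun t => S.tw_sub_mem G hG (ih t)
  exact funext fun t => by simpa [hM, sub_eq_zero] using key M t

end SymmFamily

/-! ### Monotone trees and the attachment of leaves -/

namespace FinTree

variable {k : ℕ}

lemma mem_children {T : FinTree k} {v w : Fin k} : w ∈ T.children v ↔ T.parent w = some v := by
  simp [children]

/-- `T.Desc v u` means that `v` is a descendant of `u`, or `u` itself. -/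
def Desc (T : FinTree k) (v u : Fin k) : Prop :=
  Relation.ReflTransGen (fun a b => T.parent a = some b) v u

lemma IsMonotone.le_of_desc {T : FinTree k} (hT : T.IsMonotone) {v u : Fin k} (h : T.Desc v u) :
    u ≤ v := by
  induction h with
  | refl => exact le_rfl
  | tail _ h ih => exact (hT _ _ h).le.trans ih

lemma IsMonotone.lt_of_mem_children {T : FinTree k} (hT : T.IsMonotone) {u c : Fin k}
    (h : c ∈ T.children u) : u < c :=
  hT _ _ (mem_children.mp h)

/-- The ancestors of `v` form a chain, so `c` and `c'` are comparable. If they differed, the path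
from one to the other would pass through their parent `u`, against the monotonicity of the labels.
-/
lemma IsMonotone.desc_unique {T : FinTree k} (hT : T.IsMonotone) {v u c c' : Fin k}
    (hc : c ∈ T.children u) (hc' : c' ∈ T.children u) (h : T.Desc v c) (h' : T.Desc v c') :
    c = c' := by
  have key : ∀ {c c'}, c ∈ T.children u → c' ∈ T.children u → T.Desc c c' → c = c' := by
    intro c c' hc hc' h
    rcases Relation.ReflTransGen.cases_head h with h | ⟨b, hb, h⟩
    · exact h
    · rw [mem_children.mp hc, Option.some_inj] at hb
      subst hb
      exact absurd (hT.le_of_desc h) (not_le.mpr (hT.lt_of_mem_children hc'))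
  have hr : Relator.RightUnique fun a b => T.parent a = some b := fun a b c hb hc =>
    Option.some_inj.mp (hb.symm.trans hc)
  rcases Relation.ReflTransGen.total_of_right_unique hr h h' with h | h
  · exact key hc hc' h
  · exact (key hc' hc h).symm

-- The proper descendants of `u` are partitioned by the children of `u`.
open Classical in
lemma IsMonotone.sum_desc {T : FinTree k} (hT : T.IsMonotone) {M : Type*} [AddCommMonoid M]
    (f : Fin k → M) (u : Fin k) :
    ∑ v with T.Desc v u, f v = f u + ∑ c ∈ T.children u, ∑ v with T.Desc v c, f v := by
  rw [← Finset.sum_biUnion]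
  · rw [← Finset.sum_insert]
    · refine Finset.sum_congr (Finset.ext fun v => ?_) fun _ _ => rfl
      simp only [Finset.mem_filter, Finset.mem_univ, true_and, Finset.mem_insert,
        Finset.mem_biUnion, mem_children]
      rw [Desc, Relation.ReflTransGen.cases_tail_iff, eq_comm]
      exact or_congr Iff.rfl ⟨fun ⟨c, h, h'⟩ => ⟨c, h', h⟩, fun ⟨c, h, h'⟩ => ⟨c, h', h⟩⟩
    · simp only [Finset.mem_biUnion, Finset.mem_filter, Finset.mem_univ, true_and, not_exists,
        not_and]
      exact fun c hc h => absurd (hT.le_of_desc h) (not_le.mpr (hT.lt_of_mem_children hc))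
  · intro c hc c' hc' hne
    refine Finset.disjoint_left.mpr fun v hv hv' => hne ?_
    simp only [Finset.mem_filter, Finset.mem_univ, true_and] at hv hv'
    exact hT.desc_unique hc hc' hv hv'

/-- The tree obtained by attaching a new last vertex to the vertex `v`. -/
def addLeaf (T : FinTree k) (v : Fin k) : FinTree (k + 1) where
  parent := Fin.lastCases (some v.castSucc) fun u => (T.parent u).map Fin.castSucc
  root := T.root.castSucc
  parent_eq_none w := by
    induction w using Fin.lastCases with
    | last => simpa using (Fin.castSucc_lt_last _).ne'
    | cast u => simp [T.parent_eq_none]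
  reaches_root w := by
    have key : ∀ u : Fin k, Relation.ReflTransGen (fun a b => (Fin.lastCases (some v.castSucc)
        (fun u => (T.parent u).map Fin.castSucc) a : Option (Fin (k + 1))) = some b)
        u.castSucc T.root.castSucc := fun u => by
      refine Relation.ReflTransGen.lift Fin.castSucc (fun a b h => ?_) _ _ (T.reaches_root u)
      have h : T.parent a = some b := h
      simp [Function.onFun, h]
    induction w using Fin.lastCases with
    | last => exact .head (by simp) (key v)
    | cast u => exact key u

@[simp] lemma addLeaf_parent_last (T : FinTree k) (v : Fin k) :
    (T.addLeaf v).parent (Fin.last k) = some v.castSucc := by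
  simp [addLeaf]

@[simp] lemma addLeaf_parent_castSucc (T : FinTree k) (v u : Fin k) :
    (T.addLeaf v).parent u.castSucc = (T.parent u).map Fin.castSucc := by
  simp [addLeaf]

lemma IsMonotone.addLeaf {T : FinTree k} (hT : T.IsMonotone) (v : Fin k) :
    (T.addLeaf v).IsMonotone := by
  intro w w' h
  induction w using Fin.lastCases with
  | last =>
    simp only [addLeaf_parent_last, Option.some_inj] at h
    exact h ▸ Fin.castSucc_lt_last _
  | cast u =>
    simp only [addLeaf_parent_castSucc, Option.map_eq_some_iff] at h
    obtain ⟨u', h, rfl⟩ := h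
    exact Fin.castSucc_lt_castSucc_iff.mpr (hT _ _ h)

lemma addLeaf_children_last (T : FinTree k) (v : Fin k) :
    (T.addLeaf v).children (Fin.last k) = ∅ := by
  refine Finset.eq_empty_of_forall_notMem fun w => ?_
  rw [mem_children]
  induction w using Fin.lastCases with
  | last => simp
  | cast u => simp

lemma addLeaf_children_of_ne (T : FinTree k) {u v : Fin k} (h : u ≠ v) :
    (T.addLeaf v).children u.castSucc = (T.children u).map Fin.castSuccEmb := by
  ext w
  rw [mem_children]
  induction w using Fin.lastCases with
  | last => simp [h.symm]
  | cast w => simp [mem_children]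

lemma addLeaf_children_self (T : FinTree k) (v : Fin k) :
    (T.addLeaf v).children v.castSucc =
      Finset.cons (Fin.last k) ((T.children v).map Fin.castSuccEmb)
        (by simp) := by
  ext w
  rw [mem_children]
  induction w using Fin.lastCases with
  | last => simp
  | cast w => simp [mem_children]

lemma addLeaf_injective :
    Function.Injective fun p : FinTree k × Fin k => p.1.addLeaf p.2 := by
  rintro ⟨T, v⟩ ⟨T', v'⟩ h
  have hp : ∀ w, (T.addLeaf v).parent w = (T'.addLeaf v').parent w := fun w =>
    congrArg (fun S : FinTree (k + 1) => S.parent w) h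
  have hv : v = v' := by simpa using hp (Fin.last k)
  have hT : T = T' := by
    refine FinTree.ext (funext fun u => ?_) ?_
    · have := hp u.castSucc
      simp only [addLeaf_parent_castSucc] at this
      exact Option.map_injective (Fin.castSucc_injective k) this
    · exact Fin.castSucc_injective k (congrArg FinTree.root h)
  rw [hv, hT]

/-- In a monotone tree the last vertex has no children, so it can be removed. With at least two
vertices it is not the root, which is `0`. -/
lemma IsMonotone.exists_addLeaf {S : FinTree (k + 2)} (hS : S.IsMonotone) :
    ∃ (T : FinTree (k + 1)) (v : Fin (k + 1)), T.IsMonotone ∧ T.addLeaf v = S := by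
  have hroot : S.root = 0 := Fin.le_zero_iff.mp (hS.le_of_desc (S.reaches_root 0))
  obtain ⟨w, hw⟩ := Option.ne_none_iff_exists'.mp fun h =>
    (Fin.last_pos (n := k)).ne' (((S.parent_eq_none (Fin.last (k + 1))).mp h).trans hroot)
  obtain ⟨v, rfl⟩ := Fin.exists_castSucc_eq.mpr (hS _ _ hw).ne
  -- The parent of a vertex other than the last has a smaller label, so it is not the last vertex
  -- either.
  have hex : ∀ u : Fin (k + 1), ∃ o : Option (Fin (k + 1)),
      o.map Fin.castSucc = S.parent u.castSucc := by
    intro u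
    rcases h : S.parent u.castSucc with _ | w
    · exact ⟨none, rfl⟩
    · obtain ⟨w, rfl⟩ := Fin.exists_castSucc_eq.mpr
        ((hS _ _ h).trans (Fin.castSucc_lt_last u)).ne
      exact ⟨some w, rfl⟩
  choose q hq using hex
  have hq' : ∀ {u w}, q u = some w → w < u := fun {u w} h => by
    have := hq u
    rw [h] at this
    exact Fin.castSucc_lt_castSucc_iff.mp (hS _ _ this.symm)
  have hq0 : ∀ u, q u = none ↔ u = 0 := fun u => by
    have := S.parent_eq_none u.castSucc
    rw [← hq u, Option.map_eq_none_iff, hroot, Fin.castSucc_eq_zero_iff] at this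
    exact this
  refine ⟨⟨q, 0, hq0, fun u => ?_⟩, v, fun _ _ h => hq' h, FinTree.ext (funext fun w => ?_) ?_⟩
  · induction u using WellFoundedLT.induction with
    | ind u ih =>
      rcases h : q u with _ | w
      · rw [(hq0 u).mp h]
      · exact .head h (ih w (hq' h))
  · induction w using Fin.lastCases with
    | last => rw [addLeaf_parent_last, hw]
    | cast u => rw [addLeaf_parent_castSucc, hq]
  · exact hroot.symm

-- Removing the last vertex is inverse to attaching one: a monotone tree records a history of growth
-- by leaves.
open Classical in
lemma sum_monotone_succ {M : Type*} [AddCommMonoid M] (f : FinTree (k + 2) → M) :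
    ∑ S : FinTree (k + 2) with S.IsMonotone, f S =
      ∑ T : FinTree (k + 1) with T.IsMonotone, ∑ v : Fin (k + 1), f (T.addLeaf v) := by
  rw [← Finset.sum_product']
  symm
  refine Finset.sum_bij (fun p _ => p.1.addLeaf p.2) (fun p hp => ?_)
    (fun p _ q _ h => addLeaf_injective h) (fun S hS => ?_) fun _ _ => rfl
  · simp only [Finset.mem_product, Finset.mem_filter, Finset.mem_univ, true_and, and_true] at hp ⊢
    exact hp.addLeaf _
  · simp only [Finset.mem_filter, Finset.mem_univ, true_and] at hS
    obtain ⟨T, v, hT, h⟩ := hS.exists_addLeaf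
    exact ⟨(T, v), by simpa using hT, h⟩

/-! ### Words of trees and their derivatives along a solution -/

section TreeWord

variable {K : Type*} [Field K] {U : Type*} [AddCommGroup U] [Module K U] (S : SymmFamily K U U)

/-- The element attached to a vertex of a tree by the twisted values of a symmetric family, computed
up to a given depth. -/
def symmVertexWord (y : U) (T : FinTree k) : ℕ → Fin k → U
  | 0, _ => 0
  | h + 1, v => S.tw y ((T.children v).val.map (T.symmVertexWord y h))

/-- The words of the children enter as a multiset, so their order is irrelevant. -/
lemma symmVertexWord_of_iso (y : U) {T T' : FinTree k} (σ : Equiv.Perm (Fin k))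
    (hσ : ∀ v, T'.parent (σ v) = (T.parent v).map σ) (h : ℕ) (v : Fin k) :
    T'.symmVertexWord S y h (σ v) = T.symmVertexWord S y h v := by
  induction h generalizing v with
  | zero => rfl
  | succ h ih =>
    have hc : T'.children (σ v) = (T.children v).map σ.toEmbedding := by
      ext w
      obtain ⟨w, rfl⟩ := σ.surjective w
      simp [mem_children, hσ]
    simp only [symmVertexWord, hc, Finset.map_val, Multiset.map_map]
    exact congrArg _ (Multiset.map_congr rfl fun c _ => ih c)

lemma symmVertexWord_of_equiv (y : U) {T T' : FinTree k} (h : T ≈ T') :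
    T.symmVertexWord S y k T.root = T'.symmVertexWord S y k T'.root := by
  obtain ⟨σ, hσ⟩ := h
  have hr : σ T.root = T'.root := by
    rw [← T'.parent_eq_none, hσ, (T.parent_eq_none _).mpr rfl, Option.map_none]
  rw [← hr, symmVertexWord_of_iso S y σ hσ]

/-- The element attached to a vertex of a tree by the twisted values of a symmetric family. -/
def symmWord (y : U) (T : FinTree k) (u : Fin k) : U := T.symmVertexWord S y k u

/-- Labels increase strictly from parent to child, so below `u` there are fewer than `k - u` further
levels and a recursion depth of `k - u` is enough. -/
lemma IsMonotone.symmVertexWord_eq (y : U) {T : FinTree k} (hT : T.IsMonotone) {h h' : ℕ}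
    {u : Fin k} (hu : k ≤ h + u) (hu' : k ≤ h' + u) :
    T.symmVertexWord S y h u = T.symmVertexWord S y h' u := by
  induction h generalizing h' u with
  | zero => omega
  | succ h ih =>
    rcases h' with _ | h'
    · omega
    · refine congrArg (S.tw y) (Multiset.map_congr rfl fun c hc => ?_)
      have : u < c := hT.lt_of_mem_children hc
      rw [Fin.lt_def] at this
      exact ih (by omega) (by omega)

lemma IsMonotone.symmWord_eq (y : U) {T : FinTree k} (hT : T.IsMonotone) (u : Fin k) :
    T.symmWord S y u = S.tw y ((T.children u).val.map (T.symmWord S y)) := by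
  rw [symmWord, hT.symmVertexWord_eq S y (h' := k + 1) (by omega) (by omega)]
  rfl

lemma IsMonotone.symmWord_addLeaf_last (y : U) {T : FinTree k} (hT : T.IsMonotone) (v : Fin k) :
    (T.addLeaf v).symmWord S y (Fin.last k) = S.tw y 0 := by
  rw [(hT.addLeaf v).symmWord_eq, addLeaf_children_last]
  simp

/-- The new leaf lies below `u` only if `v` does, so nothing changes in the branch at `u`. -/
lemma IsMonotone.symmWord_addLeaf_of_not_desc (y : U) {T : FinTree k} (hT : T.IsMonotone)
    {u v : Fin k} (h : ¬T.Desc v u) :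
    (T.addLeaf v).symmWord S y u.castSucc = T.symmWord S y u := by
  induction u using WellFoundedGT.induction with
  | ind u ih =>
    have hne : u ≠ v := fun e => h (e ▸ .refl)
    rw [(hT.addLeaf v).symmWord_eq, hT.symmWord_eq, addLeaf_children_of_ne T hne, Finset.map_val,
      Multiset.map_map]
    refine congrArg _ (Multiset.map_congr rfl fun c hc => ?_)
    exact ih c (hT.lt_of_mem_children hc) fun hd => h (hd.tail (mem_children.mp hc))

/-- The new child of `u` contributes the word `S.tw y 0` of a single vertex, which is the right-hand
side of the differential equation. -/
lemma IsMonotone.symmWord_addLeaf_self (y : U) {T : FinTree k} (hT : T.IsMonotone) (u : Fin k) :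
    (T.addLeaf u).symmWord S y u.castSucc =
      S.tw y (S.tw y 0 ::ₘ (T.children u).val.map (T.symmWord S y)) := by
  rw [(hT.addLeaf u).symmWord_eq, addLeaf_children_self, Finset.cons_val, Multiset.map_cons,
    hT.symmWord_addLeaf_last, Finset.map_val, Multiset.map_map]
  refine congrArg (fun s => S.tw y (_ ::ₘ s)) (Multiset.map_congr rfl fun c hc => ?_)
  exact hT.symmWord_addLeaf_of_not_desc S y fun hd =>
    absurd (hT.le_of_desc hd) (not_le.mpr (hT.lt_of_mem_children hc))

/-- Exactly one child of `u` lies above `v`, and only its word is affected. -/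
lemma IsMonotone.symmWord_addLeaf_of_desc (y : U) {T : FinTree k} (hT : T.IsMonotone)
    {u v c : Fin k} (hc : c ∈ T.children u) (h : T.Desc v c) :
    (T.addLeaf v).symmWord S y u.castSucc =
      S.tw y ((T.addLeaf v).symmWord S y c.castSucc ::ₘ
        ((T.children u).erase c).val.map (T.symmWord S y)) := by
  have hne : u ≠ v := ((hT.lt_of_mem_children hc).trans_le (hT.le_of_desc h)).ne
  rw [(hT.addLeaf v).symmWord_eq, addLeaf_children_of_ne T hne, Finset.map_val, Multiset.map_map,
    ← Multiset.cons_erase (show c ∈ (T.children u).val from hc), Multiset.map_cons]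
  refine congrArg (fun s => S.tw y (_ ::ₘ s)) ?_
  rw [← Finset.erase_val]
  refine Multiset.map_congr rfl fun c' hc' => ?_
  have hc' : c' ∈ (T.children u).erase c := hc'
  rw [Finset.mem_erase] at hc'
  exact hT.symmWord_addLeaf_of_not_desc S y fun hd => hc'.1 (hT.desc_unique hc'.2 hc hd h)

open Classical in
/-- Along a solution of `Y' = ∑ₗ S(Y, …, Y) / l!`, the derivative of the word of a tree is the sum of the
words of the trees obtained by attaching a leaf. -/
lemma IsMonotone.hasPolyDeriv_symmWord [CharZero K] {T : FinTree k} (hT : T.IsMonotone)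
    {Y : K → U} (hY : HasPolyDeriv Y fun t => S.tw (Y t) 0) (u : Fin k) :
    HasPolyDeriv (fun t => T.symmWord S (Y t) u) fun t =>
      ∑ v with T.Desc v u, (T.addLeaf v).symmWord S (Y t) u.castSucc := by
  induction u using WellFoundedGT.induction with
  | ind u ih =>
    convert S.hasPolyDeriv_tw (T.children u) (fun c t => T.symmWord S (Y t) c) _
      (fun c hc => ih c (hT.lt_of_mem_children hc)) hY using 2
    · exact hT.symmWord_eq S _ u
    · rename_i t
      -- Differentiating the twisting argument attaches a leaf to `u` itself; differentiating the
      -- word of a child `c` attaches one in the branch of `c`.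
      rw [hT.sum_desc, hT.symmWord_addLeaf_self]
      congr 1
      refine Finset.sum_congr rfl fun c hc => ?_
      rw [← SymmFamily.twHead_apply, map_sum]
      refine Finset.sum_congr rfl fun v hv => ?_
      rw [SymmFamily.twHead_apply]
      exact hT.symmWord_addLeaf_of_desc S _ hc (by simpa using hv)

open Classical in
/-- The sum of the words of the monotone trees with `k` vertices. -/
def monotoneSum (y : U) (k : ℕ) : U :=
  ∑ T : FinTree k with T.IsMonotone, T.symmWord S y T.root

lemma monotoneSum_one (y : U) : monotoneSum S y 1 = S.tw y 0 := by
  classical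
  let T₀ : FinTree 1 := ⟨fun _ => none, 0, fun v => by simp [Subsingleton.elim v 0],
    fun v => by rw [Subsingleton.elim v 0]⟩
  have h₀ : T₀.IsMonotone := fun v w h => by simp [T₀] at h
  have hu : ∀ T : FinTree 1, T = T₀ := fun T => FinTree.ext
    (funext fun v => (T.parent_eq_none v).mpr (Subsingleton.elim _ _)) (Subsingleton.elim _ _)
  have : (Finset.univ.filter fun T : FinTree 1 => T.IsMonotone) = {T₀} := by
    ext T
    simp [hu T, h₀]
  rw [monotoneSum, this, Finset.sum_singleton, h₀.symmWord_eq]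
  have : T₀.children T₀.root = ∅ :=
    Finset.eq_empty_of_forall_notMem fun w hw => by simp [mem_children, T₀] at hw
  simp [this]

lemma hasPolyDeriv_monotoneSum [CharZero K] {Y : K → U}
    (hY : HasPolyDeriv Y fun t => S.tw (Y t) 0) (k : ℕ) :
    HasPolyDeriv (fun t => monotoneSum S (Y t) (k + 1)) fun t => monotoneSum S (Y t) (k + 2) := by
  classical
  convert HasPolyDeriv.sum (Finset.univ.filter fun T : FinTree (k + 1) => T.IsMonotone)
    fun T hT => ((Finset.mem_filter.mp hT).2).hasPolyDeriv_symmWord S hY T.root using 2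
  · rfl
  rename_i t
  rw [monotoneSum, sum_monotone_succ]
  refine Finset.sum_congr rfl fun T _ => ?_
  rw [Finset.filter_true_of_mem (p := fun v => T.Desc v T.root) fun v _ => T.reaches_root v]
  rfl

end TreeWord

end FinTree

/-! ### The lower central filtration, and brackets of lists -/

namespace LInfinityAlgebra

variable {K : Type*} [Field K] {V : Type*} [AddCommGroup V] [Module K V]
  {𝒢 : ℤ → Submodule K V} [DirectSum.Decomposition 𝒢] (L : LInfinityAlgebra 𝒢)

/-! ### The filtration attached to the lower central series -/

/-- The sum of the `F^j 𝔤` over `j > i`. -/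
def lowerCentralFiltration (i : ℕ) : Submodule K V :=
  Submodule.span K {x | ∃ j > i, L.MemLowerCentral j x}

/-- Taking all `j > i` makes the filtration decreasing by definition and shifts the index, so that
stage `0` is everything. -/
lemma lowerCentralFiltration_zero : L.lowerCentralFiltration 0 = ⊤ :=
  eq_top_iff.mpr fun x _ => Submodule.subset_span ⟨1, one_pos, .one x⟩

lemma IsNilpotent.exists_lowerCentralFiltration_eq_bot {L : LInfinityAlgebra 𝒢}
    (hL : L.IsNilpotent) : ∃ N, L.lowerCentralFiltration N = ⊥ := by
  obtain ⟨N, hN⟩ := hL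
  refine ⟨N, Submodule.span_eq_bot.mpr ?_⟩
  rintro x ⟨j, hj, hx⟩
  exact hN j (le_of_lt hj) x hx

lemma IsNilpotent.exists_bracket_eq_zero {L : LInfinityAlgebra 𝒢} (hL : L.IsNilpotent) :
    ∃ N, ∀ k ≥ N, L.bracket k = 0 := by
  obtain ⟨N, hN⟩ := hL
  refine ⟨N + 2, fun k hk => MultilinearMap.ext fun x => hN k (by omega) _ ?_⟩
  simpa using MemLowerCentral.bracket (L := L) (show 2 ≤ k by omega) (fun _ => 1) x fun j => .one _

/-- The other arguments, of which there is at least one, lie in `F^1`; hence the total index exceeds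
that of `x j` by at least `1`. -/
lemma bracket_mem_lowerCentralFiltration {k : ℕ} (hk : 2 ≤ k) {i : ℕ} (x : Fin k → V) (j : Fin k)
    (hx : x j ∈ L.lowerCentralFiltration i) : L.bracket k x ∈ L.lowerCentralFiltration (i + 1) := by
  have key : L.lowerCentralFiltration i ≤
      (L.lowerCentralFiltration (i + 1)).comap ((L.bracket k).toLinearMap x j) := by
    refine Submodule.span_le.mpr ?_
    rintro y ⟨a, ha, hy⟩
    refine Submodule.subset_span ⟨∑ l, Function.update (fun _ => 1) j a l, ?_,
      .bracket hk (Function.update (fun _ => 1) j a) _ fun l => ?_⟩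
    · rw [Finset.sum_update_of_mem (Finset.mem_univ _)]
      have : (Finset.univ \ {j}).card = k - 1 := by
        rw [Finset.card_sdiff_of_subset (by simp)]
        simp
      simp only [Finset.sum_const, this, smul_eq_mul, mul_one]
      omega
    · by_cases h : l = j
      · subst h; simpa using hy
      · simpa [h] using MemLowerCentral.one (L := L) (x l)
  simpa using key hx

/-! ### The brackets as functions of a list of arguments -/

lemma listEval_bracket_swap (p : List V) {a b : V} (q : List V) {da db : ℤ} (ha : a ∈ 𝒢 da)
    (hb : b ∈ 𝒢 db) (hp : ∀ y ∈ p, ∃ d, y ∈ 𝒢 d) (hq : ∀ y ∈ q, ∃ d, y ∈ 𝒢 d) :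
    listEval L.bracket (p ++ a :: b :: q) =
      -((da * db).negOnePow • listEval L.bracket (p ++ b :: a :: q)) := by
  set l := p ++ a :: b :: q with hl
  have hi : p.length < l.length := by simp [hl]
  have hj : p.length + 1 < l.length := by simp [hl]
  let i : Fin l.length := ⟨p.length, hi⟩
  let j : Fin l.length := ⟨p.length + 1, hj⟩
  have hia : l.get i = a := by simp [i, hl]
  have hjb : l.get j = b := by simp [j, hl, List.getElem_append_right]
  have hij : i ≠ j := by simp [i, j]
  have hd : ∀ v, ∃ d, l.get v ∈ 𝒢 d ∧ (v = i → d = da) ∧ (v = j → d = db) := by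
    intro v
    by_cases hv : v = i
    · exact ⟨da, by rwa [hv, hia], fun _ => rfl, fun h => absurd (hv.symm.trans h) hij⟩
    by_cases hv' : v = j
    · exact ⟨db, by rwa [hv', hjb], fun h => absurd h hv, fun _ => rfl⟩
    have : ∃ d, l.get v ∈ 𝒢 d := by
      have hm : l.get v ∈ p ++ a :: b :: q := List.get_mem l v
      simp only [List.mem_append, List.mem_cons] at hm
      rcases hm with h | h | h | h
      · exact hp _ h
      · exact ⟨da, h ▸ ha⟩
      · exact ⟨db, h ▸ hb⟩
      · exact hq _ h
    obtain ⟨d, hd⟩ := this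
    exact ⟨d, hd, fun h => absurd h hv, fun h => absurd h hv'⟩
  choose d hd hdi hdj using hd
  have h := L.antisymm l.length d l.get hd i j rfl
  rw [hdi i rfl, hdj j rfl] at h
  rw [listEval, eq_neg_of_add_eq_zero_left h]
  congr 2
  refine listEval_of_get _ _ _ (by simp [hl]) fun v hv => ?_
  have hv' : v < l.length := by simpa [hl] using hv
  change _ = l.get (Equiv.swap i j ⟨v, hv'⟩)
  by_cases h1 : v = p.length
  · subst h1
    rw [show (⟨p.length, hv'⟩ : Fin l.length) = i from rfl, Equiv.swap_apply_left, hjb]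
    simp
  by_cases h2 : v = p.length + 1
  · subst h2
    rw [show (⟨p.length + 1, hv'⟩ : Fin l.length) = j from rfl, Equiv.swap_apply_right, hia]
    simp [List.getElem_append_right]
  rw [Equiv.swap_apply_of_ne_of_ne (by simpa [i, Fin.ext_iff] using h1)
    (by simpa [j, Fin.ext_iff] using h2)]
  simp only [hl, List.get_eq_getElem]
  rcases lt_or_ge v p.length with h | h
  · rw [List.getElem_append_left h, List.getElem_append_left h]
  · obtain ⟨c, rfl⟩ := Nat.exists_eq_add_of_le h
    rw [List.getElem_append_right (by omega), List.getElem_append_right (by omega)]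
    simp only [Nat.add_sub_cancel_left]
    rcases c with _ | _ | c
    · omega
    · omega
    · rfl

/-- Moving an element of degree `0` to the front, past elements of degree `1`. -/
lemma listEval_bracket_move {x μ : V} (hx : x ∈ 𝒢 0) (hμ : μ ∈ 𝒢 1) (l : ℕ) (q : List V)
    (hq : ∀ y ∈ q, ∃ d, y ∈ 𝒢 d) :
    listEval L.bracket (List.replicate l μ ++ x :: q) =
      (-1 : K) ^ l • listEval L.bracket (x :: (List.replicate l μ ++ q)) := by
  induction l generalizing q with
  | zero => simp
  | succ l ih =>
    have hr : ∀ q : List V, List.replicate (l + 1) μ ++ q = List.replicate l μ ++ μ :: q := by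
      simp [List.replicate_succ']
    rw [hr, hr, L.listEval_bracket_swap _ _ hμ hx
      (fun y hy => ⟨1, (List.eq_of_mem_replicate hy) ▸ hμ⟩) hq, ih]
    · simp [pow_succ]
    · rintro y (_ | ⟨_, hy⟩)
      · exact ⟨1, hμ⟩
      · exact hq y hy

lemma listEval_bracket_mem (l : List V) (d : List ℤ) (h : List.Forall₂ (fun y e => y ∈ 𝒢 e) l d) :
    listEval L.bracket l ∈ 𝒢 (2 - l.length + d.sum) := by
  obtain ⟨hl, hd⟩ := List.forall₂_iff_get.mp h
  have := L.bracket_mem l.length (fun i => d.get (i.cast hl)) l.get fun i =>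
    hd i i.2 (hl ▸ i.2)
  rw [listEval]
  convert this
  rw [← List.sum_ofFn]
  congr 1
  refine List.ext_getElem (by simp [hl]) fun i h1 h2 => by simp

end LInfinityAlgebra

/-! ### Brackets of elements of degrees `0` and `1` as symmetric families -/

namespace LInfinityAlgebra

variable {K : Type*} [Field K] {V : Type*} [AddCommGroup V] [Module K V]
  {𝒢 : ℤ → Submodule K V} [DirectSum.Decomposition 𝒢] (L : LInfinityAlgebra 𝒢)

omit [DirectSum.Decomposition 𝒢] in
lemma exists_mem_of_mem_map {p : ℤ} (l : List (𝒢 p)) :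
    ∀ y ∈ l.map Subtype.val, ∃ d, y ∈ 𝒢 d := fun y hy => by
  obtain ⟨z, -, rfl⟩ := List.mem_map.mp hy
  exact ⟨p, z.2⟩

/-- For two elements of degree `1` the Koszul sign cancels the sign of the transposition. -/
lemma listEval_bracket_swap_one (p q : List V) {a b : V} (ha : a ∈ 𝒢 1)
    (hb : b ∈ 𝒢 1) (hp : ∀ y ∈ p, ∃ d, y ∈ 𝒢 d) (hq : ∀ y ∈ q, ∃ d, y ∈ 𝒢 d) :
    listEval L.bracket (p ++ a :: b :: q) = listEval L.bracket (p ++ b :: a :: q) := by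
  rw [L.listEval_bracket_swap p q ha hb hp hq]
  simp

/-- With `n` arguments of degree `1` the degree is `2 - (n + 1) + n = 1`, whatever `n` is. -/
lemma listEval_bracket_cons_mem {x : V} (hx : x ∈ 𝒢 0) (l : List (𝒢 1)) :
    listEval L.bracket (x :: l.map Subtype.val) ∈ 𝒢 1 := by
  have := L.listEval_bracket_mem (x :: l.map Subtype.val) (0 :: List.replicate l.length 1)
    (.cons hx (List.forall₂_iff_get.mpr ⟨by simp, fun i h _ => by simp⟩))
  simpa [show (2 : ℤ) - (l.length + 1) + l.length = 1 by ring] using this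

/-- The brackets restricted to the elements of degree `1`. -/
def oneFamily {N : ℕ} (hN : ∀ k ≥ N, L.bracket k = 0) : SymmFamily K (𝒢 1) V where
  map n := (L.bracket n).compLinearMap fun _ => (𝒢 1).subtype
  symm p a b q := by
    have h : ∀ l : List (𝒢 1), listEval (fun n => (L.bracket n).compLinearMap
        fun _ => (𝒢 1).subtype) l = listEval L.bracket (l.map Subtype.val) := fun l =>
      listEval_of_get _ _ _ (by simp) (by simp)
    simp only [h, List.map_append, List.map_cons]
    exact L.listEval_bracket_swap_one _ _ a.2 b.2 (exists_mem_of_mem_map p)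
      (exists_mem_of_mem_map q)
  order := N
  vanish n hn := by
    ext
    simp [hN n hn]

/-- The brackets `[x, a_1, …, a_n]` with `x` of degree `0` as functions of the elements `a_i` of
degree `1`. -/
def zeroMap {x : V} (hx : x ∈ 𝒢 0) (n : ℕ) : MultilinearMap K (fun _ : Fin n => 𝒢 1) (𝒢 1) :=
  (((L.bracket (n + 1)).curryLeft x).compLinearMap fun _ => (𝒢 1).subtype).codRestrict
    (𝒢 1) fun v => by
      have := L.listEval_bracket_cons_mem hx (List.ofFn v)
      rwa [← listEval_of_get _ (Fin.cons x fun i => (v i : V)) _ (by simp)] at this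
      intro i hi
      rcases i with _ | i
      · rfl
      · simp only [List.getElem_cons_succ, List.getElem_map, List.getElem_ofFn]
        rfl

lemma listEval_zeroMap {x : V} (hx : x ∈ 𝒢 0) (l : List (𝒢 1)) :
    ((listEval (L.zeroMap hx) l : 𝒢 1) : V) = listEval L.bracket (x :: l.map Subtype.val) := by
  refine listEval_of_get L.bracket (n := l.length + 1) (Fin.cons x fun i => ((l.get i : 𝒢 1) : V))
    (x :: l.map Subtype.val) (by simp) fun i hi => ?_
  rcases i with _ | i
  · rfl
  · exact List.getElem_map _

/-- The brackets `[x, a_1, …, a_n]` with `x` of degree `0` as a symmetric family of functions of the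
elements `a_i` of degree `1`. -/
def zeroFamily {x : V} (hx : x ∈ 𝒢 0) {N : ℕ} (hN : ∀ k ≥ N, L.bracket k = 0) :
    SymmFamily K (𝒢 1) (𝒢 1) where
  map := L.zeroMap hx
  symm p a b q := by
    rw [Subtype.ext_iff, listEval_zeroMap, listEval_zeroMap]
    simp only [List.map_append, List.map_cons]
    refine L.listEval_bracket_swap_one (x :: _) _ a.2 b.2 ?_ (exists_mem_of_mem_map q)
    rintro y (_ | ⟨_, hy⟩)
    · exact ⟨0, hx⟩
    · exact exists_mem_of_mem_map p y hy
  order := N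
  vanish n hn := by
    ext
    simp [zeroMap, hN (n + 1) (by omega)]

variable {x : V} (hx : x ∈ 𝒢 0) {N : ℕ} (hN : ∀ k ≥ N, L.bracket k = 0)

lemma oneFamily_app (l : List (𝒢 1)) :
    (L.oneFamily hN).app l = listEval L.bracket (l.map Subtype.val) :=
  listEval_of_get L.bracket (n := l.length) (fun i => ((l.get i : 𝒢 1) : V))
    (l.map Subtype.val) (by simp) (by simp)

lemma zeroFamily_app (l : List (𝒢 1)) :
    ((L.zeroFamily hx hN).app l : V) = listEval L.bracket (x :: l.map Subtype.val) :=
  L.listEval_zeroMap hx l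

/-- This is the nilpotence needed for the differential equation: beside `a` there is always the
argument `x`, so the bracket has at least two entries. -/
lemma zeroFamily_app_mem {i : ℕ} {a : 𝒢 1} (s : Multiset (𝒢 1))
    (h : a ∈ (L.lowerCentralFiltration i).comap (𝒢 1).subtype) :
    (L.zeroFamily hx hN).app (a ::ₘ s) ∈ (L.lowerCentralFiltration (i + 1)).comap (𝒢 1).subtype := by
  induction s using Quot.inductionOn with
  | h l =>
    change ((L.zeroFamily hx hN).app ((a :: l : List (𝒢 1)) : Multiset (𝒢 1)) : V) ∈
      L.lowerCentralFiltration (i + 1)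
    rw [zeroFamily_app]
    exact L.bracket_mem_lowerCentralFiltration (by simp) _ ⟨1, by simp⟩ h

lemma app_replicate_neg {U W : Type*} [AddCommGroup U] [Module K U] [AddCommGroup W] [Module K W]
    (S : SymmFamily K U W) (l : ℕ) (y : U) (r : Multiset U) :
    S.app (Multiset.replicate l (-y) + r) =
      (-1 : K) ^ l • S.app (Multiset.replicate l y + r) := by
  induction l generalizing r with
  | zero => simp
  | succ l ih =>
    have := ih (-y ::ₘ r)
    simp only [Multiset.add_cons] at this
    rw [Multiset.replicate_succ, Multiset.cons_add, this, Multiset.replicate_succ, Multiset.cons_add,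
      ← neg_one_smul K y, SymmFamily.app_cons_smul, smul_smul, pow_succ]

/-- The twisted brackets `[x, a_1, …, a_k]_μ` in terms of the twisted values of a symmetric family. -/
lemma twisted_cons {μ : V} (hμ : μ ∈ 𝒢 1) {k : ℕ} (a : Fin k → 𝒢 1) :
    L.twisted μ (Fin.cons x fun j => (a j : V) : Fin (k + 1) → V) =
      ((L.zeroFamily hx hN).tw (-⟨μ, hμ⟩) (Finset.univ.val.map a) : 𝒢 1) := by
  -- Moving `x` to the front past `l` copies of `μ` costs `(-1)^l`, which is absorbed by twisting
  -- with `-μ` instead of `μ`.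
  have key : ∀ l : ℕ, L.bracket (l + (k + 1)) (Fin.append (fun _ : Fin l => μ)
      (Fin.cons x fun j => (a j : V) : Fin (k + 1) → V)) =
      (L.zeroFamily hx hN).app (Multiset.replicate l (-⟨μ, hμ⟩) + Finset.univ.val.map a) := by
    intro l
    rw [app_replicate_neg, Submodule.coe_smul, Fin.univ_val_map, ← Multiset.coe_replicate,
      Multiset.coe_add, zeroFamily_app, ← listEval_ofFn, List.ofFn_fin_append, List.ofFn_cons,
      List.ofFn_const, L.listEval_bracket_move hx hμ]
    · simp [List.map_ofFn, Function.comp_def]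
    · intro y hy
      obtain ⟨j, rfl⟩ := List.mem_ofFn.mp hy
      exact ⟨1, (a j).2⟩
  rw [twisted, finsum_eq_sum_of_support_subset (s := Finset.range N), SymmFamily.tw,
    AddSubmonoidClass.coe_finsetSum]
  · exact Finset.sum_congr rfl fun l _ => by rw [key]; rfl
  · intro l hl
    by_contra h
    simp only [Finset.coe_range, Set.mem_Iio, not_lt] at h
    exact hl (by simp [hN (l + (k + 1)) (by omega)])

lemma vertexWord_eq {μ : V} (hμ : μ ∈ 𝒢 1) {k : ℕ} (T : FinTree k) (h : ℕ) (v : Fin k) :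
    T.vertexWord L μ x h v = (T.symmVertexWord (L.zeroFamily hx hN) (-⟨μ, hμ⟩) h v : 𝒢 1) := by
  induction h generalizing v with
  | zero => rfl
  | succ h ih =>
    rw [FinTree.vertexWord, FinTree.symmVertexWord]
    simp only [ih]
    rw [L.twisted_cons hx hN hμ]
    congr 2
    conv_rhs => rw [← Finset.map_orderEmbOfFin_univ (T.children v) rfl, Finset.map_val,
      Multiset.map_map]
    rfl

lemma word_eq {μ : V} (hμ : μ ∈ 𝒢 1) {k : ℕ} (T : FinTree k) :
    T.word L μ x = (T.symmWord (L.zeroFamily hx hN) (-⟨μ, hμ⟩) T.root : 𝒢 1) :=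
  L.vertexWord_eq hx hN hμ T k T.root

include hx hN in
lemma word_of_equiv {μ : V} (hμ : μ ∈ 𝒢 1) {k : ℕ} {S T : FinTree k} (h : S ≈ T) :
    S.word L μ x = T.word L μ x := by
  rw [L.word_eq hx hN hμ, L.word_eq hx hN hμ]
  exact congrArg _ (FinTree.symmVertexWord_of_equiv _ _ h)

/-- The weight of an isomorphism class counts the monotone trees in it, so grouping all monotone
trees by their class gives the weighted sum. -/
lemma expTerm_eq {μ : V} (hμ : μ ∈ 𝒢 1) (k : ℕ) :
    FinTree.expTerm L μ x k =
      (FinTree.monotoneSum (L.zeroFamily hx hN) (-⟨μ, hμ⟩) k : 𝒢 1) := by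
  classical
  rw [FinTree.expTerm, FinTree.monotoneSum, AddSubmonoidClass.coe_finsetSum,
    ← Finset.sum_fiberwise (g := fun T : FinTree k => (⟦T⟧ : FinTree.IsoClass k))]
  refine Finset.sum_congr rfl fun c _ => ?_
  rw [Finset.filter_filter, FinTree.monotoneOrderings, ← Finset.sum_const]
  refine Finset.sum_congr (by congr!) fun T hT => ?_
  rw [← L.word_eq hx hN hμ]
  refine L.word_of_equiv hx hN hμ (Quotient.exact ?_)
  rw [Quotient.out_eq]
  exact (Finset.mem_filter.mp hT).2.2.symm

end LInfinityAlgebra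

/-! ### The twisted Jacobi rule and the curvature along a solution -/

namespace LInfinityAlgebra

variable {K : Type*} [Field K] {V : Type*} [AddCommGroup V] [Module K V]
  {𝒢 : ℤ → Submodule K V} [DirectSum.Decomposition 𝒢] (L : LInfinityAlgebra 𝒢)

/-- The degrees of the arguments `(x, a, …, a)` with `x` of degree `0` and `a` of degree `1`. -/
def diagDegree (m : ℕ) : Fin (m + 1) → ℤ := Fin.cons 0 fun _ => 1

lemma diagDegree_of_ne {m : ℕ} {i : Fin (m + 1)} (h : i ≠ 0) : diagDegree m i = 1 := by
  obtain ⟨j, rfl⟩ := Fin.exists_succ_eq.mpr h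
  rfl

/-- Here `x` stays in front, and transpositions of elements of degree `1` have sign `+1`. -/
lemma unshuffleSign_diag_of_mem {m : ℕ} {I : Finset (Fin (m + 1))} (h : 0 ∈ I) :
    unshuffleSign (diagDegree m) I = 1 := by
  refine Finset.prod_eq_one fun i hi => Finset.prod_eq_one fun j hj => ?_
  simp only [Finset.mem_filter, Finset.mem_compl] at hj
  have hj0 : j ≠ 0 := fun e => hj.1 (e ▸ h)
  have hi0 : i ≠ 0 := fun e => absurd hj.2 (by simp [e])
  simp [diagDegree_of_ne hi0, diagDegree_of_ne hj0]

/-- Each element of `I` passes `x`, of degree `0`, with sign `-1`; all other transpositions have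
sign `+1`. -/
lemma unshuffleSign_diag_of_notMem {m : ℕ} {I : Finset (Fin (m + 1))} (h : 0 ∉ I) :
    unshuffleSign (diagDegree m) I = (-1) ^ I.card := by
  refine Finset.prod_eq_pow_card fun i hi => ?_
  have hi0 : i ≠ 0 := fun e => h (e ▸ hi)
  rw [Finset.prod_eq_single_of_mem 0]
  · simp [diagDegree]
  · simpa [h] using Fin.pos_iff_ne_zero.mpr hi0
  · intro j _ hj0
    simp [diagDegree_of_ne hi0, diagDegree_of_ne hj0]

omit [AddCommGroup V] in
lemma ofFn_diag_of_mem {m : ℕ} (x a : V) {I : Finset (Fin (m + 1))} (h : 0 ∈ I) :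
    List.ofFn ((Fin.cons x fun _ => a : Fin (m + 1) → V) ∘ I.orderEmbOfFin rfl) =
      x :: List.replicate (I.card - 1) a := by
  have hc : 0 < I.card := Finset.card_pos.mpr ⟨0, h⟩
  have h0 : I.orderEmbOfFin rfl ⟨0, hc⟩ = 0 := by
    rw [Finset.orderEmbOfFin_zero rfl hc]
    exact Fin.le_zero_iff.mp (Finset.min'_le _ _ h)
  refine List.ext_getElem (by simp; omega) fun i h1 h2 => ?_
  rcases i with _ | i
  · simp [h0]
  · have hi : i + 1 < I.card := by simpa using h1
    have : I.orderEmbOfFin rfl ⟨i + 1, hi⟩ ≠ 0 := fun e => by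
      have := (I.orderEmbOfFin rfl).injective (e.trans h0.symm)
      simp at this
    obtain ⟨j, hj⟩ := Fin.exists_succ_eq.mpr this
    simp [← hj]

omit [AddCommGroup V] in
lemma ofFn_diag_of_notMem {m : ℕ} (x a : V) {I : Finset (Fin (m + 1))} (h : 0 ∉ I) :
    List.ofFn ((Fin.cons x fun _ => a : Fin (m + 1) → V) ∘ I.orderEmbOfFin rfl) =
      List.replicate I.card a := by
  refine List.ext_getElem (by simp) fun i h1 h2 => ?_
  have hi : i < I.card := by simpa using h1
  have : I.orderEmbOfFin rfl ⟨i, hi⟩ ≠ 0 := fun e => h (e ▸ I.orderEmbOfFin_mem rfl _)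
  obtain ⟨j, hj⟩ := Fin.exists_succ_eq.mpr this
  simp [← hj]

/-- The Jacobi rule for the arguments `(x, a, …, a)`, with `x` of degree `0` and `a` of degree `1`. -/
lemma jacobi_diag {x a : V} (hx : x ∈ 𝒢 0) (ha : a ∈ 𝒢 1) (m : ℕ) :
    ∑ j ∈ Finset.range (m + 1), (m.choose j) •
      (listEval L.bracket
          (listEval L.bracket (List.replicate j a) :: x :: List.replicate (m - j) a) -
        (-1 : K) ^ j • listEval L.bracket
          (listEval L.bracket (x :: List.replicate j a) :: List.replicate (m - j) a)) = 0 := by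
  classical
  have hJ := L.jacobi (m + 1) (diagDegree m) (Fin.cons x fun _ => a) fun i => by
    refine Fin.cases hx (fun _ => ha) i
  set z : Fin (m + 1) → V := Fin.cons x fun _ => a with hz
  let T : Finset (Fin (m + 1)) → V := fun I => (-1 : ℤˣ) ^ I.card • unshuffleSign (diagDegree m) I •
      L.bracket (Iᶜ.card + 1) (Fin.cons (L.bracket I.card (z ∘ I.orderEmbOfFin rfl))
        (z ∘ Iᶜ.orderEmbOfFin rfl) : Fin (Iᶜ.card + 1) → V)
  have hT : ∀ I, T I = (-1 : ℤˣ) ^ I.card • unshuffleSign (diagDegree m) I •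
      listEval L.bracket (listEval L.bracket (List.ofFn (z ∘ I.orderEmbOfFin rfl)) ::
        List.ofFn (z ∘ Iᶜ.orderEmbOfFin rfl)) := fun I => by
    rw [listEval_ofFn, ← List.ofFn_cons, listEval_ofFn]
  -- Since `bracket 0 = 0`, the empty set can be included in the Jacobi sum.
  have hsum : ∑ I, T I = 0 := by
    rw [← hJ]
    refine (Finset.sum_filter_of_ne fun I _ hI => ?_).symm
    by_contra h
    rw [Finset.not_nonempty_iff_eq_empty] at h
    subst h
    refine hI ?_
    have hnil : listEval L.bracket (List.replicate (∅ : Finset (Fin (m + 1))).card a) = 0 :=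
      DFunLike.congr_fun L.bracket_zero _
    rw [hT, ofFn_diag_of_notMem x a (Finset.notMem_empty 0), hnil, listEval_cons,
      MultilinearMap.map_coord_zero _ 0 rfl, smul_zero, smul_zero]
  have h1 : ∀ I : Finset (Fin (m + 1)), 0 ∉ I → I.card ≤ m → T I = listEval L.bracket
      (listEval L.bracket (List.replicate I.card a) :: x :: List.replicate (m - I.card) a) := by
    intro I h hc
    rw [hT, ofFn_diag_of_notMem x a h, ofFn_diag_of_mem x a (Finset.mem_compl.mpr h),
      unshuffleSign_diag_of_notMem h, smul_smul, ← mul_pow, Finset.card_compl, Fintype.card_fin,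
      show m + 1 - I.card - 1 = m - I.card by omega]
    simp
  have h2 : ∀ I : Finset (Fin (m + 1)), 0 ∉ I → T (insert 0 I) = -((-1 : K) ^ I.card •
      listEval L.bracket (listEval L.bracket (x :: List.replicate I.card a) ::
        List.replicate (m - I.card) a)) := by
    intro I h
    rw [hT, ofFn_diag_of_mem x a (Finset.mem_insert_self 0 I),
      ofFn_diag_of_notMem x a (I := (insert 0 I)ᶜ) (by simp),
      unshuffleSign_diag_of_mem (Finset.mem_insert_self 0 I), one_smul, Finset.card_compl,
      Finset.card_insert_of_notMem h, Fintype.card_fin, Nat.add_sub_add_right, Nat.add_sub_add_right,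
      Nat.sub_zero, pow_succ, mul_neg_one, Units.neg_smul]
    congr 1
    rcases Nat.even_or_odd I.card with h | h <;> simp [h.neg_one_pow]
  -- The subsets are paired as `I` and `insert 0 I`, according to whether `x` is in the inner
  -- bracket; the terms then depend only on the cardinality of `I`.
  have hu : (Finset.univ : Finset (Finset (Fin (m + 1)))) =
      (insert 0 (Finset.univ.map (Fin.succEmb m))).powerset := by
    rw [← Finset.powerset_univ, Fin.univ_succ]
    congr 1
    ext; simp
  have h0 : (0 : Fin (m + 1)) ∉ Finset.univ.map (Fin.succEmb m) := by simp
  rw [hu, Finset.sum_powerset_insert h0, ← Finset.sum_add_distrib] at hsum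
  have hcard : (Finset.univ.map (Fin.succEmb m)).card = m := by simp
  have := Finset.sum_powerset_apply_card (fun j => listEval L.bracket
          (listEval L.bracket (List.replicate j a) :: x :: List.replicate (m - j) a) -
        (-1 : K) ^ j • listEval L.bracket
          (listEval L.bracket (x :: List.replicate j a) :: List.replicate (m - j) a))
    (x := Finset.univ.map (Fin.succEmb m))
  rw [hcard] at this
  rw [← this, ← hsum]
  refine Finset.sum_congr rfl fun I hI => ?_
  rw [Finset.mem_powerset] at hI
  have h : 0 ∉ I := fun h => h0 (hI h)
  rw [h1 I h ((Finset.card_le_card hI).trans hcard.le), h2 I h, sub_eq_add_neg]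

variable {x : V} (hx : x ∈ 𝒢 0) {N : ℕ} (hN : ∀ k ≥ N, L.bracket k = 0)

lemma listEval_bracket_eq_zero {L : LInfinityAlgebra 𝒢} (hN : ∀ k ≥ N, L.bracket k = 0) (l : List V)
    (h : N ≤ l.length) : listEval L.bracket l = 0 := by
  rw [listEval, hN _ h]
  rfl

/-- The function `y ↦ [y, z_1, …, z_k]`. -/
def bracketHead (l : List V) : V →ₗ[K] V where
  toFun y := listEval L.bracket (y :: l)
  map_add' a b := listEval_cons_add _ a b l
  map_smul' c a := listEval_cons_smul _ c a l

lemma bracketHead_apply (l : List V) (y : V) :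
    L.bracketHead l y = listEval L.bracket (y :: l) := rfl

lemma oneFamily_tw_zero (a : 𝒢 1) :
    (L.oneFamily hN).tw a 0 = ∑ l ∈ Finset.range N, ((l ! : ℕ) : K)⁻¹ •
      listEval L.bracket (List.replicate l (a : V)) := by
  refine Finset.sum_congr rfl fun l _ => ?_
  rw [add_zero, ← Multiset.coe_replicate, oneFamily_app, List.map_replicate]

lemma oneFamily_tw_singleton (a b : 𝒢 1) :
    (L.oneFamily hN).tw a {b} = ∑ l ∈ Finset.range N, ((l ! : ℕ) : K)⁻¹ •
      listEval L.bracket (b :: List.replicate l (a : V)) := by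
  refine Finset.sum_congr rfl fun l _ => ?_
  rw [add_comm, ← Multiset.coe_replicate, Multiset.singleton_add, Multiset.cons_coe,
    oneFamily_app, List.map_cons, List.map_replicate]

lemma zeroFamily_tw_neg_zero (a : 𝒢 1) :
    (((L.zeroFamily hx hN).tw (-a) 0 : 𝒢 1) : V) = ∑ l ∈ Finset.range N,
      (((l ! : ℕ) : K)⁻¹ * (-1) ^ l) • listEval L.bracket (x :: List.replicate l (a : V)) := by
  rw [SymmFamily.tw, AddSubmonoidClass.coe_finsetSum]
  refine Finset.sum_congr rfl fun l _ => ?_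
  rw [app_replicate_neg, add_zero, ← Multiset.coe_replicate, Submodule.coe_smul, Submodule.coe_smul,
    zeroFamily_app, List.map_replicate, smul_smul]

/-- The twisted Jacobi rule for an element `x` of degree `0`: `[[x]_a]_a` is the bracket of the curvature of
`a` and of `x`. -/
lemma twisted_jacobi [CharZero K] (a : 𝒢 1) :
    (L.oneFamily hN).tw a {(L.zeroFamily hx hN).tw (-a) 0} =
      ∑ b ∈ Finset.range N, ((b ! : ℕ) : K)⁻¹ • listEval L.bracket
        ((L.oneFamily hN).tw a 0 :: x :: List.replicate b (a : V)) := by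
  let E₁ : ℕ → ℕ → V := fun j b => listEval L.bracket
    (listEval L.bracket (List.replicate j (a : V)) :: x :: List.replicate b (a : V))
  let E₂ : ℕ → ℕ → V := fun j b => (-1 : K) ^ j • listEval L.bracket
    (listEval L.bracket (x :: List.replicate j (a : V)) :: List.replicate b (a : V))
  let g : ℕ × ℕ → V := fun p =>
    (((p.1 ! : ℕ) : K)⁻¹ * ((p.2 ! : ℕ) : K)⁻¹) • (E₁ p.1 p.2 - E₂ p.1 p.2)
  have hg : ∀ p : ℕ × ℕ, N ≤ p.1 ∨ N ≤ p.2 → g p = 0 := by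
    rintro ⟨j, b⟩ (h | h)
    · simp only [g, E₁, E₂]
      rw [listEval_bracket_eq_zero hN (List.replicate j _) (by simpa using h),
        listEval_bracket_eq_zero hN (x :: List.replicate j _) (by simp; omega),
        ← bracketHead_apply, ← bracketHead_apply, map_zero, map_zero]
      simp
    · simp only [g, E₁, E₂]
      rw [listEval_bracket_eq_zero hN (_ :: x :: _) (by simp; omega),
        listEval_bracket_eq_zero hN (_ :: List.replicate b _) (by simp; omega)]
      simp
  -- Dividing the Jacobi rule by `m!` turns the binomial coefficient into `1 / (j! (m - j)!)`.
  have hm : ∀ m, ∑ p ∈ Finset.HasAntidiagonal.antidiagonal m, g p = 0 := by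
    intro m
    rw [Finset.Nat.sum_antidiagonal_eq_sum_range_succ_mk]
    have := congrArg (fun v => ((m ! : ℕ) : K)⁻¹ • v) (L.jacobi_diag hx a.2 m)
    simp only [smul_zero, Finset.smul_sum] at this
    rw [← this]
    refine Finset.sum_congr rfl fun j hj => ?_
    simp only [g, E₁, E₂]
    rw [← Nat.cast_smul_eq_nsmul K, smul_smul, Nat.cast_choose K (Finset.mem_range_succ_iff.mp hj)]
    congr 1
    have : (m ! : K) ≠ 0 := by exact_mod_cast m.factorial_ne_zero
    field_simp
  -- The square is cut into antidiagonals; by `hg` the parts of these outside the square contribute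
  -- nothing.
  have hsum : ∑ p ∈ Finset.range N ×ˢ Finset.range N, g p = 0 := by
    rw [← Finset.sum_fiberwise_of_maps_to (g := fun p : ℕ × ℕ => p.1 + p.2)
      (t := Finset.range (N + N)) (by
        intro p hp
        simp only [Finset.mem_product, Finset.mem_range] at hp ⊢
        omega)]
    refine Finset.sum_eq_zero fun m _ => ?_
    rw [← hm m]
    refine Finset.sum_subset (fun p hp => ?_) fun p hp hp' => hg p ?_
    · simp only [Finset.mem_filter] at hp
      exact Finset.HasAntidiagonal.mem_antidiagonal.mpr hp.2
    · rw [Finset.HasAntidiagonal.mem_antidiagonal] at hp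
      simp only [Finset.mem_filter, Finset.mem_product, Finset.mem_range] at hp'
      omega
  rw [Finset.sum_product] at hsum
  simp only [g, smul_sub, Finset.sum_sub_distrib] at hsum
  rw [sub_eq_zero] at hsum
  rw [oneFamily_tw_singleton, oneFamily_tw_zero, zeroFamily_tw_neg_zero]
  simp only [← bracketHead_apply, map_sum, map_smul, Finset.smul_sum, smul_smul]
  rw [Finset.sum_comm]
  conv_rhs => rw [Finset.sum_comm]
  convert hsum.symm using 1
  · refine Finset.sum_congr rfl fun j _ => Finset.sum_congr rfl fun b _ => ?_
    simp only [E₂, bracketHead_apply, smul_smul]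
    congr 1
    ring
  · refine Finset.sum_congr rfl fun j _ => Finset.sum_congr rfl fun b _ => ?_
    simp only [E₁, bracketHead_apply]
    congr 1
    ring

/-- The curvature of a solution of the differential equation `A' = -[x]_A` vanishes if it vanishes at
`0`. -/
lemma curvature_solution_eq_zero [CharZero K] (hL : L.IsNilpotent) {Y : K → 𝒢 1}
    (hY : HasPolyDeriv Y fun t => (L.zeroFamily hx hN).tw (Y t) 0)
    (h0 : (L.oneFamily hN).tw (-Y 0) 0 = 0) (t : K) : (L.oneFamily hN).tw (-Y t) 0 = 0 := by
  obtain ⟨M, hM⟩ := hL.exists_lowerCentralFiltration_eq_bot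
  have hd := (L.oneFamily hN).hasPolyDeriv_tw (∅ : Finset ℕ) (fun _ _ => 0) (fun _ _ => 0) (by simp)
    hY.neg
  simp only [Finset.empty_val, Multiset.map_zero, Finset.sum_empty, add_zero] at hd
  -- The derivative of the curvature is, up to sign, a sum of brackets containing the curvature and
  -- `x`. So if the curvature lies in one stage of the filtration, its derivative lies in the next.
  have key : ∀ i t, (L.oneFamily hN).tw (-Y t) 0 ∈ L.lowerCentralFiltration i := by
    intro i
    induction i with
    | zero => simp [lowerCentralFiltration_zero]
    | succ i ih =>
      refine hd.mem_of_deriv_mem _ (by simp [h0]) fun t => ?_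
      have h := L.twisted_jacobi hx hN (-Y t)
      rw [neg_neg] at h
      rw [← SymmFamily.twHead_apply, map_neg, SymmFamily.twHead_apply]
      change -(L.oneFamily hN).tw (-Y t) {(L.zeroFamily hx hN).tw (Y t) 0} ∈ _
      rw [h]
      refine neg_mem (sum_mem fun b _ => Submodule.smul_mem _ _ ?_)
      exact L.bracket_mem_lowerCentralFiltration (by simp) _ ⟨0, by simp⟩ (ih t)
  simpa [hM] using key M t

end LInfinityAlgebra

/-! ### The tree expansion of the solution, and the dg Lie case -/

namespace LInfinityAlgebra

variable {K : Type*} [Field K] [CharZero K] {V : Type*} [AddCommGroup V] [Module K V]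
  {𝒢 : ℤ → Submodule K V} [DirectSum.Decomposition 𝒢] (L : LInfinityAlgebra 𝒢)
  {x : V} (hx : x ∈ 𝒢 0) {N : ℕ} (hN : ∀ k ≥ N, L.bracket k = 0)

include hx in
lemma zeroFamily_solution_unique (hL : L.IsNilpotent) {Y Z : K → 𝒢 1}
    (hY : HasPolyDeriv Y fun t => (L.zeroFamily hx hN).tw (Y t) 0)
    (hZ : HasPolyDeriv Z fun t => (L.zeroFamily hx hN).tw (Z t) 0) (h : Y 0 = Z 0) : Y = Z := by
  obtain ⟨M, hM⟩ := hL.exists_lowerCentralFiltration_eq_bot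
  exact (L.zeroFamily hx hN).solution_unique
    (fun i => (L.lowerCentralFiltration i).comap (𝒢 1).subtype)
    (fun _ _ s h => L.zeroFamily_app_mem hx hN s h)
    (by simp [lowerCentralFiltration_zero]) (M := M) (by simp [hM]) hY hZ h

/-- The solution of `A' = -[x]_A` with `A(0) = μ`, written as `A = -Y`. -/
lemma exists_zeroFamily_solution (hL : L.IsNilpotent) {μ : V} (hμ : μ ∈ 𝒢 1) :
    ∃ Y : K → 𝒢 1, HasPolyDeriv Y (fun t => (L.zeroFamily hx hN).tw (Y t) 0) ∧ Y 0 = -⟨μ, hμ⟩ ∧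
      ∃ M, (∀ k ≥ M, FinTree.expTerm L μ x k = 0) ∧ ∀ t, -(Y t : V) = μ -
        ∑ k ∈ Finset.range M, ((k + 1)! : K)⁻¹ • t ^ (k + 1) • FinTree.expTerm L μ x (k + 1) := by
  obtain ⟨M, hM⟩ := hL.exists_lowerCentralFiltration_eq_bot
  obtain ⟨Y, hY, hY0⟩ := (L.zeroFamily hx hN).exists_solution
    (fun i => (L.lowerCentralFiltration i).comap (𝒢 1).subtype)
    (fun _ _ s h => L.zeroFamily_app_mem hx hN s h)
    (by simp [lowerCentralFiltration_zero]) (M := M) (by simp [hM]) (-⟨μ, hμ⟩)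
  refine ⟨Y, hY, hY0, ?_⟩
  -- These are the successive derivatives of `Y`. There is no tree without vertices, so `Y` itself
  -- has to be put in at index `0`.
  let E : ℕ → K → 𝒢 1 := fun k => match k with
    | 0 => Y
    | k + 1 => fun t => FinTree.monotoneSum (L.zeroFamily hx hN) (Y t) (k + 1)
  have hE : ∀ k, HasPolyDeriv (E k) (E (k + 1)) := by
    intro k
    rcases k with _ | k
    · simpa only [E, zero_add, FinTree.monotoneSum_one] using hY
    · exact FinTree.hasPolyDeriv_monotoneSum _ hY k
  obtain ⟨m, hm, hT⟩ := HasPolyDeriv.taylor E hE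
  have he : ∀ k, FinTree.expTerm L μ x (k + 1) = E (k + 1) 0 := fun k => by
    rw [L.expTerm_eq hx hN hμ, ← hY0]
  have hm' : ∀ k ≥ m + 1, FinTree.expTerm L μ x k = 0 := fun k hk => by
    obtain ⟨k, rfl⟩ := Nat.exists_eq_add_of_le' (show 1 ≤ k by omega)
    rw [he, hm (k + 1) (by omega)]
    rfl
  refine ⟨m + 1, hm', fun t => ?_⟩
  have hT' : Y t = ∑ k ∈ Finset.range (m + 1 + 1), (t ^ k * ((k ! : ℕ) : K)⁻¹) • E k 0 := by
    rw [Finset.sum_range_succ, Finset.sum_range_succ, hm m le_rfl, hm (m + 1) (by omega), smul_zero,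
      add_zero, smul_zero, add_zero]
    exact hT t
  rw [hT', Finset.sum_range_succ', Submodule.coe_add, AddSubmonoidClass.coe_finsetSum, neg_add_rev]
  simp only [pow_zero, Nat.factorial_zero, Nat.cast_one, inv_one, one_mul, one_smul]
  rw [show E 0 0 = -⟨μ, hμ⟩ from hY0, sub_eq_add_neg]
  congr 1
  · simp
  · refine congrArg _ (Finset.sum_congr rfl fun k _ => ?_)
    rw [he, smul_smul, mul_comm, Submodule.coe_smul]

/-- The adjoint action as a linear map. -/
def adLinear (x : V) : V →ₗ[K] V := (L.bracket 2).toLinearMap ![x, 0] 1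

omit [CharZero K] in
lemma adLinear_apply (x y : V) : L.adLinear x y = L.ad x y := by
  simp only [adLinear, ad, MultilinearMap.toLinearMap_apply]
  congr 1
  ext i
  fin_cases i <;> rfl

-- Only the terms with at most one copy of `y` survive, so the differential equation becomes affine.
omit [CharZero K] in
lemma zeroFamily_tw_of_isDGLie (hD : L.IsDGLie) (y : 𝒢 1) :
    (((L.zeroFamily hx hN).tw y 0 : 𝒢 1) : V) = L.bracket 1 ![x] + L.adLinear x y := by
  have h : (L.zeroFamily hx hN).tw y 0 = ∑ l ∈ Finset.range 2, ((l ! : ℕ) : K)⁻¹ •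
      (L.zeroFamily hx hN).app (Multiset.replicate l y + 0) := by
    rw [SymmFamily.tw_eq_sum _ _ _ (show _ ≤ (L.zeroFamily hx hN).order + 2 by omega)]
    symm
    refine Finset.sum_subset (Finset.range_mono (by omega)) fun l _ hl => ?_
    simp only [Finset.mem_range, not_lt] at hl
    refine Subtype.ext ?_
    rw [add_zero, ← Multiset.coe_replicate, Submodule.coe_smul, zeroFamily_app, listEval,
      hD _ (by simp; omega)]
    simp
  have h1 : ∀ l : List (𝒢 1), ((L.zeroFamily hx hN).app (l : Multiset (𝒢 1)) : V) = _ :=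
    L.zeroFamily_app hx hN
  rw [h, Finset.sum_range_succ, Finset.sum_range_one]
  simp only [← Multiset.coe_replicate, add_zero, Submodule.coe_add, Submodule.coe_smul, h1]
  rw [adLinear_apply, ad, ← listEval_ofFn, ← listEval_ofFn]
  simp

/-- In a dg Lie algebra `e^{k+1}_μ(x) = ad(x)^k (δ_μ x)`. -/
lemma expTerm_of_isDGLie (hL : L.IsNilpotent) (hD : L.IsDGLie) {μ : V} (hμ : μ ∈ 𝒢 1)
    (hx : x ∈ 𝒢 0) (k : ℕ) :
    FinTree.expTerm L μ x (k + 1) = (L.ad x)^[k] (L.covDiff μ x) := by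
  obtain ⟨N, hN⟩ := hL.exists_bracket_eq_zero
  obtain ⟨Y, hY, hY0, -⟩ := L.exists_zeroFamily_solution hx hN hL hμ
  have hE : ∀ k, HasPolyDeriv
      (fun t => ((FinTree.monotoneSum (L.zeroFamily hx hN) (Y t) (k + 1) : 𝒢 1) : V))
      (fun t => ((FinTree.monotoneSum (L.zeroFamily hx hN) (Y t) (k + 2) : 𝒢 1) : V)) := fun k =>
    (FinTree.hasPolyDeriv_monotoneSum _ hY k).map (𝒢 1).subtype
  have h1 : ∀ t, ((FinTree.monotoneSum (L.zeroFamily hx hN) (Y t) 1 : 𝒢 1) : V) =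
      L.bracket 1 ![x] + L.adLinear x (Y t) := fun t => by
    rw [FinTree.monotoneSum_one, L.zeroFamily_tw_of_isDGLie hx hN hD]
  -- Differentiating the affine expression `h1` and comparing with the tree derivative identifies
  -- the second derivative as `ad(x)` of the first.
  have h2 : ∀ t, ((FinTree.monotoneSum (L.zeroFamily hx hN) (Y t) 2 : 𝒢 1) : V) =
      L.adLinear x (FinTree.monotoneSum (L.zeroFamily hx hN) (Y t) 1 : 𝒢 1) := by
    refine congrFun ((hE 0).unique ?_)
    convert (HasPolyDeriv.const (L.bracket 1 ![x])).add
      ((hY.map (𝒢 1).subtype).map (L.adLinear x)) using 2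
    · exact h1 _
    · rw [FinTree.monotoneSum_one, zero_add]
      rfl
  have hk : ∀ k t, ((FinTree.monotoneSum (L.zeroFamily hx hN) (Y t) (k + 1) : 𝒢 1) : V) =
      (L.adLinear x)^[k] (FinTree.monotoneSum (L.zeroFamily hx hN) (Y t) 1 : 𝒢 1) := by
    intro k
    induction k with
    | zero => exact fun t => rfl
    | succ k ih =>
      refine congrFun ((hE k).unique ?_)
      convert (hE 0).map (L.adLinear x ^ k) using 2
      · rw [ih, Module.End.pow_apply]
      · rw [h2, Function.iterate_succ_apply, Module.End.pow_apply]
  have hfun : (L.adLinear x : V → V) = L.ad x := funext (L.adLinear_apply x)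
  rw [L.expTerm_eq hx hN hμ, ← hY0, hk, h1, hY0, hfun]
  congr 1
  -- At `t = 0` one has `Y = -μ`, and `-[x, μ] = [μ, x]` by antisymmetry in degrees `0` and `1`.
  have hs := L.listEval_bracket_swap [] [] hμ hx (by simp) (by simp)
  rw [covDiff, ad, ← listEval_ofFn L.bracket ![μ, x]]
  simp only [List.ofFn_succ, List.ofFn_zero, List.nil_append] at hs ⊢
  have h3 : L.bracket 2 ![x, -μ] = -listEval L.bracket [x, μ] := by
    have := map_neg (L.adLinear x) μ
    rw [adLinear_apply, adLinear_apply, ad, ad, ← listEval_ofFn L.bracket ![x, μ]] at this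
    simpa [List.ofFn_succ] using this
  rw [show ((-⟨μ, hμ⟩ : 𝒢 1) : V) = -μ from rfl, h3]
  simpa using hs.symm

end LInfinityAlgebra

/-! ### Multilinear extensions evaluated in dual numbers -/

section DualEvaluation

variable {K : Type*} [Field K]

section Coefficients

variable {B : Type*} [Ring B] [Algebra K B] (f : B →ₐ[K] DualNumber K)
  {V W : Type*} [AddCommGroup V] [Module K V] [AddCommGroup W] [Module K W]

/-- The constant coefficient of the image of an element of `W ⊗ B` in `W ⊗ K[ε]`. -/
def fstCoeff : W ⊗[K] B →ₗ[K] W :=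
  TensorProduct.rid K W ∘ₗ LinearMap.lTensor W ((TrivSqZeroExt.fstHom K K K).toLinearMap ∘ₗ f.toLinearMap)

/-- The coefficient of `ε` in the image of an element of `W ⊗ B` in `W ⊗ K[ε]`. -/
def sndCoeff : W ⊗[K] B →ₗ[K] W :=
  TensorProduct.rid K W ∘ₗ LinearMap.lTensor W (TrivSqZeroExt.sndHom K K ∘ₗ f.toLinearMap)

@[simp] lemma fstCoeff_tmul (w : W) (b : B) : fstCoeff f (w ⊗ₜ b) = (f b).fst • w := by
  simp [fstCoeff]

@[simp] lemma sndCoeff_tmul (w : W) (b : B) : sndCoeff f (w ⊗ₜ b) = (f b).snd • w := by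
  simp [sndCoeff]

lemma fstCoeff_mul (b : B) (y : W ⊗[K] B) :
    fstCoeff f (LinearMap.lTensor W (LinearMap.mul K B b) y) = (f b).fst • fstCoeff f y := by
  induction y with
  | zero => simp
  | tmul w c => simp [mul_smul]
  | add y z hy hz => simp [hy, hz]

lemma sndCoeff_mul (b : B) (y : W ⊗[K] B) :
    sndCoeff f (LinearMap.lTensor W (LinearMap.mul K B b) y) =
      (f b).fst • sndCoeff f y + (f b).snd • fstCoeff f y := by
  induction y with
  | zero => simp
  | tmul w c => simp [mul_smul, add_smul, smul_comm (f b).snd]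
  | add y z hy hz =>
    simp only [map_add, hy, hz, smul_add]
    abel

lemma tensorExtend_succ {k : ℕ} (m : MultilinearMap K (fun _ : Fin (k + 1) => V) W) (x : V) (b : B)
    (z : Fin (k + 1) → V ⊗[K] B) (h : z 0 = x ⊗ₜ b) :
    tensorExtend B (k + 1) m z = LinearMap.lTensor W (LinearMap.mul K B b)
      (tensorExtend B k (m.curryLeft x) (Fin.tail z)) := by
  simp [tensorExtend, h]

/-- The constant coefficient is multiplicative, so it commutes with the extension of `m`. -/
lemma fstCoeff_tensorExtend {k : ℕ} (m : MultilinearMap K (fun _ : Fin k => V) W)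
    (z : Fin k → V ⊗[K] B) :
    fstCoeff f (tensorExtend B k m z) = m fun j => fstCoeff f (z j) := by
  induction k with
  | zero =>
    change fstCoeff f (m 0 ⊗ₜ 1) = _
    rw [fstCoeff_tmul, map_one, TrivSqZeroExt.fst_one, one_smul]
    exact congrArg m (Subsingleton.elim _ _)
  | succ k ih =>
    obtain ⟨w, y, rfl⟩ : ∃ w y, z = Fin.cons w y := ⟨z 0, Fin.tail z, (Fin.cons_self_tail z).symm⟩
    have hc : (fun j => fstCoeff f ((Fin.cons w y : Fin (k + 1) → V ⊗[K] B) j)) =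
        Fin.cons (fstCoeff f w) fun j => fstCoeff f (y j) := by
      ext j; refine Fin.cases rfl (fun _ => rfl) j
    rw [hc]
    induction w with
    | zero =>
      rw [map_zero, MultilinearMap.map_coord_zero _ 0 rfl, MultilinearMap.map_coord_zero m 0 rfl,
        map_zero]
    | tmul x b =>
      rw [tensorExtend_succ m x b _ rfl, fstCoeff_mul, ih, fstCoeff_tmul, MultilinearMap.cons_smul]
      rfl
    | add w w' hw hw' =>
      rw [MultilinearMap.cons_add, map_add, map_add, MultilinearMap.cons_add, hw, hw'] <;>
        (ext j; refine Fin.cases rfl (fun _ => rfl) j)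

/-- Since `ε² = 0`, exactly one argument contributes its coefficient of `ε`: the Leibniz rule. -/
lemma sndCoeff_tensorExtend {k : ℕ} (m : MultilinearMap K (fun _ : Fin k => V) W)
    (z : Fin k → V ⊗[K] B) :
    sndCoeff f (tensorExtend B k m z) =
      ∑ i, m (Function.update (fun j => fstCoeff f (z j)) i (sndCoeff f (z i))) := by
  induction k with
  | zero => simp [tensorExtend]
  | succ k ih =>
    obtain ⟨w, y, rfl⟩ : ∃ w y, z = Fin.cons w y := ⟨z 0, Fin.tail z, (Fin.cons_self_tail z).symm⟩
    have hc : ∀ w, (fun j => fstCoeff f ((Fin.cons w y : Fin (k + 1) → V ⊗[K] B) j)) =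
        Fin.cons (fstCoeff f w) fun j => fstCoeff f (y j) := fun w => by
      ext j; refine Fin.cases rfl (fun _ => rfl) j
    have key : ∀ w, ∑ i, m (Function.update
        (fun j => fstCoeff f ((Fin.cons w y : Fin (k + 1) → V ⊗[K] B) j)) i
          (sndCoeff f ((Fin.cons w y : Fin (k + 1) → V ⊗[K] B) i))) =
        m (Fin.cons (sndCoeff f w) fun j => fstCoeff f (y j)) +
        ∑ i, m (Fin.cons (fstCoeff f w)
          (Function.update (fun j => fstCoeff f (y j)) i (sndCoeff f (y i)))) := by
      intro w
      rw [Fin.sum_univ_succ, hc]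
      simp only [Fin.cons_zero, Fin.cons_succ, Fin.update_cons_zero, Fin.cons_update]
    rw [key]
    induction w with
    | zero =>
      rw [MultilinearMap.map_coord_zero _ 0 rfl, map_zero, map_zero,
        MultilinearMap.map_coord_zero m 0 rfl, zero_add]
      symm
      exact Finset.sum_eq_zero fun i _ => by rw [map_zero]; exact MultilinearMap.map_coord_zero m 0 rfl
    | tmul x b =>
      rw [tensorExtend_succ m x b _ rfl, sndCoeff_mul, ih, fstCoeff_tensorExtend, fstCoeff_tmul,
        sndCoeff_tmul, MultilinearMap.cons_smul, add_comm, Finset.smul_sum]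
      congr 1
      refine Finset.sum_congr rfl fun i _ => ?_
      rw [MultilinearMap.cons_smul]
      rfl
    | add w w' hw hw' =>
      rw [MultilinearMap.cons_add, map_add, hw, hw', map_add, map_add, MultilinearMap.cons_add]
      simp only [MultilinearMap.cons_add, Finset.sum_add_distrib]
      abel

end Coefficients

end DualEvaluation

/-! ### Forms on the interval in coordinates -/

section Interval

variable {K : Type*} [Field K] {V W : Type*} [AddCommGroup V] [Module K V]
  [AddCommGroup W] [Module K W]

variable (K) in
/-- The function `t_1 ^ n` on the interval. -/
def tPow (n : ℕ) : Forms K 1 := (MvPolynomial.X 0 ^ n) ⊗ₜ 1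

variable (K) in
/-- The form `t_1 ^ n dt_1` on the interval. -/
def tPowDt (n : ℕ) : Forms K 1 :=
  (MvPolynomial.X 0 ^ n) ⊗ₜ ExteriorAlgebra.ι K (Pi.single 0 (1 : K) : Fin 1 → K)

lemma exterior_one_eq (η : ExteriorAlgebra K (Fin 1 → K)) :
    ∃ a b : K, η = a • 1 + b • ExteriorAlgebra.ι K (Pi.single 0 (1 : K) : Fin 1 → K) := by
  induction η using ExteriorAlgebra.induction with
  | algebraMap a => exact ⟨a, 0, by simp [Algebra.algebraMap_eq_smul_one]⟩
  | ι v =>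
    refine ⟨0, v 0, ?_⟩
    rw [zero_smul, zero_add, ← map_smul]
    congr 1
    ext i
    simp [Subsingleton.elim i 0]
  | mul η η' h h' =>
    obtain ⟨a, b, rfl⟩ := h
    obtain ⟨a', b', rfl⟩ := h'
    refine ⟨a * a', a * b' + b * a', ?_⟩
    simp only [add_mul, mul_add, smul_mul_assoc, one_mul, mul_smul_comm, mul_one,
      ExteriorAlgebra.ι_sq_zero, smul_zero, add_zero]
    module
  | add η η' h h' =>
    obtain ⟨a, b, rfl⟩ := h
    obtain ⟨a', b', rfl⟩ := h'
    refine ⟨a + a', b + b', ?_⟩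
    simp only [add_smul]
    abel

/-- The forms `t₁ⁿ` and `t₁ⁿ dt₁` span `Ω_1`; identities between operators on `𝔤 ⊗ Ω_1` are checked
on them. -/
lemma interval_ext {f g : V ⊗[K] Forms K 1 →ₗ[K] W}
    (h0 : ∀ v n, f (v ⊗ₜ tPow K n) = g (v ⊗ₜ tPow K n))
    (h1 : ∀ v n, f (v ⊗ₜ tPowDt K n) = g (v ⊗ₜ tPowDt K n)) : f = g := by
  refine TensorProduct.ext' fun v ω => ?_
  induction ω using TensorProduct.induction_on with
  | zero => simp
  | add ω ω' h h' => simp only [TensorProduct.tmul_add, map_add, h, h']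
  | tmul P η =>
    obtain ⟨a, b, rfl⟩ := exterior_one_eq η
    have hP : ∀ η₀ : ExteriorAlgebra K (Fin 1 → K),
        (∀ n : ℕ, f (v ⊗ₜ ((MvPolynomial.X 0 ^ n : MvPolynomial (Fin 1) K) ⊗ₜ η₀)) =
          g (v ⊗ₜ ((MvPolynomial.X 0 ^ n : MvPolynomial (Fin 1) K) ⊗ₜ η₀))) →
        f (v ⊗ₜ (P ⊗ₜ η₀)) = g (v ⊗ₜ (P ⊗ₜ η₀)) := by
      intro η₀ h
      induction P using MvPolynomial.induction_on' with
      | monomial u c =>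
        have : MvPolynomial.monomial u c =
            c • (MvPolynomial.X 0 ^ u 0 : MvPolynomial (Fin 1) K) := by
          rw [MvPolynomial.monomial_eq, Finsupp.prod_fintype _ _ (by simp), Fin.prod_univ_one,
            MvPolynomial.smul_eq_C_mul]
        rw [this, ← TensorProduct.smul_tmul', TensorProduct.tmul_smul, map_smul, map_smul, h]
      | add P Q hP hQ =>
        simp only [TensorProduct.add_tmul, TensorProduct.tmul_add, map_add, hP, hQ]
    simp only [TensorProduct.tmul_add, TensorProduct.tmul_smul, map_add, map_smul]
    rw [hP 1 (h0 v), hP _ (h1 v)]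

/-- The element `∑ₙ pₙ ⊗ t_1 ^ n`. -/
def intervalZero : (ℕ →₀ V) →ₗ[K] V ⊗[K] Forms K 1 :=
  Finsupp.lsum K fun n => (TensorProduct.mk K V (Forms K 1)).flip (tPow K n)

/-- The element `∑ₙ qₙ ⊗ t_1 ^ n dt_1`. -/
def intervalOne : (ℕ →₀ V) →ₗ[K] V ⊗[K] Forms K 1 :=
  Finsupp.lsum K fun n => (TensorProduct.mk K V (Forms K 1)).flip (tPowDt K n)

@[simp] lemma intervalZero_single (n : ℕ) (v : V) :
    intervalZero (K := K) (Finsupp.single n v) = v ⊗ₜ tPow K n := by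
  simp [intervalZero]

@[simp] lemma intervalOne_single (n : ℕ) (v : V) :
    intervalOne (K := K) (Finsupp.single n v) = v ⊗ₜ tPowDt K n := by
  simp [intervalOne]

lemma exists_interval (α : V ⊗[K] Forms K 1) :
    ∃ p q : ℕ →₀ V, α = intervalZero p + intervalOne q := by
  let R := LinearMap.range (intervalZero (K := K) (V := V)) ⊔
    LinearMap.range (intervalOne (K := K) (V := V))
  -- That the two ranges span is the statement that the quotient map vanishes, which can be tested
  -- on the spanning elements.
  have hR : R.mkQ = 0 := by
    refine interval_ext (fun v n => ?_) fun v n => ?_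
    · exact (Submodule.Quotient.mk_eq_zero R).mpr
        (Submodule.mem_sup_left ⟨Finsupp.single n v, intervalZero_single n v⟩)
    · exact (Submodule.Quotient.mk_eq_zero R).mpr
        (Submodule.mem_sup_right ⟨Finsupp.single n v, intervalOne_single n v⟩)
  have : α ∈ R := by
    rw [← Submodule.Quotient.mk_eq_zero, ← Submodule.mkQ_apply, hR]
    rfl
  obtain ⟨_, ⟨p, rfl⟩, _, ⟨q, rfl⟩, h⟩ := Submodule.mem_sup.mp this
  exact ⟨p, q, h.symm⟩

/-- The value of a form on the interval at a point, in the algebra of dual numbers with `ε = dt_1`. -/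
def dualEval (t : K) : Forms K 1 →ₐ[K] DualNumber K :=
  Algebra.TensorProduct.productMap
    ((Algebra.ofId K (DualNumber K)).comp (MvPolynomial.aeval fun _ => t))
    (ExteriorAlgebra.lift K ⟨TrivSqZeroExt.inrHom K K ∘ₗ LinearMap.proj 0, fun v => by simp⟩)

@[simp] lemma dualEval_tPow (t : K) (n : ℕ) : dualEval t (tPow K n) = TrivSqZeroExt.inl (t ^ n) := by
  simp [dualEval, tPow, Algebra.ofId_apply, TrivSqZeroExt.algebraMap_eq_inl]

@[simp] lemma dualEval_tPowDt (t : K) (n : ℕ) :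
    dualEval t (tPowDt K n) = TrivSqZeroExt.inr (t ^ n) := by
  simp only [dualEval, tPowDt, Algebra.TensorProduct.productMap_apply_tmul, AlgHom.comp_apply,
    map_pow, MvPolynomial.aeval_X, Algebra.ofId_apply, TrivSqZeroExt.algebraMap_eq_inl,
    ExteriorAlgebra.lift_ι_apply, LinearMap.comp_apply, LinearMap.proj_apply, Pi.single_eq_same,
    TrivSqZeroExt.inrHom_apply]
  rw [TrivSqZeroExt.inl_pow, TrivSqZeroExt.inl_mul_inr, smul_eq_mul, mul_one]

/-- The value at `t` of the component of form degree `0`. -/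
def funPart (t : K) : V ⊗[K] Forms K 1 →ₗ[K] V := fstCoeff (dualEval t)

/-- The value at `t` of the coefficient of `dt_1`. -/
def dtPart (t : K) : V ⊗[K] Forms K 1 →ₗ[K] V := sndCoeff (dualEval t)

@[simp] lemma funPart_tPow (t : K) (v : V) (n : ℕ) : funPart t (v ⊗ₜ tPow K n) = t ^ n • v := by
  simp [funPart]

@[simp] lemma funPart_tPowDt (t : K) (v : V) (n : ℕ) : funPart t (v ⊗ₜ tPowDt K n) = 0 := by
  simp [funPart]

@[simp] lemma dtPart_tPow (t : K) (v : V) (n : ℕ) : dtPart t (v ⊗ₜ tPow K n) = 0 := by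
  simp [dtPart]

@[simp] lemma dtPart_tPowDt (t : K) (v : V) (n : ℕ) : dtPart t (v ⊗ₜ tPowDt K n) = t ^ n • v := by
  simp [dtPart]

lemma funPart_intervalZero (t : K) (p : ℕ →₀ V) : funPart t (intervalZero (K := K) p) = polyEval t p := by
  induction p using Finsupp.induction_linear with
  | zero => simp
  | add p q hp hq => simp [hp, hq]
  | single n v => simp

lemma funPart_intervalOne (t : K) (p : ℕ →₀ V) : funPart t (intervalOne (K := K) p) = 0 := by
  induction p using Finsupp.induction_linear with
  | zero => simp
  | add p q hp hq => simp [hp, hq]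
  | single n v => simp

lemma dtPart_intervalZero (t : K) (p : ℕ →₀ V) : dtPart t (intervalZero (K := K) p) = 0 := by
  induction p using Finsupp.induction_linear with
  | zero => simp
  | add p q hp hq => simp [hp, hq]
  | single n v => simp

lemma dtPart_intervalOne (t : K) (p : ℕ →₀ V) : dtPart t (intervalOne (K := K) p) = polyEval t p := by
  induction p using Finsupp.induction_linear with
  | zero => simp
  | add p q hp hq => simp [hp, hq]
  | single n v => simp

/-- An element of `V ⊗ Ω_1` is determined by its values at all points. -/
lemma interval_eq_of_parts [CharZero K] {α β : V ⊗[K] Forms K 1}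
    (h0 : ∀ t : K, funPart t α = funPart t β) (h1 : ∀ t : K, dtPart t α = dtPart t β) : α = β := by
  rw [← sub_eq_zero]
  obtain ⟨p, q, h⟩ := exists_interval (α - β)
  have hp : p = 0 := eq_zero_of_polyEval (K := K) p fun t => by
    have := congrArg (funPart t) h
    rwa [map_add, funPart_intervalZero, funPart_intervalOne, add_zero, map_sub, h0, sub_self,
      eq_comm] at this
  have hq : q = 0 := eq_zero_of_polyEval (K := K) q fun t => by
    have := congrArg (dtPart t) h
    rwa [map_add, dtPart_intervalZero, dtPart_intervalOne, zero_add, map_sub, h1, sub_self,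
      eq_comm] at this
  rw [h, hp, hq, map_zero, map_zero, add_zero]

@[simp] lemma extDeriv_tPow (n : ℕ) : extDeriv K 1 (tPow K n) = (n : K) • tPowDt K (n - 1) := by
  simp [extDeriv, tPow, tPowDt, TensorProduct.smul_tmul',
    Algebra.smul_def]

@[simp] lemma extDeriv_tPowDt (n : ℕ) : extDeriv K 1 (tPowDt K n) = 0 := by
  simp [extDeriv, tPowDt]

lemma extProj_one (q : ℕ) : extProj K 1 q 1 = if q = 0 then 1 else 0 := by
  have h1 : (1 : ExteriorAlgebra K (Fin 1 → K)) ∈ (fun i : ℕ => ⋀[K]^i (Fin 1 → K)) 0 := by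
    simp only [pow_zero]
    exact Submodule.one_le.mp le_rfl
  rw [extProj, GradedAlgebra.proj_apply]
  split_ifs with h
  · subst h
    exact DirectSum.decompose_of_mem_same _ h1
  · exact DirectSum.decompose_of_mem_ne _ h1 (Ne.symm h)

lemma extProj_ι (q : ℕ) (v : Fin 1 → K) :
    extProj K 1 q (ExteriorAlgebra.ι K v) = if q = 1 then ExteriorAlgebra.ι K v else 0 := by
  have hv : ExteriorAlgebra.ι K v ∈ (fun i : ℕ => ⋀[K]^i (Fin 1 → K)) 1 := by
    simp only [pow_one]
    exact ⟨v, rfl⟩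
  rw [extProj, GradedAlgebra.proj_apply]
  split_ifs with h
  · subst h
    exact DirectSum.decompose_of_mem_same _ hv
  · exact DirectSum.decompose_of_mem_ne _ hv (Ne.symm h)

lemma formsProj_tPow (q n : ℕ) : formsProj K 1 q (tPow K n) = if q = 0 then tPow K n else 0 := by
  simp only [formsProj, tPow, LinearMap.lTensor_tmul, extProj_one]
  split_ifs <;> simp

lemma formsProj_tPowDt (q n : ℕ) :
    formsProj K 1 q (tPowDt K n) = if q = 1 then tPowDt K n else 0 := by
  simp only [formsProj, tPowDt, LinearMap.lTensor_tmul, extProj_ι]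
  split_ifs <;> simp

@[simp] lemma vertexEval_tPow (n : ℕ) : vertexEval K 1 0 (tPow K n) = 0 ^ n := by
  simp [vertexEval, tPow]

@[simp] lemma vertexEval_tPowDt (n : ℕ) : vertexEval K 1 0 (tPowDt K n) = 0 := by
  simp [vertexEval, tPowDt, ExteriorAlgebra.algebraMapInv]

@[simp] lemma chainIntegral_tPow (n : ℕ) :
    chainIntegral K (![1] : Fin 1 → Fin 2) (tPow K n) = 1 := by
  have h1 : polyIntegral K 0 1 = 1 := by
    have : (1 : MvPolynomial (Fin 0) K) = MvPolynomial.basisMonomials (Fin 0) K 0 := by simp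
    rw [this, polyIntegral, Module.Basis.constr_basis]
    simp
  have h2 : topCoeff K 0 1 = 1 := by
    simp only [topCoeff, ExteriorAlgebra.liftAlternating_one, Pi.single_eq_same]
    exact Matrix.det_isEmpty
  simp [chainIntegral, simplexIntegral, tPow, pullback, bary, h1, h2]

@[simp] lemma chainIntegral_tPowDt (n : ℕ) :
    chainIntegral K (![1] : Fin 1 → Fin 2) (tPowDt K n) = 0 := by
  simp [chainIntegral, simplexIntegral, tPowDt, pullback, dbary, Fintype.linearCombination_apply]
  rw [Subsingleton.elim (![] : Fin 0 → K) 0, map_zero, map_zero]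
  exact Or.inr rfl

@[simp] lemma poincareHomotopy_tPow (n : ℕ) : poincareHomotopy K 1 0 (tPow K n) = 0 := by
  simp [poincareHomotopy, tPow, extProj_one]

@[simp] lemma poincareHomotopy_tPowDt (n : ℕ) :
    poincareHomotopy K 1 0 (tPowDt K n) = ((n + 1 : ℕ) : K)⁻¹ • tPow K (n + 1) := by
  have h : dilationIntegral K 1 0 0 (MvPolynomial.X 0 ^ n) =
      ((n + 1 : ℕ) : K)⁻¹ • MvPolynomial.X 0 ^ n := by
    simp only [dilationIntegral, LinearMap.comp_apply, AlgHom.toLinearMap_apply, map_pow,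
      MvPolynomial.aeval_X, Fin.succ_ne_zero, if_false, mul_zero, add_zero, mul_pow]
    rw [← Polynomial.C_pow, mul_comm, Polynomial.C_mul_X_pow_eq_monomial, Polynomial.lsum_apply,
      Polynomial.sum_monomial_index _ _ (by simp)]
    simp
  simp [poincareHomotopy, tPowDt, tPow, extProj_ι, h, TensorProduct.smul_tmul', pow_succ']

end Interval

/-! ### The differential, the homotopy and the gauge on the interval -/

section Interval

variable {K : Type*} [Field K] {V W : Type*} [AddCommGroup V] [Module K V]
  [AddCommGroup W] [Module K W]

lemma one_eq_tPow : (1 : Forms K 1) = tPow K 0 := by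
  rw [tPow, pow_zero]
  rfl

lemma coord_one_pow (n : ℕ) : coord K 1 1 ^ n = tPow K n := by
  rw [coord, Algebra.TensorProduct.tmul_pow, one_pow, tPow]
  rfl

lemma coord_one_eq : coord K 1 1 = tPow K 1 := by
  rw [← coord_one_pow, pow_one]

lemma dcoord_zero_eq : dcoord K 1 0 = -tPowDt K 0 := by
  simp [dcoord, dbary, tPowDt, TensorProduct.tmul_neg]

lemma tPow_mem (n : ℕ) : tPow K n ∈ formsDeg K 1 0 := by
  have h : (1 : ExteriorAlgebra K (Fin 1 → K)) ∈ ⋀[K]^0 (Fin 1 → K) := by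
    change _ ∈ LinearMap.range (ExteriorAlgebra.ι K : (Fin 1 → K) →ₗ[K] _) ^ 0
    rw [pow_zero]
    exact Submodule.one_le.mp le_rfl
  exact ⟨(MvPolynomial.X 0 ^ n) ⊗ₜ ⟨1, h⟩, by simp [tPow]⟩

lemma tPowDt_mem (n : ℕ) : tPowDt K n ∈ formsDeg K 1 1 := by
  have h : ExteriorAlgebra.ι K (Pi.single 0 (1 : K) : Fin 1 → K) ∈ ⋀[K]^1 (Fin 1 → K) := by
    change _ ∈ LinearMap.range (ExteriorAlgebra.ι K : (Fin 1 → K) →ₗ[K] _) ^ 1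
    rw [pow_one]
    exact ⟨_, rfl⟩
  exact ⟨(MvPolynomial.X 0 ^ n) ⊗ₜ ⟨_, h⟩, by simp [tPowDt]⟩

lemma formsProj_of_mem {n q : ℕ} {a : Forms K n} (ha : a ∈ formsDeg K n q) :
    formsProj K n q a = a := by
  obtain ⟨b, rfl⟩ := ha
  rw [formsProj, ← LinearMap.comp_apply, ← LinearMap.lTensor_comp]
  refine congrArg (fun f => LinearMap.lTensor (MvPolynomial (Fin n) K) f b)
    (LinearMap.ext fun η => ?_)
  exact DirectSum.decompose_of_mem_same (fun i : ℕ => ⋀[K]^i (Fin n → K)) η.2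

lemma hasPolyDeriv_funPart (α : V ⊗[K] Forms K 1) :
    HasPolyDeriv (fun t => funPart t α) fun t =>
      dtPart t (LinearMap.lTensor V (extDeriv K 1) α) := by
  obtain ⟨p, q, rfl⟩ := exists_interval α
  refine ⟨p, fun t => by simp [funPart_intervalZero, funPart_intervalOne], fun t => ?_⟩
  have h0 : dtPart t (LinearMap.lTensor V (extDeriv K 1) (intervalZero p)) =
      polyEval t (polyDeriv (K := K) p) := by
    induction p using Finsupp.induction_linear with
    | zero => simp
    | add p p' hp hp' => simp only [map_add, hp, hp']
    | single n v => simp [smul_smul, mul_comm]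
  have h1 : LinearMap.lTensor V (extDeriv K 1) (intervalOne q) = 0 := by
    induction q using Finsupp.induction_linear with
    | zero => simp
    | add p p' hp hp' => simp only [map_add, hp, hp', add_zero]
    | single n v => simp
  simp only [map_add, h0, h1, add_zero]

/-- An element of `V ⊗ Ω_1` whose part of form degree `1` is constant. -/
lemma exists_of_dtPart_eq [CharZero K] {α : V ⊗[K] Forms K 1} {b : V}
    (h : ∀ t : K, dtPart t α = b) : ∃ p : ℕ →₀ V, α = intervalZero p + b ⊗ₜ tPowDt K 0 := by
  obtain ⟨p, q, rfl⟩ := exists_interval α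
  refine ⟨p, congrArg _ ?_⟩
  rw [← intervalOne_single]
  congr 1
  rw [← sub_eq_zero]
  refine eq_zero_of_polyEval (K := K) _ fun t => ?_
  have := h t
  rw [map_add, dtPart_intervalZero, dtPart_intervalOne, zero_add] at this
  rw [map_sub, this]
  simp

lemma map_intervalZero_eq_zero (P : V →ₗ[K] W) {T : Forms K 1 →ₗ[K] Forms K 1}
    (hT : ∀ n, T (tPow K n) = 0) (p : ℕ →₀ V) : TensorProduct.map P T (intervalZero p) = 0 := by
  induction p using Finsupp.induction_linear with
  | zero => simp
  | add p p' hp hp' => simp only [map_add, hp, hp', add_zero]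
  | single n v => simp [hT]

lemma funPart_map_formsProj (t : K) (P : V →ₗ[K] W) (q : ℕ) (α : V ⊗[K] Forms K 1) :
    funPart t (TensorProduct.map P (formsProj K 1 q) α) =
      if q = 0 then P (funPart t α) else 0 := by
  have : funPart t ∘ₗ TensorProduct.map P (formsProj K 1 q) =
      if q = 0 then P ∘ₗ funPart t else 0 := by
    refine interval_ext (fun v n => ?_) fun v n => ?_
    · split_ifs with h <;> simp [formsProj_tPow, h]
    · split_ifs with h <;> simp [formsProj_tPowDt, h]
      split_ifs <;> simp
  have := LinearMap.congr_fun this α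
  split_ifs at this ⊢ <;> exact this

lemma dtPart_map_formsProj (t : K) (P : V →ₗ[K] W) (q : ℕ) (α : V ⊗[K] Forms K 1) :
    dtPart t (TensorProduct.map P (formsProj K 1 q) α) =
      if q = 1 then P (dtPart t α) else 0 := by
  have : dtPart t ∘ₗ TensorProduct.map P (formsProj K 1 q) =
      if q = 1 then P ∘ₗ dtPart t else 0 := by
    refine interval_ext (fun v n => ?_) fun v n => ?_
    · split_ifs with h <;> simp [formsProj_tPow, h]
      split_ifs <;> simp
    · split_ifs with h <;> simp [formsProj_tPowDt, h]
  have := LinearMap.congr_fun this α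
  split_ifs at this ⊢ <;> exact this

lemma dtPart_map_poincareHomotopy (t : K) (P : V →ₗ[K] W) (α : V ⊗[K] Forms K 1) :
    dtPart t (TensorProduct.map P (poincareHomotopy K 1 0) α) = 0 := by
  have : dtPart t ∘ₗ TensorProduct.map P (poincareHomotopy K 1 0) = 0 :=
    interval_ext (fun v n => by simp) fun v n => by simp
  exact LinearMap.congr_fun this α

/-- The homotopy is integration from `0`, so differentiating afterwards recovers the coefficient of
`dt₁`; `P` carries the parity sign along. -/
lemma dtPart_extDeriv_poincareHomotopy [CharZero K] (t : K) (P : V →ₗ[K] W)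
    (α : V ⊗[K] Forms K 1) :
    dtPart t (LinearMap.lTensor W (extDeriv K 1)
      (TensorProduct.map P (poincareHomotopy K 1 0) α)) = P (dtPart t α) := by
  have : dtPart t ∘ₗ LinearMap.lTensor W (extDeriv K 1) ∘ₗ
      TensorProduct.map P (poincareHomotopy K 1 0) = P ∘ₗ dtPart t := by
    refine interval_ext (fun v n => by simp) fun v n => ?_
    have : ((n : K) + 1) ≠ 0 := by exact_mod_cast n.succ_ne_zero
    simp [smul_smul, this]
  exact LinearMap.congr_fun this α

lemma chainIntegral_tPow_of_ne {i : Fin 1 → Fin 2} (hi : i ≠ ![1]) :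
    chainIntegral K i (tPow K 1) = 0 := by
  have h0 : i 0 ≠ 1 := fun h => hi (funext fun j => by rw [Subsingleton.elim j 0, h]; rfl)
  have : (Finset.univ.filter fun j => i j = (0 : Fin 1).succ) = ∅ :=
    Finset.filter_eq_empty_iff.mpr fun j _ => by rw [Subsingleton.elim j 0]; exact h0
  simp only [chainIntegral, tPow, LinearMap.comp_apply, AlgHom.toLinearMap_apply, pullback,
    Algebra.TensorProduct.map_tmul, pow_one, MvPolynomial.aeval_X, this, Finset.sum_empty,
    TensorProduct.zero_tmul, map_zero]

lemma chainIntegral_one_tPow (i : Fin 2 → Fin 2) (n : ℕ) : chainIntegral K i (tPow K n) = 0 := by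
  have : topCoeff K 1 1 = 0 := by
    simp [topCoeff, ExteriorAlgebra.liftAlternating_one]
  simp [chainIntegral, simplexIntegral, tPow, pullback, this]

/-- The function `t₁` is the elementary form of the vertex `e_1`; it vanishes at `e_0`, and
functions have no integral over the edge. -/
lemma whitney_tPow_one : whitney K 1 (tPow K 1) = tPow K 1 := by
  classical
  have h1 : elementaryForm K (![1] : Fin 1 → Fin 2) = tPow K 1 := by
    simp [elementaryForm, coord_one_eq]
  rw [whitney, Finset.sum_range_succ, Finset.sum_range_one, LinearMap.add_apply,
    LinearMap.sum_apply, LinearMap.sum_apply]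
  rw [Finset.sum_eq_single_of_mem (![1] : Fin 1 → Fin 2)]
  · rw [LinearMap.smulRight_apply, chainIntegral_tPow, h1, one_smul, Finset.sum_eq_zero, add_zero]
    intro i _
    rw [LinearMap.smulRight_apply, chainIntegral_one_tPow, zero_smul]
  · simp
  · intro i _ hi
    rw [LinearMap.smulRight_apply, chainIntegral_tPow_of_ne hi, zero_smul]

/-- A gauge annihilates the form `dt_1` on the interval. -/
lemma Gauge.op_tPowDt_zero (s : Gauge K) : s.op 1 (tPowDt K 0) = 0 := by
  -- Since `t₁` is elementary and `s t₁ = 0`, the homotopy formula reduces to `s (d t₁) = 0`.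
  have h := s.contraction 1 (tPow K 1)
  rw [whitney_tPow_one, sub_self, s.op_zero_form 1 _ (tPow_mem 1), map_zero, zero_add] at h
  simpa using h.symm

end Interval

/-! ### The differential and the degrees of `𝔤 ⊗ Ω_1` in coordinates -/

namespace LInfinityAlgebra

variable {K : Type*} [Field K] {V : Type*} [AddCommGroup V] [Module K V]
  {𝒢 : ℤ → Submodule K V} [DirectSum.Decomposition 𝒢] (L : LInfinityAlgebra 𝒢)

lemma parity_of_mem {p : ℤ} {v : V} (hv : v ∈ 𝒢 p) :
    parity 𝒢 v = ((p.negOnePow : ℤ) : K) • v := by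
  rw [parity, LinearMap.comp_apply, LinearEquiv.coe_coe, DirectSum.decomposeLinearEquiv_apply,
    DirectSum.decompose_of_mem 𝒢 hv, ← DirectSum.lof_eq_of K, DirectSum.toModule_lof]
  rfl

lemma parity_of_mem_zero {v : V} (hv : v ∈ 𝒢 0) : parity 𝒢 v = v := by
  simp [parity_of_mem hv]

lemma parity_of_mem_one {v : V} (hv : v ∈ 𝒢 1) : parity 𝒢 v = -v := by
  simp [parity_of_mem hv]

lemma valueAt_zero_eq (α : V ⊗[K] Forms K 1) : valueAt (0 : Fin 2) α = funPart (0 : K) α := by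
  have : (TensorProduct.rid K V).toLinearMap ∘ₗ LinearMap.lTensor V (vertexEval K 1 0) =
      funPart (0 : K) := interval_ext (fun v n => by simp) fun v n => by simp
  exact LinearMap.congr_fun this α

lemma integralOne_eq (α : V ⊗[K] Forms K 1) : integralOne α = funPart (1 : K) α := by
  have : (TensorProduct.rid K V).toLinearMap ∘ₗ LinearMap.lTensor V (chainIntegral K ![1]) =
      funPart (1 : K) := interval_ext (fun v n => by simp) fun v n => by simp
  exact LinearMap.congr_fun this α

lemma bracket_one_apply (v : V) :
    (L.bracket 1).toLinearMap 0 0 v = listEval L.bracket [v] :=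
  listEval_of_get L.bracket (n := 1) _ [v] rfl fun i hi => by
    have : i = 0 := by simpa using hi
    subst this
    simp

lemma funPart_tensorDifferential (t : K) (α : V ⊗[K] Forms K 1) :
    funPart t (L.tensorDifferential 1 α) = listEval L.bracket [funPart t α] := by
  have : funPart t ∘ₗ L.tensorDifferential 1 = (L.bracket 1).toLinearMap 0 0 ∘ₗ funPart t := by
    refine interval_ext (fun v n => ?_) fun v n => ?_ <;>
      simp [tensorDifferential, -MultilinearMap.toLinearMap_apply]
  rw [← bracket_one_apply]
  exact LinearMap.congr_fun this α

lemma dtPart_tensorDifferential (t : K) (α : V ⊗[K] Forms K 1) :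
    dtPart t (L.tensorDifferential 1 α) = listEval L.bracket [dtPart t α] +
      parity 𝒢 (dtPart t (LinearMap.lTensor V (extDeriv K 1) α)) := by
  have : dtPart t ∘ₗ L.tensorDifferential 1 = (L.bracket 1).toLinearMap 0 0 ∘ₗ dtPart t +
      parity 𝒢 ∘ₗ dtPart t ∘ₗ LinearMap.lTensor V (extDeriv K 1) := by
    refine interval_ext (fun v n => ?_) fun v n => ?_ <;>
      simp [tensorDifferential, -MultilinearMap.toLinearMap_apply]
  rw [← bracket_one_apply]
  exact LinearMap.congr_fun this α

omit [DirectSum.Decomposition 𝒢] in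
lemma parts_mem_of_mem_tensorDeg {m : ℤ} {α : V ⊗[K] Forms K 1} (h : α ∈ tensorDeg 𝒢 1 m) (t : K) :
    funPart t α ∈ 𝒢 m ∧ dtPart t α ∈ 𝒢 (m - 1) := by
  have key : tensorDeg 𝒢 1 m ≤ (𝒢 m).comap (funPart t) ⊓ (𝒢 (m - 1)).comap (dtPart t) := by
    refine Submodule.span_le.mpr ?_
    rintro _ ⟨p, q, hpq, v, hv, a, ha, rfl⟩
    have h : v ⊗ₜ a = TensorProduct.map LinearMap.id (formsProj K 1 q) (v ⊗ₜ a) := by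
      rw [TensorProduct.map_tmul, formsProj_of_mem ha]
      rfl
    refine ⟨?_, ?_⟩
    · change funPart t (v ⊗ₜ a) ∈ 𝒢 m
      rw [h, funPart_map_formsProj]
      split_ifs with hq
      · subst hq
        obtain rfl : p = m := by simpa using hpq
        rw [funPart, fstCoeff_tmul]
        exact Submodule.smul_mem _ _ hv
      · exact zero_mem _
    · change dtPart t (v ⊗ₜ a) ∈ 𝒢 (m - 1)
      rw [h, dtPart_map_formsProj]
      split_ifs with hq
      · subst hq
        obtain rfl : p = m - 1 := by
          push_cast at hpq
          omega
        rw [dtPart, sndCoeff_tmul]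
        exact Submodule.smul_mem _ _ hv
      · exact zero_mem _
  exact key h

omit [DirectSum.Decomposition 𝒢] in
lemma tmul_tPow_mem_tensorDeg {v : V} (hv : v ∈ 𝒢 1) (n : ℕ) :
    v ⊗ₜ tPow K n ∈ tensorDeg 𝒢 1 1 :=
  Submodule.subset_span ⟨1, 0, by norm_num, v, hv, _, tPow_mem n, rfl⟩

omit [DirectSum.Decomposition 𝒢] in
lemma tmul_tPowDt_mem_tensorDeg {v : V} (hv : v ∈ 𝒢 0) (n : ℕ) :
    v ⊗ₜ tPowDt K n ∈ tensorDeg 𝒢 1 1 :=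
  Submodule.subset_span ⟨0, 1, by norm_num, v, hv, _, tPowDt_mem n, rfl⟩

end LInfinityAlgebra

/-! ### The Maurer–Cartan equation on the interval as a differential equation -/

namespace LInfinityAlgebra

variable {K : Type*} [Field K] {V : Type*} [AddCommGroup V] [Module K V]
  {𝒢 : ℤ → Submodule K V} [DirectSum.Decomposition 𝒢] (L : LInfinityAlgebra 𝒢)

lemma funPart_tensorMultiBracket (t : K) (k : ℕ) (α : V ⊗[K] Forms K 1) :
    funPart t (L.tensorMultiBracket 1 k fun _ => α) = L.bracket k fun _ => funPart t α := by
  simp only [tensorMultiBracket, _root_.sum_apply, MultilinearMap.compLinearMap_apply,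
    map_sum]
  rw [Finset.sum_eq_single_of_mem (0 : Fin k → Fin 2) (Finset.mem_univ _)]
  · rw [funPart, fstCoeff_tensorExtend]
    refine congrArg _ (funext fun j => ?_)
    exact (funPart_map_formsProj t _ _ α).trans (by simp; rfl)
  · intro p _ hp
    obtain ⟨j, hj⟩ := Function.ne_iff.mp hp
    rw [funPart, fstCoeff_tensorExtend]
    refine MultilinearMap.map_coord_zero _ j ?_
    refine (funPart_map_formsProj t _ _ α).trans (if_neg ?_)
    exact fun h => hj (Fin.ext h)

/-- One argument supplies `dt₁`, the others their function parts. The arguments to the right of it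
have degree `1` and move past `dt₁`, which changes their sign. -/
lemma dtPart_tensorMultiBracket (t : K) (k : ℕ) {α : V ⊗[K] Forms K 1}
    (h0 : funPart t α ∈ 𝒢 1) :
    dtPart t (L.tensorMultiBracket 1 k fun _ => α) =
      ∑ i : Fin k, L.bracket k (Function.update
        (fun j => if i < j then -funPart t α else funPart t α) i (dtPart t α)) := by
  simp only [tensorMultiBracket, _root_.sum_apply, MultilinearMap.compLinearMap_apply,
    map_sum]
  simp only [dtPart, sndCoeff_tensorExtend]
  rw [Finset.sum_comm]
  refine Finset.sum_congr rfl fun i _ => ?_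
  have hfun := fun (P : V →ₗ[K] V) q => funPart_map_formsProj t P q α
  have hdt := fun (P : V →ₗ[K] V) q => dtPart_map_formsProj t P q α
  rw [funPart] at hfun h0
  rw [dtPart] at hdt
  simp only [hfun, hdt]
  -- If slot `i` supplies `dt₁`, the only surviving tuple of form degrees is `1` at `i` and `0`
  -- elsewhere.
  rw [Finset.sum_eq_single_of_mem (Pi.single i 1 : Fin k → Fin 2) (Finset.mem_univ _)]
  · congr 1
    have hs : ∀ j, ∑ l with l < j, ((Pi.single i 1 : Fin k → Fin 2) l : ℕ) =
        if i < j then 1 else 0 := by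
      intro j
      rw [Finset.sum_filter, Finset.sum_eq_single_of_mem i (Finset.mem_univ _)]
      · simp
      · intro l _ hl
        simp [hl]
    ext j
    by_cases hj : j = i
    · subst hj
      simp [hs]
    · simp only [Function.update_of_ne hj, hs, Pi.single_eq_of_ne hj, Fin.val_zero, if_true]
      split_ifs with h
      · rw [pow_one, parity_of_mem_one h0]
        rfl
      · rfl
  · intro p _ hp
    obtain ⟨j, hj⟩ := Function.ne_iff.mp hp
    refine MultilinearMap.map_coord_zero _ j ?_
    by_cases h : j = i
    · subst h
      rw [Pi.single_eq_same] at hj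
      rw [Function.update_self, if_neg (show ¬(p j : ℕ) = 1 from fun h => hj (Fin.ext h))]
    · rw [Pi.single_eq_of_ne h] at hj
      rw [Function.update_of_ne h,
        if_neg (show ¬(p j : ℕ) = 0 from fun h => hj (Fin.ext h))]

/-- Moving `b` to the front gives `(-1)^i` and the negated entries give `(-1)^j`, so the total
depends only on `i + j`: every position of `dt₁` contributes the same. -/
lemma listEval_bracket_sign {N : ℕ} (hN : ∀ k ≥ N, L.bracket k = 0) {a b : V} (ha : a ∈ 𝒢 1)
    (hb : b ∈ 𝒢 0) (i j : ℕ) :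
    listEval L.bracket (List.replicate i a ++ b :: List.replicate j (-a)) =
      (-1 : K) ^ (i + j) • listEval L.bracket (b :: List.replicate (i + j) a) := by
  have h := L.zeroFamily_app hb hN
  have hl : List.replicate i a ++ List.replicate j (-a) =
      (List.replicate i (⟨a, ha⟩ : 𝒢 1) ++ List.replicate j (-(⟨a, ha⟩ : 𝒢 1))).map Subtype.val := by simp
  have hl' : List.replicate (i + j) a =
      (List.replicate (i + j) (⟨a, ha⟩ : 𝒢 1)).map Subtype.val := by simp
  rw [L.listEval_bracket_move hb ha, hl, ← h, hl', ← h, pow_add, mul_smul]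
  · congr 1
    rw [← Multiset.coe_add, Multiset.coe_replicate, Multiset.coe_replicate, add_comm,
      app_replicate_neg, Submodule.coe_smul, Multiset.coe_replicate, add_comm i j,
      Multiset.replicate_add]
  · intro y hy
    exact ⟨1, (List.eq_of_mem_replicate hy) ▸ neg_mem ha⟩

lemma dtPart_tensorMultiBracket_eq {N : ℕ} (hN : ∀ k ≥ N, L.bracket k = 0) (t : K) (l : ℕ)
    {α : V ⊗[K] Forms K 1} (h0 : funPart t α ∈ 𝒢 1) (h1 : dtPart t α ∈ 𝒢 0) :
    dtPart t (L.tensorMultiBracket 1 (l + 1) fun _ => α) =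
      ((l + 1 : ℕ) * (-1 : K) ^ l) •
        listEval L.bracket (dtPart t α :: List.replicate l (funPart t α)) := by
  rw [L.dtPart_tensorMultiBracket t _ h0, mul_smul, Nat.cast_smul_eq_nsmul]
  have : ∀ i ∈ (Finset.univ : Finset (Fin (l + 1))), L.bracket (l + 1) (Function.update
        (fun j => if i < j then -funPart t α else funPart t α) i (dtPart t α)) =
      (-1 : K) ^ l • listEval L.bracket (dtPart t α :: List.replicate l (funPart t α)) := by
    intro i _
    have hi := L.listEval_bracket_sign hN h0 h1 i (l - i)
    rw [show (i : ℕ) + (l - i) = l by omega] at hi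
    rw [← hi]
    refine listEval_of_get _ _ _ (by simp; omega) fun j hj => ?_
    have hj' : j < l + 1 := by
      simp at hj
      omega
    rcases lt_trichotomy j i with h | h | h
    · rw [List.getElem_append_left (by simpa using h), List.getElem_replicate,
        Function.update_of_ne (by simp [Fin.ext_iff]; omega),
        if_neg (by simp [Fin.lt_def]; omega)]
    · subst h
      rw [List.getElem_append_right (by simp)]
      simp
    · obtain ⟨c, rfl⟩ := Nat.exists_eq_add_of_lt h
      rw [List.getElem_append_right (by simp; omega),
        Function.update_of_ne (by simp [Fin.ext_iff]; omega),
        if_pos (by simp [Fin.lt_def])]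
      simp [show (i : ℕ) + c + 1 - i = c + 1 by omega]
  rw [Finset.sum_congr rfl this, Finset.sum_const, Finset.card_univ, Fintype.card_fin]

lemma finsum_eq_sum_range {X : Type*} [AddCommMonoid X] {F : ℕ → X} {N : ℕ}
    (h : ∀ k ≥ N, F k = 0) : ∑ᶠ k, F k = ∑ k ∈ Finset.range N, F k := by
  refine finsum_eq_sum_of_support_subset _ fun k hk => ?_
  by_contra hk'
  simp only [Finset.coe_range, Set.mem_Iio, not_lt] at hk'
  exact hk (h k hk')

lemma curvature_eq_sum {X : Type*} [AddCommGroup X] [Module K X] (b : ∀ k : ℕ, (Fin k → X) → X)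
    (α : X) {N : ℕ} (hN : ∀ k ≥ N, b (k + 1) (fun _ => α) = 0) :
    curvature (K := K) b α =
      ∑ l ∈ Finset.range N, ((l + 1)! : K)⁻¹ • b (l + 1) fun _ => α :=
  finsum_eq_sum_range fun l hl => by rw [hN l hl, smul_zero]

lemma oneFamily_tw_eq_sum {N : ℕ} (hN : ∀ k ≥ N, L.bracket k = 0) (a : 𝒢 1) :
    (L.oneFamily hN).tw a 0 = ∑ l ∈ Finset.range (N + 1), ((l + 1)! : K)⁻¹ •
      L.bracket (l + 1) fun _ => (a : V) := by
  rw [SymmFamily.tw_eq_sum _ _ _ (N := N + 1 + 1) (Nat.le_add_right N 2), Finset.sum_range_succ']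
  have h : ∀ l, (L.oneFamily hN).app (Multiset.replicate l a) =
      L.bracket l fun _ => (a : V) := fun l => by
    rw [SymmFamily.app_replicate]
    rfl
  simp only [add_zero, h, L.bracket_zero, zero_apply, smul_zero]

lemma curvature_bracket_eq {N : ℕ} (hN : ∀ k ≥ N, L.bracket k = 0) (a : 𝒢 1) :
    curvature (K := K) (fun k => L.bracket k) (a : V) = (L.oneFamily hN).tw a 0 := by
  rw [L.oneFamily_tw_eq_sum hN, curvature_eq_sum (N := N + 1)]
  intro k hk
  simp [hN (k + 1) (by omega)]

lemma curvature_tensorBracket {N : ℕ} (hN : ∀ k ≥ N, L.bracket k = 0) (α : V ⊗[K] Forms K 1) :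
    curvature (K := K) (L.tensorBracket 1) α = ∑ l ∈ Finset.range (N + 1),
      ((l + 1)! : K)⁻¹ • L.tensorBracket 1 (l + 1) fun _ => α := by
  refine curvature_eq_sum _ _ fun k hk => ?_
  rcases k with _ | k
  · omega
  · change L.tensorMultiBracket 1 (k + 2) _ = 0
    simp [tensorMultiBracket, hN (k + 2) (by omega)]

lemma funPart_curvature {N : ℕ} (hN : ∀ k ≥ N, L.bracket k = 0) (t : K) {α : V ⊗[K] Forms K 1}
    (h0 : funPart t α ∈ 𝒢 1) :
    funPart t (curvature (K := K) (L.tensorBracket 1) α) =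
      (L.oneFamily hN).tw ⟨funPart t α, h0⟩ 0 := by
  rw [L.curvature_tensorBracket hN, L.oneFamily_tw_eq_sum hN, map_sum]
  refine Finset.sum_congr rfl fun l _ => ?_
  rw [map_smul]
  congr 1
  rcases l with _ | l
  · exact (L.funPart_tensorDifferential t α).trans
      (listEval_ofFn L.bracket fun _ : Fin 1 => funPart t α)
  · exact L.funPart_tensorMultiBracket t (l + 2) α

/-- The `l + 1` equal positions of `dt₁` turn `1/(l + 1)!` into `1/l!`, and the signs `(-1)^l`
become the twist by `-A`. The first term comes from the de Rham part of the differential. -/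
lemma dtPart_curvature [CharZero K] {N : ℕ} (hN : ∀ k ≥ N, L.bracket k = 0) (t : K)
    {α : V ⊗[K] Forms K 1} (h0 : funPart t α ∈ 𝒢 1) (h1 : dtPart t α ∈ 𝒢 0) :
    dtPart t (curvature (K := K) (L.tensorBracket 1) α) =
      parity 𝒢 (dtPart t (LinearMap.lTensor V (extDeriv K 1) α)) +
      ((L.zeroFamily h1 hN).tw (-⟨funPart t α, h0⟩) 0 : 𝒢 1) := by
  have hB : (((L.zeroFamily h1 hN).tw (-⟨funPart t α, h0⟩) 0 : 𝒢 1) : V) =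
      ∑ l ∈ Finset.range (N + 1), (((l ! : ℕ) : K)⁻¹ * (-1) ^ l) •
        listEval L.bracket (dtPart t α :: List.replicate l (funPart t α)) := by
    rw [zeroFamily_tw_neg_zero, Finset.sum_range_succ,
      listEval_bracket_eq_zero hN _ (by simp), smul_zero, add_zero]
  rw [hB, L.curvature_tensorBracket hN, map_sum, Finset.sum_range_succ', Finset.sum_range_succ',
    ← add_assoc, add_comm (parity 𝒢 _) (Finset.sum _ _), add_assoc]
  congr 1
  · refine Finset.sum_congr rfl fun l _ => ?_
    rw [map_smul]
    change _ • dtPart t (L.tensorMultiBracket 1 (l + 1 + 1) fun _ => α) = _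
    rw [L.dtPart_tensorMultiBracket_eq hN t (l + 1) h0 h1, smul_smul, Nat.factorial_succ (l + 1)]
    congr 1
    have : ((l + 1 + 1 : ℕ) : K) ≠ 0 := by exact_mod_cast (l + 1).succ_ne_zero
    rw [Nat.cast_mul, mul_inv]
    field_simp
  · rw [map_smul]
    change _ • dtPart t (L.tensorDifferential 1 α) = _
    rw [L.dtPart_tensorDifferential]
    simp [add_comm]

variable {x : V}

lemma zeroFamily_tw_neg_element {N : ℕ} (hN : ∀ k ≥ N, L.bracket k = 0) (hx : x ∈ 𝒢 0) {b : V}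
    (hb : b ∈ 𝒢 0) (h : b = -x) (y : 𝒢 1) :
    (((L.zeroFamily hb hN).tw y 0 : 𝒢 1) : V) = -((L.zeroFamily hx hN).tw y 0 : 𝒢 1) := by
  obtain ⟨a, rfl⟩ : ∃ a, y = -a := ⟨-y, (neg_neg y).symm⟩
  rw [zeroFamily_tw_neg_zero, zeroFamily_tw_neg_zero, ← Finset.sum_neg_distrib]
  refine Finset.sum_congr rfl fun l _ => ?_
  rw [h, ← bracketHead_apply, ← bracketHead_apply, map_neg, smul_neg]

/-- The `dt₁` component of `(d + δ) h α` is that of `α`, the two parity signs being trivial in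
degree `0`. Conversely, if the component is `-x`, then `h α = -x ⊗ t₁` before `d + δ` is applied. -/
lemma potentialPart_eq_iff [CharZero K] {α : V ⊗[K] Forms K 1}
    (h1 : ∀ t : K, dtPart t α ∈ 𝒢 0) (hx : x ∈ 𝒢 0) :
    L.potentialPart (0 : Fin 2) α = -L.tensorDifferential 1 (x ⊗ₜ coord K 1 1) ↔
      ∀ t : K, dtPart t α = -x := by
  constructor
  · intro h t
    have := congrArg (dtPart t) h
    rw [potentialPart, oddExtend, dtPart_tensorDifferential, dtPart_map_poincareHomotopy,
      dtPart_extDeriv_poincareHomotopy, parity_of_mem_zero (h1 t), parity_of_mem_zero (h1 t),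
      ← bracketHead_apply, map_zero, zero_add, map_neg, dtPart_tensorDifferential, coord_one_eq] at this
    simpa [← bracketHead_apply, parity_of_mem_zero hx] using this
  · intro h
    obtain ⟨p, rfl⟩ := exists_of_dtPart_eq h
    rw [potentialPart, ← map_neg]
    congr 1
    rw [oddExtend, map_add, map_intervalZero_eq_zero _ poincareHomotopy_tPow, zero_add,
      TensorProduct.map_tmul, map_neg, parity_of_mem_zero hx, poincareHomotopy_tPowDt, coord_one_eq,
      TensorProduct.neg_tmul]
    simp

lemma oddExtend_gauge_eq_zero [CharZero K] (s : Gauge K) {α : V ⊗[K] Forms K 1} {b : V}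
    (h : ∀ t : K, dtPart t α = b) : oddExtend 𝒢 (s.op 1) α = 0 := by
  obtain ⟨p, rfl⟩ := exists_of_dtPart_eq h
  rw [oddExtend, map_add, map_intervalZero_eq_zero _ fun n => s.op_zero_form 1 _ (tPow_mem n),
    TensorProduct.map_tmul, s.op_tPowDt_zero, TensorProduct.tmul_zero, add_zero]

/-- The form part of degree `0` of a simplex `α_1^μ(x)` solves `A' = -[x]_A`. -/
lemma IsOneSimplex.exists_solution [CharZero K] {L : LInfinityAlgebra 𝒢} {s : Gauge K} {μ : V}
    {α : V ⊗[K] Forms K 1} (h : L.IsOneSimplex s μ x α) (hx : x ∈ 𝒢 0) (hμ : μ ∈ 𝒢 1) {N : ℕ}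
    (hN : ∀ k ≥ N, L.bracket k = 0) :
    (∀ t : K, dtPart t α = -x) ∧ ∃ Y : K → 𝒢 1, (∀ t, funPart t α = -(Y t : V)) ∧
      Y 0 = -⟨μ, hμ⟩ ∧ HasPolyDeriv Y fun t => (L.zeroFamily hx hN).tw (Y t) 0 := by
  obtain ⟨⟨⟨hdeg, hcurv⟩, -⟩, hval, hpot⟩ := h
  have h0 : ∀ t : K, funPart t α ∈ 𝒢 1 := fun t => (parts_mem_of_mem_tensorDeg hdeg t).1
  have h1 : ∀ t : K, dtPart t α ∈ 𝒢 0 := fun t => by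
    simpa using (parts_mem_of_mem_tensorDeg hdeg t).2
  have hdt := (L.potentialPart_eq_iff h1 hx).mp hpot
  refine ⟨hdt, fun t => -⟨funPart t α, h0 t⟩, fun t => by simp, ?_, ?_⟩
  · rw [neg_inj, Subtype.mk.injEq, ← hval, valueAt_zero_eq]
  -- A linear retraction onto the elements of degree `1` makes the function part a polynomial
  -- function with values in `𝒢 1`.
  · obtain ⟨π, hπ⟩ := (𝒢 1).subtype.exists_leftInverse_of_injective (𝒢 1).ker_subtype
    have hπ' : ∀ a : 𝒢 1, π a = a := fun a => LinearMap.congr_fun hπ a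
    have hA := hasPolyDeriv_funPart (K := K) α
    have hπA : ∀ t, π (funPart t α) = ⟨funPart t α, h0 t⟩ := fun t => hπ' ⟨_, h0 t⟩
    -- The function part is fixed by `π`, hence so is its derivative; its parity sign is therefore
    -- `-1`.
    have hA' : ∀ t, dtPart t (LinearMap.lTensor V (extDeriv K 1) α) =
        (π (dtPart t (LinearMap.lTensor V (extDeriv K 1) α)) : V) := by
      refine congrFun (hA.unique ?_)
      convert (hA.map π).map (𝒢 1).subtype using 2
      · rw [hπA]
        rfl
      · rfl
    convert (hA.map π).neg using 2
    · rw [hπA]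
    rename_i t
    have hc := congrArg (dtPart t) hcurv
    rw [L.dtPart_curvature hN t (h0 t) (h1 t), map_zero,
      L.zeroFamily_tw_neg_element hN hx (h1 t) (hdt t), hA' t, parity_of_mem_one (Subtype.property _),
      add_neg_eq_zero] at hc
    exact Subtype.ext hc.symm

/-- The value of a simplex `α_1^μ(x)` is characterized by a solution of `A' = -[x]_A`. -/
lemma isOneSimplex_of_solution [CharZero K] (s : Gauge K) {μ : V} (hx : x ∈ 𝒢 0) (hμ : μ ∈ 𝒢 1)
    (hL : L.IsNilpotent) (hμ' : μ ∈ L.maurerCartan) {N : ℕ} (hN : ∀ k ≥ N, L.bracket k = 0)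
    {α : V ⊗[K] Forms K 1} (hα : α ∈ tensorDeg 𝒢 1 1) (hdt : ∀ t : K, dtPart t α = -x)
    {Y : K → 𝒢 1} (hfun : ∀ t, funPart t α = -(Y t : V)) (hY0 : Y 0 = -⟨μ, hμ⟩)
    (hY : HasPolyDeriv Y fun t => (L.zeroFamily hx hN).tw (Y t) 0) : L.IsOneSimplex s μ x α := by
  have h0 : ∀ t : K, funPart t α ∈ 𝒢 1 := fun t => (parts_mem_of_mem_tensorDeg hα t).1
  have h1 : ∀ t : K, dtPart t α ∈ 𝒢 0 := fun t => by
    simpa using (parts_mem_of_mem_tensorDeg hα t).2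
  have hYα : ∀ t, (⟨funPart t α, h0 t⟩ : 𝒢 1) = -Y t := fun t => Subtype.ext (hfun t)
  refine ⟨⟨⟨hα, interval_eq_of_parts (fun t => ?_) fun t => ?_⟩, oddExtend_gauge_eq_zero s hdt⟩, ?_,
    (L.potentialPart_eq_iff h1 hx).mpr hdt⟩
  · rw [L.funPart_curvature hN t (h0 t), hYα, map_zero]
    refine L.curvature_solution_eq_zero hx hN hL hY ?_ t
    rw [hY0, neg_neg, ← curvature_bracket_eq]
    exact hμ'.2
  · have hA : (fun t => dtPart t (LinearMap.lTensor V (extDeriv K 1) α)) =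
        fun t => -((L.zeroFamily hx hN).tw (Y t) 0 : V) := by
      refine (hasPolyDeriv_funPart (K := K) α).unique ?_
      convert (hY.map (𝒢 1).subtype).neg using 2
      · exact hfun _
      · rfl
    rw [L.dtPart_curvature hN t (h0 t) (h1 t), map_zero,
      L.zeroFamily_tw_neg_element hN hx (h1 t) (hdt t), congrFun hA t, hYα, neg_neg,
      map_neg, parity_of_mem_one (Subtype.property _), neg_neg, add_neg_cancel]
  · rw [valueAt_zero_eq, hfun, hY0]
    simp

end LInfinityAlgebra

end LieTheory

end

/-! ### The closed formula for `α_1^μ(x)` and its consequences -/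

theorem mainTheorem9 {K : Type*} [Field K] [CharZero K] {V : Type*} [AddCommGroup V] [Module K V]
    (𝒢 : ℤ → Submodule K V) [DirectSum.Decomposition 𝒢]
    (L : LieTheory.LInfinityAlgebra 𝒢) (hL : L.IsNilpotent) (s : LieTheory.Gauge K)
    (μ : V) (hμ : μ ∈ L.maurerCartan) (x : V) (hx : x ∈ 𝒢 0) :
    -- the words of isomorphic rooted trees agree
    (∀ (k : ℕ) (S T : LieTheory.FinTree k), S ≈ T → S.word L μ x = T.word L μ x) ∧
    -- the sums below are finite
    (∃ N, ∀ k ≥ N, LieTheory.FinTree.expTerm L μ x k = 0) ∧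
    -- the `1`-simplex determined by `μ` and `x`
    (∀ α : V ⊗[K] LieTheory.Forms K 1, L.IsOneSimplex s μ x α ↔
      α = μ ⊗ₜ[K] (1 : LieTheory.Forms K 1)
        - (∑ᶠ k : ℕ, ((k + 1)! : K)⁻¹ •
            (LieTheory.FinTree.expTerm L μ x (k + 1) ⊗ₜ[K] (LieTheory.coord K 1 1 ^ (k + 1))))
        + x ⊗ₜ[K] LieTheory.dcoord K 1 0) ∧
    -- the closed formula for `ρ_1^μ(x)`
    (∀ α : V ⊗[K] LieTheory.Forms K 1, L.IsOneSimplex s μ x α →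
      LieTheory.LInfinityAlgebra.integralOne α =
        μ - ∑ᶠ k : ℕ, ((k + 1)! : K)⁻¹ • LieTheory.FinTree.expTerm L μ x (k + 1)) ∧
    -- the case of dg Lie algebras
    (L.IsDGLie →
      (∀ k : ℕ, LieTheory.FinTree.expTerm L μ x (k + 1) = (L.ad x)^[k] (L.covDiff μ x)) ∧
      ∀ α : V ⊗[K] LieTheory.Forms K 1, L.IsOneSimplex s μ x α →
        LieTheory.LInfinityAlgebra.integralOne α = L.gaugeAction x μ) := by
  obtain ⟨N, hN⟩ := hL.exists_bracket_eq_zero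
  obtain ⟨Y, hY, hY0, M, hM, hYM⟩ := L.exists_zeroFamily_solution hx hN hL hμ.1
  have hα : ∀ α : V ⊗[K] LieTheory.Forms K 1, L.IsOneSimplex s μ x α ↔
      (α = μ ⊗ₜ[K] (1 : LieTheory.Forms K 1)
        - (∑ᶠ k : ℕ, ((k + 1)! : K)⁻¹ •
            (LieTheory.FinTree.expTerm L μ x (k + 1) ⊗ₜ[K] (LieTheory.coord K 1 1 ^ (k + 1))))
        + x ⊗ₜ[K] LieTheory.dcoord K 1 0) := by
    rw [LieTheory.LInfinityAlgebra.finsum_eq_sum_range (N := M) fun k hk => by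
      rw [hM (k + 1) (by omega), TensorProduct.zero_tmul, smul_zero]]
    -- On the interval `dt_0 = -dt_1`, so the term `x dt_0` is the constant `dt₁` component `-x`.
    simp only [LieTheory.one_eq_tPow, LieTheory.coord_one_pow, LieTheory.dcoord_zero_eq]
    set β : V ⊗[K] LieTheory.Forms K 1 := μ ⊗ₜ[K] LieTheory.tPow K 0
        - (∑ k ∈ Finset.range M, ((k + 1)! : K)⁻¹ •
            (LieTheory.FinTree.expTerm L μ x (k + 1) ⊗ₜ[K] LieTheory.tPow K (k + 1)))
        + x ⊗ₜ[K] (-LieTheory.tPowDt K 0) with hβ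
    have hβ0 : ∀ t : K, LieTheory.funPart t β = -(Y t : V) := fun t => by
      rw [hYM, hβ, TensorProduct.tmul_neg]
      simp
    have hβ1 : ∀ t : K, LieTheory.dtPart t β = -x := fun t => by
      rw [hβ, TensorProduct.tmul_neg]
      simp
    intro α
    constructor
    · intro h
      obtain ⟨hdt, Z, hZ, hZ0, hZ'⟩ := h.exists_solution hx hμ.1 hN
      have : Z = Y := L.zeroFamily_solution_unique hx hN hL hZ' hY (hZ0.trans hY0.symm)
      subst this
      exact LieTheory.interval_eq_of_parts (fun t => by rw [hZ, hβ0])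
        fun t => by rw [hdt, hβ1]
    · rintro rfl
      refine L.isOneSimplex_of_solution s hx hμ.1 hL hμ hN ?_ hβ1 hβ0 hY0 hY
      refine add_mem (sub_mem (LieTheory.LInfinityAlgebra.tmul_tPow_mem_tensorDeg hμ.1 0)
        (sum_mem fun k _ => Submodule.smul_mem _ _ ?_)) ?_
      · refine LieTheory.LInfinityAlgebra.tmul_tPow_mem_tensorDeg ?_ _
        rw [L.expTerm_eq hx hN hμ.1]
        exact Subtype.property _
      · rw [TensorProduct.tmul_neg]
        exact neg_mem (LieTheory.LInfinityAlgebra.tmul_tPowDt_mem_tensorDeg hx 0)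
  have hρ : ∀ α : V ⊗[K] LieTheory.Forms K 1, L.IsOneSimplex s μ x α →
      LieTheory.LInfinityAlgebra.integralOne α =
        μ - ∑ᶠ k : ℕ, ((k + 1)! : K)⁻¹ • LieTheory.FinTree.expTerm L μ x (k + 1) := by
    intro α h
    obtain ⟨-, Z, hZ, hZ0, hZ'⟩ := h.exists_solution hx hμ.1 hN
    have : Z = Y := L.zeroFamily_solution_unique hx hN hL hZ' hY (hZ0.trans hY0.symm)
    subst this
    rw [LieTheory.LInfinityAlgebra.finsum_eq_sum_range (N := M) fun k hk => by
      rw [hM (k + 1) (by omega), smul_zero], LieTheory.LInfinityAlgebra.integralOne_eq, hZ, hYM]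
    simp
  refine ⟨fun k S T h => L.word_of_equiv hx hN hμ.1 h, ⟨M, hM⟩, hα, hρ, fun hD => ?_⟩
  have hk := L.expTerm_of_isDGLie hL hD hμ.1 hx
  refine ⟨hk, fun α h => (hρ α h).trans ?_⟩
  simp only [hk]
  rfl
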